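/- **Setting.** There are $M=2^L$ processes ($L\ge 1$), the leaves of a complete binary tree with levels $l=0$ (leaves) to $l=L=\log_2M$ (root). Exactly one process is anomalous, drawn from a prior; the nodes on the path from it to the root are anomalous and all other nodes are normal. In each time step one node of the tree is sampled; given the choices, the observations are independent, and an observation at a level-$l$ node has density $f_l(\cdot\mid\theta_0^{(l)})$ if the node is normal ($\theta_0^{(l)}$ known) and $f_l(\cdot\mid\theta_1^{(l)})$ if it is anomalous, with $\theta_1^{(l)}$ an unknown element of a known set $\Theta_1^{(l)}$. Densities are strictly positive. The level models ($l=0,1,2,\dots$) do not depend on $M$. $D_l$ is the Kullback–Leibler divergence at level $l$. A policy $\pi$ chooses the next node, a stopping time $\tau$ and a final decision from the data collected so far; its Bayesian risk at cost $c\in(0,1)$ is $R(\pi)=P_{\rm Err}(\pi)+c\,\mathbb E[\tau]$, averaged over the prior. **HDS.** The search starts at the root. At a node of level $l>0$ it takes $K_{l-1}$ samples from each child and computes for each the generalized log-likelihood ratio of the maximum likelihood estimate over $\Theta_1^{(l-1)}$ against $\theta_0^{(l-1)}$; if at least one ratio is strictly positive it moves to the child with the larger ratio (any fixed rule for equality),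 otherwise to the parent (the parent of the root is the root). At a leaf it draws $N_0$ samples to initialize the maximum likelihood estimate over $\Theta_1^{(0)}$, and then samples $y(1),y(2),\dots$ sequentially and updates $\tilde S(n)=\sum_{i\le n}\log\frac{f_0(y(i)\mid\hat\theta(i-1))}{f_0(y(i)\mid\theta_0^{(0)})}$, where $\hat\theta(i-1)$ uses all samples of this leaf test before $y(i)$. It stops and declares the leaf anomalous if $\tilde S(n)>\log\frac{\log_2M}{c}$, and moves to the parent if $\tilde S(n)<0$. **Theorem.** Suppose that for some $\Delta>0$: $D_l(\theta_0^{(l)}\|\theta)\ge\Delta$ and $D_l(\theta\|\theta_0^{(l)})\ge\Delta$ for all $l$ and all $\theta\in\Theta_1^{(l)}$; that every $\Theta_1^{(l)}$ is finite and non-empty; and that for $\theta\in\Theta_1^{(0)}$ the log-likelihood ratio $\log\frac{f_0(\cdot\mid\theta)}{f_0(\cdot\mid\theta_0^{(0)})}$ has a finite second moment under $f_0(\cdot\mid\theta)$. Then: 1. For every level $l$ and every $q<1$, all sufficiently large $k$ have the property that an internal test with $k$ samples from each of two children at level $l$ moves in the direction of the anomaly with probability at least $q$ (to the anomalous child, or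 to the parent if neither child is anomalous), whichever node is anomalous and whatever $\theta_1^{(l)}\in\Theta_1^{(l)}$. If $|\Theta_1^{(l)}|$ and the second moments of the log-likelihood ratios of $\theta\in\Theta_1^{(l)}$ against $\theta_0^{(l)}$, under both parameters, are bounded uniformly in $l$, then the same $k$ serve all levels. 2. There is $n_0$ such that the following holds for all $N_0\ge n_0$ and all bounded sequences $(K_l)$ for which, for some $\eta>0$, the internal tests move in the direction of the anomaly with probability at least $\frac12+\eta$ at every level. There are constants $C,B$, independent of $M$, $c$, the prior and $\theta_1$, with $$R(\mathrm{HDS})\le c\,C\log_2M+\frac{c\log\frac{\log_2M}{c}}{D_0(\theta_1^{(0)}\|\theta_0^{(0)})}+B\,c\qquad\text{for all } M=2^L,\ L\ge1,\ c\in(0,1),$$ where $0<D_0(\theta_1^{(0)}\|\theta_0^{(0)})<\infty$. 3. With $n_0,N_0,(K_l)$ as in 2, HDS is asymptotically optimal in $c$: for fixed $M$, a prior giving positive mass to every process, and $\theta_1$ with $D_0(\theta_0^{(0)}\|\theta_1^{(0)})\le D_0(\theta_1^{(0)}\|\theta_0^{(0)})$, one has $\lim_{c\to0}R(\mathrm{HDS})/R^*=1$,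 where $R^*$ is the infimum of the risk over all policies, even those that know $\theta_1$. 4. With $n_0,N_0,(K_l)$ as in 2, HDS is order-optimal in $M$: under the uniform prior, for every $c\in(0,1)$ and $\varepsilon<1$ there is $B'$ independent of $M$ and $\theta_1$ such that $R(\mathrm{HDS})\le B'\,R(\pi)$ for every $M=2^L$, $L\ge1$, and every policy $\pi$ with error probability at most $\varepsilon$. -/

import Mathlib

open MeasureTheory
open scoped ENNReal

namespace HDS

noncomputable section

/-- A family of observation models indexed by the tree level `l` (`l = 0` for the leaves):
parametric densities `f l θ` with respect to a reference measure `ν l`, the known normal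
parameter `θ₀ l`, and the set `Θ₁ l` of anomalous parameters. The densities are strictly
positive, so that all log-likelihood ratios are finite. -/
structure Model (Y P : Type*) [MeasurableSpace Y] where
  ν : ℕ → Measure Y
  f : ℕ → P → Y → ℝ
  measurable_f : ∀ l θ, Measurable (f l θ)
  f_pos : ∀ l θ y, 0 < f l θ y
  lintegral_f : ∀ l θ, ∫⁻ y, ENNReal.ofReal (f l θ y) ∂(ν l) = 1
  θ₀ : ℕ → P
  Θ₁ : ℕ → Set P

variable {Y P : Type*} [MeasurableSpace Y]

/-- The observation law at level `l` under parameter `θ`. -/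
def Model.law (S : Model Y P) (l : ℕ) (θ : P) : Measure Y :=
  (S.ν l).withDensity (fun y => ENNReal.ofReal (S.f l θ y))

instance (S : Model Y P) (l : ℕ) (θ : P) : IsProbabilityMeasure (S.law l θ) :=
  ⟨by rw [Model.law, withDensity_apply _ MeasurableSet.univ, setLIntegral_univ, S.lintegral_f]⟩

/-- `D_l(θ ‖ θ')`. -/
def Model.kl (S : Model Y P) (l : ℕ) (θ θ' : P) : ℝ≥0∞ :=
  InformationTheory.klDiv (S.law l θ) (S.law l θ')

/-- Normal and anomalous observations are `Δ`-separated in both Kullback-Leibler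
divergences, at every level. -/
def Model.KLSeparated (S : Model Y P) (Δ : ℝ) : Prop :=
  ∀ l, ∀ θ ∈ S.Θ₁ l,
    ENNReal.ofReal Δ ≤ S.kl l (S.θ₀ l) θ ∧ ENNReal.ofReal Δ ≤ S.kl l θ (S.θ₀ l)

/-- The log-likelihood ratio of `θ` against the normal parameter at one observation. -/
def Model.llr (S : Model Y P) (l : ℕ) (θ : P) (y : Y) : ℝ :=
  Real.log (S.f l θ y / S.f l (S.θ₀ l) y)

/-- Likelihood of a finite sample. -/
def Model.lik (S : Model Y P) (l : ℕ) (θ : P) (ys : List Y) : ℝ :=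
  (ys.map (S.f l θ)).prod

/-- `est` is a (measurable) maximum likelihood estimator over the anomalous parameters,
for every level and every sample size; ties are broken in any measurable way. -/
structure Model.IsMLE (S : Model Y P) (est : ℕ → List Y → P) : Prop where
  mem : ∀ l ys, est l ys ∈ S.Θ₁ l
  max : ∀ l ys, ∀ θ ∈ S.Θ₁ l, S.lik l θ ys ≤ S.lik l (est l ys) ys
  meas : ∀ l t θ, MeasurableSet {y : Fin t → Y | est l (List.ofFn y) = θ}

/-! ### The binary tree -/

/-- Nodes of the complete binary tree of height `L`. A node is given by its path from the
root, last step first: `[]` is the root and the children of `p` are `b :: p`. -/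
abbrev Node (L : ℕ) := {p : List Bool // p.length ≤ L}

/-- The processes are the `2 ^ L` leaves. -/
abbrev Leaf (L : ℕ) := List.Vector Bool L

/-- Level of a node: leaves have level `0`, the root has level `L`. -/
def Node.level {L : ℕ} (p : Node L) : ℕ := L - p.1.length

/-- The parent of a node; the parent of the root is the root. -/
def Node.parent {L : ℕ} (p : Node L) : Node L :=
  ⟨p.1.tail, le_trans (by simp) p.2⟩

/-- The child of an internal node in direction `b` (`false` = left, `true` = right);
a leaf is left unchanged. -/
def Node.child {L : ℕ} (p : Node L) (b : Bool) : Node L :=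
  if h : p.1.length < L then ⟨b :: p.1, by simpa using h⟩ else p

def Node.root (L : ℕ) : Node L := ⟨[], Nat.zero_le _⟩

/-- Law of an observation at node `p` when `m` is the anomalous process and `θ l` is the
parameter of the anomalous node at level `l`: the nodes on the path from `m` to the root are
anomalous, all others are normal. -/
def nodeLaw (S : Model Y P) {L : ℕ} (θ : ℕ → P) (m : Leaf L) (p : Node L) : Measure Y :=
  S.law p.level (if p.1 <:+ m.1 then θ p.level else S.θ₀ p.level)

instance (S : Model Y P) {L : ℕ} (θ : ℕ → P) (m : Leaf L) (p : Node L) :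
    IsProbabilityMeasure (nodeLaw S θ m p) := by
  unfold nodeLaw; infer_instance

/-- Law of the array of independent potential observations: coordinate `(t, p)` is what is
observed if node `p` is sampled at time `t`. -/
def obsLaw (S : Model Y P) {L : ℕ} (θ : ℕ → P) (m : Leaf L) : Measure (ℕ × Node L → Y) :=
  Measure.infinitePi (fun i : ℕ × Node L => nodeLaw S θ m i.2)

/-! ### Active search policies and their Bayesian risk -/

/-- An active search policy: selection, stopping and decision rules, all functions of the
data collected so far (oldest observation first). The decision is a Boolean vector. -/
structure Policy (L : ℕ) (Y : Type*) where
  select : List Y → Node L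
  halt : List Y → Prop
  decision : List Y → Leaf L → Bool

/-- Measurability of the three rules, for every number of observations. -/
structure Policy.IsMeasurable {L : ℕ} (π : Policy L Y) : Prop where
  select : ∀ t p, MeasurableSet {y : Fin t → Y | π.select (List.ofFn y) = p}
  halt : ∀ t, MeasurableSet {y : Fin t → Y | π.halt (List.ofFn y)}
  decision : ∀ t d, MeasurableSet {y : Fin t → Y | π.decision (List.ofFn y) = d}

/-- The data collected in the first `t` time steps when sampling goes on indefinitely. -/
def Policy.data {L : ℕ} {Y : Type*} (π : Policy L Y) (ω : ℕ × Node L → Y) : ℕ → List Y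
  | 0 => []
  | t + 1 => π.data ω t ++ [ω (t, π.select (π.data ω t))]

/-- The stopping time `τ`: the first time at which the stopping rule holds (`∞` if none). -/
def Policy.stopTime {L : ℕ} {Y : Type*} (π : Policy L Y) (ω : ℕ × Node L → Y) : ℝ≥0∞ :=
  ⨅ (t : ℕ) (_ : π.halt (π.data ω t)), (t : ℝ≥0∞)

/-- The search stops, and the decision declares exactly the process `m` anomalous. -/
def Policy.Correct {L : ℕ} {Y : Type*} (π : Policy L Y) (m : Leaf L)
    (ω : ℕ × Node L → Y) : Prop :=
  ∃ t, π.halt (π.data ω t) ∧ (∀ s < t, ¬ π.halt (π.data ω s)) ∧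
    π.decision (π.data ω t) = fun k => decide (k = m)

/-- Error probability, averaged over the prior of the anomalous process. -/
def errProb (S : Model Y P) {L : ℕ} (θ : ℕ → P) (prior : PMF (Leaf L)) (π : Policy L Y) :
    ℝ≥0∞ :=
  ∑ m, prior m * obsLaw S θ m {ω | ¬ π.Correct m ω}

/-- Sample complexity: expected stopping time, averaged over the prior. -/
def sampleComplexity (S : Model Y P) {L : ℕ} (θ : ℕ → P) (prior : PMF (Leaf L))
    (π : Policy L Y) : ℝ≥0∞ :=
  ∑ m, prior m * ∫⁻ ω, π.stopTime ω ∂(obsLaw S θ m)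

/-- Bayesian risk with cost `c` per observation. -/
def risk (S : Model Y P) {L : ℕ} (θ : ℕ → P) (prior : PMF (Leaf L)) (c : ℝ)
    (π : Policy L Y) : ℝ≥0∞ :=
  errProb S θ prior π + ENNReal.ofReal c * sampleComplexity S θ prior π

/-- The smallest Bayesian risk over all policies (which may use the knowledge of `θ`). -/
def optRisk (S : Model Y P) {L : ℕ} (θ : ℕ → P) (prior : PMF (Leaf L)) (c : ℝ) : ℝ≥0∞ :=
  ⨅ (π : Policy L Y) (_ : π.IsMeasurable), risk S θ prior c π

/-! ### Hierarchical dynamic search -/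

/-- Generalized log-likelihood ratio of a sample from a node at level `l`. -/
def gllr (S : Model Y P) (est : ℕ → List Y → P) (l : ℕ) (ys : List Y) : ℝ :=
  (ys.map (S.llr l (est l ys))).sum

/-- Internal test with samples `a`, `b` from the left and the right child, which are at level
`l`: `none` is the move to the parent, `some d` the move to the child in direction `d`. -/
def internalMove (S : Model Y P) (est : ℕ → List Y → P) (l : ℕ) (a b : List Y) :
    Option Bool :=
  if gllr S est l a ≤ 0 ∧ gllr S est l b ≤ 0 then none
  else if gllr S est l a < gllr S est l b then some true
  else some false

/-- Probability that the internal test with `k` samples from each child makes the move `mv`,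
when the left and right child (at level `l`) have parameters `θa` and `θb`. -/
def moveProb (S : Model Y P) (est : ℕ → List Y → P) (l k : ℕ) (θa θb : P)
    (mv : Option Bool) : ℝ :=
  ((Measure.pi (fun _ : Fin k => S.law l θa)).prod
    (Measure.pi (fun _ : Fin k => S.law l θb))).real
      {z | internalMove S est l (List.ofFn z.1) (List.ofFn z.2) = mv}

/-- With `k` samples from each child (at level `l`), the internal test moves in the direction
of the anomaly with probability at least `q`, wherever the anomaly is. -/
def InternalTestGood (S : Model Y P) (est : ℕ → List Y → P) (l k : ℕ) (q : ℝ) : Prop :=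
  q ≤ moveProb S est l k (S.θ₀ l) (S.θ₀ l) none ∧
  ∀ θ ∈ S.Θ₁ l, q ≤ moveProb S est l k θ (S.θ₀ l) (some false) ∧
    q ≤ moveProb S est l k (S.θ₀ l) θ (some true)

/-- The adaptive log-likelihood ratio of the samples collected in the current leaf test: the
first `N₀` samples only initialize the estimate, and every later sample is weighed with the
estimate from all the samples before it. -/
def allr (S : Model Y P) (est : ℕ → List Y → P) (N₀ : ℕ) (ys : List Y) : ℝ :=
  ∑ i : Fin ys.length,
    if N₀ ≤ (i : ℕ) then S.llr 0 (est 0 (ys.take i)) (ys.get i) else 0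

/-- State of the search: the inspected node, the samples collected since the search arrived
there (oldest first), and whether the inspected leaf has been declared anomalous. -/
structure SearchState (L : ℕ) (Y : Type*) where
  node : Node L
  buf : List Y
  done : Bool

/-- Effect of one observation `y` on the state. At an internal node whose children are at
level `l`, the first `K l` samples are from the left child and the next `K l` from the right
child. -/
def searchStep (S : Model Y P) (est : ℕ → List Y → P) (K : ℕ → ℕ) (N₀ : ℕ) (c : ℝ)
    {L : ℕ} (s : SearchState L Y) (y : Y) : SearchState L Y :=
  let buf := s.buf ++ [y]
  if s.done then s
  else if s.node.1.length < L then
    let l := s.node.level - 1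
    if buf.length < 2 * K l then { s with buf := buf }
    else
      match internalMove S est l (buf.take (K l)) (buf.drop (K l)) with
      | none => ⟨s.node.parent, [], false⟩
      | some d => ⟨s.node.child d, [], false⟩
  else if buf.length ≤ N₀ then { s with buf := buf }
  else if Real.log (L / c) < allr S est N₀ buf then ⟨s.node, buf, true⟩
  else if allr S est N₀ buf < 0 then ⟨s.node.parent, [], false⟩
  else { s with buf := buf }

/-- State after the data `ys`; the search starts at the root. -/
def searchState (S : Model Y P) (est : ℕ → List Y → P) (K : ℕ → ℕ) (N₀ : ℕ) (c : ℝ)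
    (L : ℕ) (ys : List Y) : SearchState L Y :=
  ys.foldl (searchStep S est K N₀ c) ⟨Node.root L, [], false⟩

/-- The hierarchical dynamic search policy. -/
def hds (S : Model Y P) (est : ℕ → List Y → P) (K : ℕ → ℕ) (N₀ : ℕ) (c : ℝ) (L : ℕ) :
    Policy L Y where
  select ys :=
    let s := searchState S est K N₀ c L ys
    s.node.child (decide (K (s.node.level - 1) ≤ s.buf.length))
  halt ys := (searchState S est K N₀ c L ys).done = true
  decision ys m := decide (m.1 = (searchState S est K N₀ c L ys).node.1)

end

end HDS

/-!
The search is analysed by one-step drift inequalities on the current state (inspected node and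
samples collected there), never through stopping-time theory; the lower bounds come from a
backward induction over the same dynamic-programming recursion `value`.

*Internal tests.* For distinct laws the Bhattacharyya coefficient is less than one, so by
Chernoff's inequality a wrong sign of a sum of `k` log-likelihood ratios has exponentially small
probability; as the parameter sets are finite, a union bound controls the generalized ratio.
A lower bound on the divergence and an upper bound on the second moment of the log-likelihood
ratio bound the coefficient away from one, which makes the sample size uniform over the levels
(`Model.bhatt_le_of_secondMoment`, `Model.IsMLE.exists_internalTestGood_uniform`).

*Risk bound.* Every internal test is a step of a walk on the tree that approaches the anomalous
leaf with probability at least `1 / 2 + η`, and a normal leaf is left for its parent unless it is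
wrongly declared. The potential of a state (`searchPotential`) is affine in the distance from
the anomalous leaf, plus a term for the progress of the running test. At a normal leaf the
exponential of the adaptive statistic is a martingale started at one, which bounds the cost of a
wrong declaration by `1 / L` in units of `c`, and its square root decreases geometrically in
mean, which bounds the length of the test (`normalLeaf_drift`). At the anomalous leaf the remaining number of
samples is `(b - s) / D` for a threshold `b = log (L / c)` and a current value `s`, where `D` is
the divergence. Three corrections turn this into a supersolution: one for the overshoot,
needed because only a second moment is available (`exists_overshoot_correction`), one for the
probability that the statistic becomes negative (`exists_ruinBound`), and one for the samples at
which the estimate is wrong, which is exponentially small in the number of samples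
(`Model.IsMLE.exists_anomalousLeaf_potential`). The verification principle
`Policy.IsMeasurable.cost_le` then gives the risk bound, with the exact coefficient `1 / D`.

*Optimality for small cost.* The laws under an anomalous leaf and under its sibling differ at
these two leaves only, where each observation carries information at most `D`. Applying the
Donsker-Varadhan inequality (`Model.integral_log_le`) at every step of the recursion shows that a
policy with error probability `α` needs about `log (1 / α) / D` observations
(`mul_prob_correct_le`), and this matches the leading term of the risk bound.

*Optimality for many processes.* An observation has only two possible laws, so it at most
doubles the sum over all processes of the probability that the process is declared correctly
(`sum_value_declares_le`). Hence `n` observations identify about `2 ^ n` of the `2 ^ L`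
processes, and the sample complexity is at least of order `L`.
-/

namespace HDS

/-! ### Measurability on the space of finite data sequences -/

section ListMeasurability

variable {Y Z W : Type*} [MeasurableSpace Y] [MeasurableSpace Z] [MeasurableSpace W]

/-- The `σ`-algebra of the disjoint union `⋃ t, Y ^ t` on finite sequences: a set is measurable
when its trace on the sequences of each length is. With it, the length-by-length measurability
conditions on policies and estimators become ordinary measurability. -/
instance instMeasurableSpaceList : MeasurableSpace (List Y) :=
  ⨅ t : ℕ, MeasurableSpace.map (List.ofFn : (Fin t → Y) → List Y) MeasurableSpace.pi

lemma measurableSet_list_iff {A : Set (List Y)} :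
    MeasurableSet A ↔ ∀ t, MeasurableSet {y : Fin t → Y | List.ofFn y ∈ A} := by
  simp only [MeasurableSpace.measurableSet_iInf]
  rfl

lemma measurable_list_of_ofFn {F : List Y → Z}
    (h : ∀ t, Measurable fun y : Fin t → Y => F (List.ofFn y)) : Measurable F :=
  fun _ hA => measurableSet_list_iff.2 fun t => h t hA

lemma measurable_ofFn (t : ℕ) : Measurable (List.ofFn : (Fin t → Y) → List Y) :=
  fun _ hA => measurableSet_list_iff.1 hA t

lemma measurableEmbedding_ofFn (t : ℕ) :
    MeasurableEmbedding (List.ofFn : (Fin t → Y) → List Y) where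
  injective := List.ofFn_injective
  measurable := measurable_ofFn t
  measurableSet_image' := by
    intro A hA
    refine measurableSet_list_iff.2 fun s => ?_
    by_cases hst : s = t
    · subst hst
      simpa [List.ofFn_injective.eq_iff] using hA
    · convert MeasurableSet.empty
      ext y
      simp only [Set.mem_ofPred_eq, Set.mem_image, Set.mem_empty_iff_false, iff_false]
      rintro ⟨z, -, hz⟩
      exact hst (by simpa using (congrArg List.length hz).symm)

lemma measurable_list_prod {G : List Y × Z → W}
    (h : ∀ t, Measurable fun q : (Fin t → Y) × Z => G (List.ofFn q.1, q.2)) :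
    Measurable G := by
  intro A hA
  have key : G ⁻¹' A = ⋃ t : ℕ, Prod.map (List.ofFn : (Fin t → Y) → List Y) (id : Z → Z) ''
      ((fun q : (Fin t → Y) × Z => G (List.ofFn q.1, q.2)) ⁻¹' A) := by
    ext ⟨ys, z⟩
    simp only [Set.mem_preimage, Set.mem_iUnion, Set.mem_image, Prod.exists, Prod.map_apply,
      id, Prod.mk.injEq]
    constructor
    · intro hG
      exact ⟨ys.length, ys.get, z, by simpa using hG, by simp, rfl⟩
    · rintro ⟨t, y, z', hG, rfl, rfl⟩
      exact hG
  rw [key]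
  exact MeasurableSet.iUnion fun t =>
    ((measurableEmbedding_ofFn t).prodMap MeasurableEmbedding.id).measurableSet_image' (h t hA)

lemma ofFn_append_singleton {Y : Type*} {t : ℕ} (y : Fin t → Y) (z : Y) :
    List.ofFn y ++ [z] = List.ofFn (Fin.snoc y z : Fin (t + 1) → Y) := by
  rw [List.ofFn_succ']
  simp [List.concat_eq_append]

lemma measurable_append_singleton : Measurable fun q : List Y × Y => q.1 ++ [q.2] := by
  refine measurable_list_prod fun t => ?_
  simp only [ofFn_append_singleton]
  refine (measurable_ofFn (t + 1)).comp (measurable_pi_lambda _ fun i => ?_)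
  refine Fin.lastCases ?_ (fun j => ?_) i
  · simpa using measurable_snd
  · simp only [Fin.snoc_castSucc]
    exact (measurable_pi_apply j).comp measurable_fst

lemma measurable_append_right (ys : List Y) : Measurable fun y : Y => ys ++ [y] :=
  measurable_append_singleton.comp measurable_prodMk_left

lemma measurable_list_length : Measurable (List.length : List Y → ℕ) :=
  measurable_list_of_ofFn fun t => by simp

lemma measurable_list_take (k : ℕ) : Measurable (List.take k : List Y → List Y) := by
  refine measurable_list_of_ofFn fun t => ?_
  have : (fun y : Fin t → Y => (List.ofFn y).take k) =
      fun y => List.ofFn fun i : Fin (min k t) => y ⟨i, by omega⟩ := by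
    ext1 y
    apply List.ext_getElem <;> simp
  rw [this]
  exact (measurable_ofFn _).comp (measurable_pi_lambda _ fun i => measurable_pi_apply _)

lemma measurable_list_drop (k : ℕ) : Measurable (List.drop k : List Y → List Y) := by
  refine measurable_list_of_ofFn fun t => ?_
  have : (fun y : Fin t → Y => (List.ofFn y).drop k) =
      fun y => List.ofFn fun i : Fin (t - k) => y ⟨k + i, by omega⟩ := by
    ext1 y
    apply List.ext_getElem <;> simp
  rw [this]
  exact (measurable_ofFn _).comp (measurable_pi_lambda _ fun i => measurable_pi_apply _)

lemma measurable_list_map_sum {g : Y → ℝ} (hg : Measurable g) :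
    Measurable fun ys : List Y => (ys.map g).sum := by
  refine measurable_list_of_ofFn fun t => ?_
  simp only [List.map_ofFn, List.sum_ofFn]
  exact Finset.measurable_sum _ fun i _ => hg.comp (measurable_pi_apply i)

lemma measurable_list_map_prod {g : Y → ℝ} (hg : Measurable g) :
    Measurable fun ys : List Y => (ys.map g).prod := by
  refine measurable_list_of_ofFn fun t => ?_
  simp only [List.map_ofFn, List.prod_ofFn]
  exact Finset.measurable_prod _ fun i _ => hg.comp (measurable_pi_apply i)

instance [MeasurableSingletonClass Y] : MeasurableSingletonClass (List Y) where
  measurableSet_singleton ys := by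
    refine measurableSet_list_iff.2 fun t => ?_
    refine Set.Subsingleton.measurableSet fun a ha b hb => List.ofFn_injective ?_
    simp only [Set.mem_singleton_iff, Set.mem_ofPred_eq] at ha hb
    rw [ha, hb]

end ListMeasurability

section Statistics

variable {Y P : Type*} [MeasurableSpace Y] {S : Model Y P} {est : ℕ → List Y → P}

lemma Model.measurable_llr (S : Model Y P) (l : ℕ) (θ : P) : Measurable (S.llr l θ) :=
  Real.measurable_log.comp ((S.measurable_f l θ).div (S.measurable_f l _))

lemma Model.IsMLE.measurableSet_eq (hest : S.IsMLE est) (l : ℕ) (θ : P) :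
    MeasurableSet {ys | est l ys = θ} :=
  measurableSet_list_iff.2 fun t => hest.meas l t θ

/-- A statistic that depends on the data through the estimate and, once the estimate is
fixed, measurably on the data, is measurable: the estimator takes finitely many values. -/
lemma Model.IsMLE.measurable_comp (hest : S.IsMLE est) {l : ℕ} (hfin : (S.Θ₁ l).Finite)
    {Z : Type*} [MeasurableSpace Z] {X : Type*} [MeasurableSpace X] {h : Z → List Y}
    (hh : Measurable h) {F : P → Z → X}
    (hF : ∀ θ, Measurable (F θ)) : Measurable fun z => F (est l (h z)) z := by
  intro A hA
  have : (fun z => F (est l (h z)) z) ⁻¹' A =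
      ⋃ θ ∈ S.Θ₁ l, (h ⁻¹' {ys | est l ys = θ}) ∩ (F θ ⁻¹' A) := by
    ext z
    simp only [Set.mem_preimage, Set.mem_iUnion, Set.mem_inter_iff, Set.mem_ofPred_eq]
    constructor
    · intro hz
      exact ⟨_, hest.mem l (h z), rfl, hz⟩
    · rintro ⟨θ, -, rfl, hz⟩
      exact hz
  rw [this]
  exact MeasurableSet.biUnion hfin.countable fun θ _ =>
    (hh (hest.measurableSet_eq l θ)).inter (hF θ hA)

lemma Model.IsMLE.measurable_gllr (hest : S.IsMLE est) {l : ℕ} (hfin : (S.Θ₁ l).Finite) :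
    Measurable (gllr S est l) :=
  hest.measurable_comp hfin measurable_id (F := fun θ ys => (ys.map (S.llr l θ)).sum)
    fun θ => measurable_list_map_sum (S.measurable_llr l θ)

lemma allr_nil (S : Model Y P) (est : ℕ → List Y → P) (N₀ : ℕ) : allr S est N₀ [] = 0 := by
  simp [allr]

lemma allr_append_singleton (S : Model Y P) (est : ℕ → List Y → P) (N₀ : ℕ) (ys : List Y)
    (y : Y) : allr S est N₀ (ys ++ [y]) =
      allr S est N₀ ys + if N₀ ≤ ys.length then S.llr 0 (est 0 ys) y else 0 := by
  have h : (ys ++ [y]).length = ys.length + 1 := by simp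
  unfold allr
  rw [← Equiv.sum_comp (finCongr h).symm, Fin.sum_univ_castSucc]
  congr 1
  · refine Finset.sum_congr rfl fun i _ => ?_
    have hi := i.2
    simp [List.take_append_of_le_length hi.le, List.getElem_append_left hi]
  · simp

lemma allr_eq_zero (S : Model Y P) (est : ℕ → List Y → P) {N₀ : ℕ} {ys : List Y}
    (h : ys.length ≤ N₀) : allr S est N₀ ys = 0 := by
  unfold allr
  refine Finset.sum_eq_zero fun i _ => if_neg ?_
  have := i.2
  omega

lemma Model.IsMLE.measurable_allr (hest : S.IsMLE est) (hfin : (S.Θ₁ 0).Finite) (N₀ : ℕ) :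
    Measurable (allr S est N₀) := by
  refine measurable_list_of_ofFn fun t => ?_
  induction t with
  | zero => simp [allr_nil]
  | succ t ih =>
    have hinit : Measurable fun y : Fin (t + 1) → Y => (Fin.init y : Fin t → Y) :=
      measurable_pi_lambda _ fun i => measurable_pi_apply _
    have : (fun y : Fin (t + 1) → Y => allr S est N₀ (List.ofFn y)) = fun y =>
        allr S est N₀ (List.ofFn (Fin.init y : Fin t → Y)) +
          if N₀ ≤ t then S.llr 0 (est 0 (List.ofFn (Fin.init y : Fin t → Y))) (y (Fin.last t))
          else 0 := by
      ext1 y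
      conv_lhs => rw [← Fin.snoc_init_self y, ← ofFn_append_singleton, allr_append_singleton]
      simp
    rw [this]
    refine (ih.comp hinit).add ?_
    split_ifs
    · exact hest.measurable_comp hfin ((measurable_ofFn t).comp hinit)
        (F := fun θ (y : Fin (t + 1) → Y) => S.llr 0 θ (y (Fin.last t)))
        fun θ => (S.measurable_llr 0 θ).comp (measurable_pi_apply _)
    · exact measurable_const

end Statistics

/-! ### Measurability of the hierarchical dynamic search -/

section SearchMeasurability

variable {Y P : Type*} [MeasurableSpace Y] {L : ℕ}

instance instMeasurableSpaceSearchState : MeasurableSpace (SearchState L Y) :=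
  MeasurableSpace.comap (fun s => (s.node, s.buf, s.done)) inferInstance

lemma measurable_searchState_mk (p : Node L) (d : Bool) :
    Measurable fun buf : List Y => (⟨p, buf, d⟩ : SearchState L Y) :=
  measurable_comap_iff.2 (measurable_const.prodMk (measurable_id.prodMk measurable_const))

lemma measurable_searchState_prod {Z W : Type*} [MeasurableSpace Z] [MeasurableSpace W]
    {F : SearchState L Y × Z → W}
    (h : ∀ p d, Measurable fun q : List Y × Z => F (⟨p, q.1, d⟩, q.2)) : Measurable F := by
  have h1 : Measurable fun r : (Node L × Bool) × (List Y × Z) =>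
      F (⟨r.1.1, r.2.1, r.1.2⟩, r.2.2) :=
    measurable_from_prod_countable_right fun r => h r.1 r.2
  have hs : Measurable fun s : SearchState L Y => (s.node, s.buf, s.done) :=
    comap_measurable _
  have h2 : Measurable fun q : SearchState L Y × Z =>
      (((q.1.node, q.1.done), (q.1.buf, q.2)) : (Node L × Bool) × (List Y × Z)) := by
    have h3 : Measurable fun q : SearchState L Y × Z => (q.1.node, q.1.buf, q.1.done) :=
      hs.comp measurable_fst
    exact (h3.fst.prodMk h3.snd.snd).prodMk (h3.snd.fst.prodMk measurable_snd)
  exact h1.comp h2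

lemma measurable_searchState {W : Type*} [MeasurableSpace W] {F : SearchState L Y → W}
    (h : ∀ p d, Measurable fun buf : List Y => F ⟨p, buf, d⟩) : Measurable F :=
  (measurable_searchState_prod (Z := Unit) (F := fun q => F q.1)
    fun p d => (h p d).comp measurable_fst).comp
    (measurable_id.prodMk (measurable_const (a := ())))

variable {S : Model Y P} {est : ℕ → List Y → P}

lemma measurable_internalMove_comp {W : Type*} [MeasurableSpace W] (hest : S.IsMLE est) {l : ℕ}
    (hfin : (S.Θ₁ l).Finite) {a b : W → List Y} (ha : Measurable a) (hb : Measurable b)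
    (mv : Option Bool) : MeasurableSet {w | internalMove S est l (a w) (b w) = mv} := by
  have ga := (hest.measurable_gllr hfin).comp ha
  have gb := (hest.measurable_gllr hfin).comp hb
  have h1 : MeasurableSet {w | gllr S est l (a w) ≤ 0 ∧ gllr S est l (b w) ≤ 0} :=
    (measurableSet_le ga measurable_const).inter (measurableSet_le gb measurable_const)
  have h2 : MeasurableSet {w | gllr S est l (a w) < gllr S est l (b w)} :=
    measurableSet_lt ga gb
  rcases mv with _ | _ | _
  · convert h1 using 3 with w
    unfold internalMove
    split_ifs <;> simp_all
  · convert h1.compl.inter h2.compl using 1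
    ext w
    simp only [internalMove, Set.mem_ofPred_eq, Set.mem_inter_iff, Set.mem_compl_iff]
    split_ifs <;> simp_all
  · convert h1.compl.inter h2 using 1
    ext w
    simp only [internalMove, Set.mem_ofPred_eq, Set.mem_inter_iff, Set.mem_compl_iff]
    split_ifs <;> simp_all

lemma measurable_searchStep (hest : S.IsMLE est) (hfin : ∀ l, (S.Θ₁ l).Finite) (K : ℕ → ℕ)
    (N₀ : ℕ) (c : ℝ) :
    Measurable fun q : SearchState L Y × Y => searchStep S est K N₀ c q.1 q.2 := by
  refine measurable_searchState_prod fun p d => ?_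
  rcases d with _ | _
  swap
  · simp only [searchStep, if_true]
    exact (measurable_searchState_mk p true).comp measurable_fst
  have key : Measurable fun buf : List Y =>
      (if p.1.length < L then
        if buf.length < 2 * K (p.level - 1) then (⟨p, buf, false⟩ : SearchState L Y)
        else if internalMove S est (p.level - 1) (buf.take (K (p.level - 1)))
            (buf.drop (K (p.level - 1))) = none then ⟨p.parent, [], false⟩
        else if internalMove S est (p.level - 1) (buf.take (K (p.level - 1)))
            (buf.drop (K (p.level - 1))) = some false then ⟨p.child false, [], false⟩
        else ⟨p.child true, [], false⟩
      else if buf.length ≤ N₀ then ⟨p, buf, false⟩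
      else if Real.log (L / c) < allr S est N₀ buf then ⟨p, buf, true⟩
      else if allr S est N₀ buf < 0 then ⟨p.parent, [], false⟩
      else ⟨p, buf, false⟩) := by
    have ha := hest.measurable_allr (hfin 0) N₀
    refine Measurable.ite (MeasurableSet.const _) ?_ ?_
    · refine Measurable.ite (measurable_list_length measurableSet_Iio)
        (measurable_searchState_mk _ _) ?_
      refine Measurable.ite (measurable_internalMove_comp hest (hfin _) (measurable_list_take _)
        (measurable_list_drop _) _) measurable_const ?_
      exact Measurable.ite (measurable_internalMove_comp hest (hfin _) (measurable_list_take _)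
        (measurable_list_drop _) _) measurable_const measurable_const
    · refine Measurable.ite (measurable_list_length measurableSet_Iic)
        (measurable_searchState_mk _ _) ?_
      refine Measurable.ite (ha measurableSet_Ioi) (measurable_searchState_mk _ _) ?_
      exact Measurable.ite (ha measurableSet_Iio) measurable_const
        (measurable_searchState_mk _ _)
  convert key.comp measurable_append_singleton using 1
  ext1 ⟨buf, y⟩
  simp only [searchStep, Function.comp_apply]
  rcases internalMove S est (p.level - 1) ((buf ++ [y]).take (K (p.level - 1)))
    ((buf ++ [y]).drop (K (p.level - 1))) with _ | _ | _ <;> simp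

lemma searchState_append_singleton (S : Model Y P) (est : ℕ → List Y → P) (K : ℕ → ℕ) (N₀ : ℕ)
    (c : ℝ) (ys : List Y) (y : Y) : searchState S est K N₀ c L (ys ++ [y]) =
      searchStep S est K N₀ c (searchState S est K N₀ c L ys) y := by
  simp [searchState, List.foldl_append]

lemma measurable_searchState_data (hest : S.IsMLE est) (hfin : ∀ l, (S.Θ₁ l).Finite)
    (K : ℕ → ℕ) (N₀ : ℕ) (c : ℝ) : Measurable (searchState S est K N₀ c L) := by
  refine measurable_list_of_ofFn fun t => ?_
  induction t with
  | zero => simp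
  | succ t ih =>
    have hinit : Measurable fun y : Fin (t + 1) → Y => (Fin.init y : Fin t → Y) :=
      measurable_pi_lambda _ fun i => measurable_pi_apply _
    have : (fun y : Fin (t + 1) → Y => searchState S est K N₀ c L (List.ofFn y)) = fun y =>
        searchStep S est K N₀ c (searchState S est K N₀ c L
          (List.ofFn (Fin.init y : Fin t → Y))) (y (Fin.last t)) := by
      ext1 y
      conv_lhs => rw [← Fin.snoc_init_self y, ← ofFn_append_singleton,
        searchState_append_singleton]
    rw [this]
    exact (measurable_searchStep hest hfin K N₀ c).comp
      ((ih.comp hinit).prodMk (measurable_pi_apply _))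

lemma hds_isMeasurable (hest : S.IsMLE est) (hfin : ∀ l, (S.Θ₁ l).Finite)
    (K : ℕ → ℕ) (N₀ : ℕ) (c : ℝ) (L : ℕ) : (hds S est K N₀ c L).IsMeasurable where
  select t p := by
    have h : Measurable fun s : SearchState L Y =>
        s.node.child (decide (K (s.node.level - 1) ≤ s.buf.length)) :=
      measurable_searchState fun q _ => (measurable_from_top
        (f := fun n => q.child (decide (K (q.level - 1) ≤ n)))).comp measurable_list_length
    exact (h.comp ((measurable_searchState_data hest hfin K N₀ c).comp (measurable_ofFn t)))
      (measurableSet_singleton p)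
  halt t := by
    have h : Measurable fun s : SearchState L Y => s.done :=
      measurable_searchState fun _ _ => measurable_const
    exact (h.comp ((measurable_searchState_data hest hfin K N₀ c).comp (measurable_ofFn t)))
      (measurableSet_singleton true)
  decision t d := by
    have h : Measurable fun s : SearchState L Y => s.node :=
      measurable_searchState fun _ _ => measurable_const
    exact (h.comp ((measurable_searchState_data hest hfin K N₀ c).comp (measurable_ofFn t)))
      (MeasurableSet.of_discrete (s := {q : Node L | (fun m : Leaf L => decide (m.1 = q.1)) = d}))

end SearchMeasurability

/-! ### The law of the data collected by a policy -/

section DataLaw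

open ProbabilityTheory

variable {Y P : Type*} [MeasurableSpace Y] {L : ℕ} {S : Model Y P} {θ : ℕ → P} {m : Leaf L}
  {π : Policy L Y}

instance : Finite (Node L) := (List.finite_length_le Bool L).to_subtype

instance : IsProbabilityMeasure (obsLaw S θ m) := by unfold obsLaw; infer_instance

lemma Model.nonempty (S : Model Y P) : Nonempty Y :=
  nonempty_of_isProbabilityMeasure (S.law 0 (S.θ₀ 0))

lemma Policy.IsMeasurable.measurable_select (hπ : π.IsMeasurable) : Measurable π.select :=
  measurable_list_of_ofFn fun t => measurable_to_countable' fun p => hπ.select t p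

lemma Policy.IsMeasurable.measurableSet_halt (hπ : π.IsMeasurable) :
    MeasurableSet {ys | π.halt ys} :=
  measurableSet_list_iff.2 hπ.halt

lemma Policy.IsMeasurable.measurableSet_decision (hπ : π.IsMeasurable) (d : Leaf L → Bool) :
    MeasurableSet {ys | π.decision ys = d} :=
  measurableSet_list_iff.2 fun t => hπ.decision t d

lemma Policy.data_congr {Y : Type*} (π : Policy L Y) {ω ω' : ℕ × Node L → Y} {t : ℕ}
    (h : ∀ i : ℕ × Node L, i.1 < t → ω i = ω' i) : π.data ω t = π.data ω' t := by
  induction t with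
  | zero => rfl
  | succ t ih =>
    have h1 := ih fun i hi => h i (by omega)
    simp only [Policy.data, h1, h (t, π.select (π.data ω' t)) (Nat.lt_succ_self t)]

lemma Policy.length_data {Y : Type*} (π : Policy L Y) (ω : ℕ × Node L → Y) (t : ℕ) :
    (π.data ω t).length = t := by
  induction t with
  | zero => rfl
  | succ t ih => simp [Policy.data, ih]

lemma Policy.IsMeasurable.measurable_obs (hπ : π.IsMeasurable) (t : ℕ)
    (h : Measurable fun ω => π.data ω t) :
    Measurable fun ω : ℕ × Node L → Y => ω (t, π.select (π.data ω t)) := by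
  have h1 : Measurable fun q : Node L × (ℕ × Node L → Y) => q.2 (t, q.1) :=
    measurable_from_prod_countable_right fun p => measurable_pi_apply (t, p)
  exact h1.comp ((hπ.measurable_select.comp h).prodMk measurable_id)

lemma Policy.IsMeasurable.measurable_data (hπ : π.IsMeasurable) (t : ℕ) :
    Measurable fun ω => π.data ω t := by
  induction t with
  | zero => exact measurable_const
  | succ t ih => exact measurable_append_singleton.comp (ih.prodMk (hπ.measurable_obs t ih))

/-- The data collected before time `t` are independent of the potential observations at
time `t`, because they are a function of the earlier coordinates only. -/
lemma Policy.IsMeasurable.indepFun_data (hπ : π.IsMeasurable) (t : ℕ) (p : Node L) :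
    IndepFun (fun ω => π.data ω t) (fun ω => ω (t, p)) (obsLaw S θ m) := by
  have hind : iIndepFun (fun (i : ℕ × Node L) (ω : ℕ × Node L → Y) => ω i) (obsLaw S θ m) :=
    iIndepFun_infinitePi (X := fun _ y => y) fun _ => measurable_id
  have h := indep_iSup_of_disjoint
    (m := fun i : ℕ × Node L => MeasurableSpace.comap (fun ω : ℕ × Node L → Y => ω i) inferInstance)
    (fun i => (measurable_pi_apply i).comap_le) hind
    (S := {i | i.1 < t}) (T := {(t, p)}) (by simp)
  rw [IndepFun_iff_Indep]
  refine indep_of_indep_of_le_left (indep_of_indep_of_le_right h ?_) ?_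
  · exact le_iSup₂_of_le (t, p) rfl le_rfl
  · obtain ⟨y₀⟩ := S.nonempty
    classical
    let r : (ℕ × Node L → Y) → (ℕ × Node L → Y) := fun ω i => if i.1 < t then ω i else y₀
    have hr : Measurable[⨆ i ∈ {i : ℕ × Node L | i.1 < t},
        MeasurableSpace.comap (fun ω : ℕ × Node L → Y => ω i) inferInstance] r := by
      refine @measurable_pi_lambda _ _ _ (_) _ _ fun i => ?_
      by_cases hi : i.1 < t
      · simp only [r, hi, if_true]
        exact measurable_iff_comap_le.2 (le_iSup₂_of_le i hi le_rfl)
      · simp only [r, hi, if_false]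
        exact @measurable_const _ _ _ (_) _
    have hd : (fun ω => π.data ω t) = (fun ω => π.data ω t) ∘ r := by
      ext1 ω
      exact π.data_congr fun i hi => by simp [r, hi]
    rw [hd]
    exact ((hπ.measurable_data t).comp hr).comap_le

/-- Given the data, the next observation follows the law of the selected node. -/
lemma Policy.IsMeasurable.lintegral_next (hπ : π.IsMeasurable) (t : ℕ)
    {F : List Y → Y → ℝ≥0∞} (hF : Measurable (Function.uncurry F)) :
    ∫⁻ ω, F (π.data ω t) (ω (t, π.select (π.data ω t))) ∂obsLaw S θ m =
      ∫⁻ ω, ∫⁻ y, F (π.data ω t) y ∂nodeLaw S θ m (π.select (π.data ω t)) ∂obsLaw S θ m := by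
  classical
  have := Fintype.ofFinite (Node L)
  have hX := hπ.measurable_data t
  let G : Node L → List Y → Y → ℝ≥0∞ := fun p ys y => if π.select ys = p then F ys y else 0
  have hG : ∀ p, Measurable (Function.uncurry (G p)) := fun p =>
    Measurable.ite (measurable_fst (hπ.measurable_select (measurableSet_singleton p))) hF
      measurable_const
  have hmap : ∀ p, (obsLaw S θ m).map (fun ω => ω (t, p)) = nodeLaw S θ m p := fun p =>
    Measure.infinitePi_map_eval (fun i : ℕ × Node L => nodeLaw S θ m i.2) (t, p)
  have key : ∀ p, ∫⁻ ω, G p (π.data ω t) (ω (t, p)) ∂obsLaw S θ m =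
      ∫⁻ ω, ∫⁻ y, G p (π.data ω t) y ∂nodeLaw S θ m p ∂obsLaw S θ m := by
    intro p
    have h1 := (indepFun_iff_map_prod_eq_prod_map_map hX.aemeasurable
      (measurable_pi_apply (t, p)).aemeasurable).1
      (hπ.indepFun_data (S := S) (θ := θ) (m := m) t p)
    calc ∫⁻ ω, G p (π.data ω t) (ω (t, p)) ∂obsLaw S θ m
        = ∫⁻ q, Function.uncurry (G p) q
            ∂(obsLaw S θ m).map (fun ω => (π.data ω t, ω (t, p))) :=
          (lintegral_map (hG p) (hX.prodMk (measurable_pi_apply _))).symm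
      _ = ∫⁻ ys, ∫⁻ y, G p ys y ∂nodeLaw S θ m p ∂(obsLaw S θ m).map (fun ω => π.data ω t) := by
          rw [h1, hmap, lintegral_prod _ (hG p).aemeasurable]
          rfl
      _ = _ := lintegral_map (hG p).lintegral_prod_right' hX
  have e1 : ∀ ω, F (π.data ω t) (ω (t, π.select (π.data ω t))) =
      ∑ p, G p (π.data ω t) (ω (t, p)) := fun ω => by
    simp [G]
  have e2 : ∀ ω, ∫⁻ y, F (π.data ω t) y ∂nodeLaw S θ m (π.select (π.data ω t)) =
      ∑ p, ∫⁻ y, G p (π.data ω t) y ∂nodeLaw S θ m p := fun ω => by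
    rw [Finset.sum_eq_single (π.select (π.data ω t))]
    · simp [G]
    · intro p _ hp
      simp [G, hp.symm]
    · simp
  simp_rw [e1, e2]
  have m1 : ∀ p, Measurable fun ω : ℕ × Node L → Y => G p (π.data ω t) (ω (t, p)) := fun p =>
    (hG p).comp (hX.prodMk (measurable_pi_apply (t, p)))
  have m2 : ∀ p, Measurable fun ω => ∫⁻ y, G p (π.data ω t) y ∂nodeLaw S θ m p := fun p =>
    (hG p).lintegral_prod_right'.comp hX
  rw [lintegral_finsetSum _ fun p _ => m1 p, lintegral_finsetSum _ fun p _ => m2 p]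
  exact Finset.sum_congr rfl fun p _ => key p

end DataLaw

/-! ### Stopping and the dynamic-programming recursion -/

section Value

variable {Y P : Type*} [MeasurableSpace Y] {L : ℕ} {S : Model Y P} {θ : ℕ → P} {m : Leaf L}
  {π : Policy L Y}

/-- The policy has not stopped before time `t`. -/
def Policy.Alive {Y : Type*} (π : Policy L Y) (t : ℕ) (ω : ℕ × Node L → Y) : Prop :=
  ∀ s < t, ¬ π.halt (π.data ω s)

/-- The policy stops exactly at time `t`. -/
def Policy.StopsAt {Y : Type*} (π : Policy L Y) (t : ℕ) (ω : ℕ × Node L → Y) : Prop :=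
  π.Alive t ω ∧ π.halt (π.data ω t)

lemma Policy.alive_zero {Y : Type*} (π : Policy L Y) (ω : ℕ × Node L → Y) : π.Alive 0 ω :=
  fun _ h => absurd h (Nat.not_lt_zero _)

lemma Policy.alive_succ {Y : Type*} {π : Policy L Y} {t : ℕ} {ω : ℕ × Node L → Y} :
    π.Alive (t + 1) ω ↔ π.Alive t ω ∧ ¬ π.halt (π.data ω t) := by
  simp only [Policy.Alive, Nat.lt_succ_iff_lt_or_eq]
  exact ⟨fun h => ⟨fun s hs => h s (Or.inl hs), h t (Or.inr rfl)⟩,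
    fun h s hs => hs.elim (h.1 s) fun e => e ▸ h.2⟩

lemma Policy.take_data {Y : Type*} (π : Policy L Y) (ω : ℕ × Node L → Y) {s t : ℕ}
    (h : s ≤ t) : (π.data ω t).take s = π.data ω s := by
  induction t, h using Nat.le_induction with
  | base => exact List.take_of_length_le (π.length_data ω s).le
  | succ t hst ih =>
    rw [Policy.data, List.take_append_of_le_length (by rw [π.length_data]; exact hst), ih]

/-- Being alive at time `t + 1`, read off from the data at time `t`. -/
def Policy.ListAlive {Y : Type*} (π : Policy L Y) (ys : List Y) : Prop :=
  ∀ s, s ≤ ys.length → ¬ π.halt (ys.take s)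

lemma Policy.listAlive_data {Y : Type*} {π : Policy L Y} {t : ℕ} {ω : ℕ × Node L → Y} :
    π.ListAlive (π.data ω t) ↔ π.Alive (t + 1) ω := by
  simp only [Policy.ListAlive, Policy.Alive, π.length_data, Nat.lt_succ_iff]
  refine forall₂_congr fun s hs => ?_
  rw [π.take_data ω hs]

lemma Policy.IsMeasurable.measurableSet_listAlive (hπ : π.IsMeasurable) :
    MeasurableSet {ys | π.ListAlive ys} := by
  have : {ys | π.ListAlive ys} =
      ⋂ s : ℕ, {ys : List Y | s ≤ ys.length}ᶜ ∪ (List.take s ⁻¹' {ys | π.halt ys})ᶜ := by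
    ext ys
    simp [Policy.ListAlive, imp_iff_not_or]
  rw [this]
  exact MeasurableSet.iInter fun s => (measurable_list_length measurableSet_Ici).compl.union
    (measurable_list_take s hπ.measurableSet_halt).compl

lemma Policy.IsMeasurable.measurableSet_alive (hπ : π.IsMeasurable) (t : ℕ) :
    MeasurableSet {ω | π.Alive t ω} := by
  cases t with
  | zero => simp [Policy.alive_zero]
  | succ t =>
    simp only [← Policy.listAlive_data]
    exact hπ.measurable_data t hπ.measurableSet_listAlive

lemma Policy.IsMeasurable.measurableSet_stopsAt (hπ : π.IsMeasurable) (t : ℕ) :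
    MeasurableSet {ω | π.StopsAt t ω} :=
  (hπ.measurableSet_alive t).inter (hπ.measurable_data t hπ.measurableSet_halt)

open Classical in
/-- Expected cost-to-go within `n` steps when the data are `ys`: `c` per observation and the
terminal cost `ψ` if the policy stops; nothing is charged at the horizon. -/
noncomputable def value (S : Model Y P) (θ : ℕ → P) (m : Leaf L) (π : Policy L Y) (c : ℝ≥0∞)
    (ψ : List Y → ℝ≥0∞) : ℕ → List Y → ℝ≥0∞
  | 0, _ => 0
  | n + 1, ys => if π.halt ys then ψ ys
      else c + ∫⁻ y, value S θ m π c ψ n (ys ++ [y]) ∂nodeLaw S θ m (π.select ys)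

lemma Policy.IsMeasurable.measurable_lintegral_next (hπ : π.IsMeasurable)
    {V : List Y → ℝ≥0∞} (hV : Measurable V) :
    Measurable fun ys => ∫⁻ y, V (ys ++ [y]) ∂nodeLaw S θ m (π.select ys) := by
  have h0 : ∀ p, Measurable fun ys : List Y => ∫⁻ y, V (ys ++ [y]) ∂nodeLaw S θ m p := fun p =>
    Measurable.lintegral_prod_right' (f := fun q : List Y × Y => V (q.1 ++ [q.2]))
      (hV.comp measurable_append_singleton)
  intro A hA
  have : (fun ys => ∫⁻ y, V (ys ++ [y]) ∂nodeLaw S θ m (π.select ys)) ⁻¹' A =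
      ⋃ p, π.select ⁻¹' {p} ∩ (fun ys => ∫⁻ y, V (ys ++ [y]) ∂nodeLaw S θ m p) ⁻¹' A := by
    ext ys
    simp
  rw [this]
  exact MeasurableSet.iUnion fun p =>
    (hπ.measurable_select (measurableSet_singleton p)).inter (h0 p hA)

lemma Policy.IsMeasurable.measurable_value (hπ : π.IsMeasurable) {c : ℝ≥0∞}
    {ψ : List Y → ℝ≥0∞} (hψ : Measurable ψ) (n : ℕ) : Measurable (value S θ m π c ψ n) := by
  induction n with
  | zero => exact measurable_const
  | succ n ih =>
    exact Measurable.ite hπ.measurableSet_halt hψ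
      (measurable_const.add (hπ.measurable_lintegral_next ih))

open Classical in
/-- The value recursion computes the expected cost along the sample path. -/
lemma Policy.IsMeasurable.value_nil (hπ : π.IsMeasurable) {c : ℝ≥0∞}
    {ψ : List Y → ℝ≥0∞} (hψ : Measurable ψ) (n : ℕ) :
    value S θ m π c ψ n [] =
      ∑ s ∈ Finset.range n, (∫⁻ ω, (if π.StopsAt s ω then ψ (π.data ω s) else 0) ∂obsLaw S θ m +
        c * obsLaw S θ m {ω | π.Alive (s + 1) ω}) := by
  have key : ∀ k j, value S θ m π c ψ (j + k) [] =
      ∑ s ∈ Finset.range k, (∫⁻ ω, (if π.StopsAt s ω then ψ (π.data ω s) else 0) ∂obsLaw S θ m +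
        c * obsLaw S θ m {ω | π.Alive (s + 1) ω}) +
      ∫⁻ ω, (if π.Alive k ω then value S θ m π c ψ j (π.data ω k) else 0) ∂obsLaw S θ m := by
    intro k
    induction k with
    | zero => intro j; simp [Policy.alive_zero, Policy.data]
    | succ k ih =>
      intro j
      rw [show j + (k + 1) = (j + 1) + k by ring, ih (j + 1), Finset.sum_range_succ, add_assoc]
      congr 1
      have hV := hπ.measurable_value (S := S) (θ := θ) (m := m) (c := c) hψ j
      have hd := hπ.measurable_data k
      have hA := hπ.measurableSet_alive (k + 1)
      have hpt : ∀ ω, (if π.Alive k ω then value S θ m π c ψ (j + 1) (π.data ω k) else 0) =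
          (if π.StopsAt k ω then ψ (π.data ω k) else 0) +
          ({ω | π.Alive (k + 1) ω}.indicator (fun _ => c) ω +
          ∫⁻ y, (if π.ListAlive (π.data ω k) then value S θ m π c ψ j (π.data ω k ++ [y]) else 0)
            ∂nodeLaw S θ m (π.select (π.data ω k))) := by
        intro ω
        rw [Set.indicator_apply]
        by_cases h1 : π.Alive k ω <;> by_cases h2 : π.halt (π.data ω k) <;>
          simp [value, Policy.StopsAt, Policy.alive_succ, Policy.listAlive_data, h1, h2]
      have hF : Measurable (Function.uncurry fun (ys : List Y) (y : Y) =>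
          if π.ListAlive ys then value S θ m π c ψ j (ys ++ [y]) else 0) :=
        Measurable.ite (measurable_fst hπ.measurableSet_listAlive)
          (hV.comp measurable_append_singleton) measurable_const
      have hψd : Measurable fun ω => if π.StopsAt k ω then ψ (π.data ω k) else 0 :=
        Measurable.ite (hπ.measurableSet_stopsAt k) (hψ.comp hd) measurable_const
      simp_rw [hpt]
      rw [lintegral_add_left hψd, lintegral_add_left (measurable_const.indicator hA),
        lintegral_indicator_const hA, ← hπ.lintegral_next k hF, ← add_assoc]
      simp only [Policy.listAlive_data]
      rfl
  have := key n 0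
  simpa [value] using this

lemma Policy.stopTime_eq_tsum {Y : Type*} (π : Policy L Y) (ω : ℕ × Node L → Y) :
    π.stopTime ω = ∑' s, {ω | π.Alive (s + 1) ω}.indicator (fun _ => (1 : ℝ≥0∞)) ω := by
  classical
  by_cases h : ∃ t, π.halt (π.data ω t)
  · have h1 : ∀ s, π.Alive (s + 1) ω ↔ s < Nat.find h := fun s => by
      rw [Nat.lt_find_iff]
      simp [Policy.Alive]
    have h2 : π.stopTime ω = (Nat.find h : ℝ≥0∞) := by
      refine le_antisymm (iInf₂_le (Nat.find h) (Nat.find_spec h)) (le_iInf₂ fun t ht => ?_)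
      exact_mod_cast Nat.find_min' h ht
    rw [h2, tsum_eq_sum (s := Finset.range (Nat.find h))]
    · rw [Finset.sum_congr rfl (g := fun _ => (1 : ℝ≥0∞))]
      · simp
      · intro s hs
        simp [h1, Finset.mem_range.1 hs]
    · intro s hs
      simpa [h1] using hs
  · have h1 : ∀ s, π.Alive s ω := fun s r _ hr => h ⟨r, hr⟩
    have h2 : π.stopTime ω = ⊤ := by
      simp only [Policy.stopTime, iInf_eq_top]
      exact fun t ht => absurd ⟨t, ht⟩ h
    rw [h2]
    simp [h1]

lemma Policy.IsMeasurable.lintegral_stopTime (hπ : π.IsMeasurable) :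
    ∫⁻ ω, π.stopTime ω ∂obsLaw S θ m = ∑' s, obsLaw S θ m {ω | π.Alive (s + 1) ω} := by
  simp_rw [π.stopTime_eq_tsum]
  rw [lintegral_tsum fun s =>
    (measurable_const.indicator (hπ.measurableSet_alive (s + 1))).aemeasurable]
  exact tsum_congr fun s => by
    rw [lintegral_indicator_const (hπ.measurableSet_alive (s + 1)), one_mul]

lemma Policy.correct_iff {Y : Type*} {π : Policy L Y} {ω : ℕ × Node L → Y} :
    π.Correct m ω ↔ ∃ t, π.StopsAt t ω ∧ π.decision (π.data ω t) = fun k => decide (k = m) := by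
  simp only [Policy.Correct, Policy.StopsAt, Policy.Alive]
  exact exists_congr fun t => by tauto

lemma Policy.IsMeasurable.measurableSet_correct (hπ : π.IsMeasurable) (m : Leaf L) :
    MeasurableSet {ω | π.Correct m ω} := by
  have : {ω | π.Correct m ω} = ⋃ t, {ω | π.StopsAt t ω} ∩
      (fun ω => π.data ω t) ⁻¹' {ys | π.decision ys = fun k => decide (k = m)} := by
    ext ω
    simp [Policy.correct_iff]
  rw [this]
  exact MeasurableSet.iUnion fun t => (hπ.measurableSet_stopsAt t).inter
    (hπ.measurable_data t (hπ.measurableSet_decision _))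

open Classical in
/-- Verification principle: a function `H` of the data that dominates the terminal cost at
stopping and its own expected value after one more observation plus one before stopping,
bounds the total expected cost. -/
lemma Policy.IsMeasurable.cost_le (hπ : π.IsMeasurable) (x : ℝ≥0∞) (H : List Y → ℝ≥0∞)
    (hterm : ∀ ys, π.halt ys → (π.decision ys ≠ fun k => decide (k = m)) → x ≤ H ys)
    (hstep : ∀ ys, ¬ π.halt ys →
      1 + ∫⁻ y, H (ys ++ [y]) ∂nodeLaw S θ m (π.select ys) ≤ H ys) :
    x * obsLaw S θ m {ω | ¬ π.Correct m ω} + ∫⁻ ω, π.stopTime ω ∂obsLaw S θ m ≤ H [] := by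
  set ψ : List Y → ℝ≥0∞ := fun ys => if π.decision ys = fun k => decide (k = m) then 0 else x
  have hψ : Measurable ψ := Measurable.ite (hπ.measurableSet_decision _) measurable_const
    measurable_const
  have hle : ∀ n ys, value S θ m π 1 ψ n ys ≤ H ys := by
    intro n
    induction n with
    | zero => intro ys; simp [value]
    | succ n ih =>
      intro ys
      by_cases h : π.halt ys
      · by_cases h' : π.decision ys = fun k => decide (k = m)
        · simp [value, h, ψ, h']
        · simpa [value, h, ψ, h'] using hterm ys h h'
      · simp only [value, h, if_false]
        exact (add_le_add_right (lintegral_mono fun y => ih _) _).trans (hstep ys h)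
  by_cases htop : H [] = ⊤
  · simp [htop]
  have hsum : ∑' s, ∫⁻ ω, (if π.StopsAt s ω then ψ (π.data ω s) else 0) ∂obsLaw S θ m +
      ∫⁻ ω, π.stopTime ω ∂obsLaw S θ m ≤ H [] := by
    rw [hπ.lintegral_stopTime, ← ENNReal.tsum_add]
    refine ENNReal.tsum_le_of_sum_range_le fun n => ?_
    have := hle n []
    rw [hπ.value_nil hψ] at this
    simpa using this
  refine le_trans (add_le_add_left ?_ _) hsum
  have hfinite : ∀ᵐ ω ∂obsLaw S θ m, ∃ t, π.halt (π.data ω t) := by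
    have h1 : ∫⁻ ω, π.stopTime ω ∂obsLaw S θ m ≠ ⊤ :=
      ne_top_of_le_ne_top htop (le_trans le_add_self hsum : _ ≤ H [])
    have hm : Measurable π.stopTime := by
      have : π.stopTime = fun ω =>
          ∑' s, {ω | π.Alive (s + 1) ω}.indicator (fun _ => (1 : ℝ≥0∞)) ω :=
        funext π.stopTime_eq_tsum
      rw [this]
      exact Measurable.tsum fun s =>
        measurable_const.indicator (hπ.measurableSet_alive (s + 1))
    filter_upwards [ae_lt_top hm h1] with ω hω
    by_contra hne
    refine hω.ne ?_
    simp only [Policy.stopTime, iInf_eq_top]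
    exact fun t ht => absurd ⟨t, ht⟩ hne
  have hsub : ∀ᵐ ω ∂obsLaw S θ m, {ω | ¬ π.Correct m ω}.indicator (fun _ => x) ω ≤
      ∑' s, (if π.StopsAt s ω then ψ (π.data ω s) else 0) := by
    filter_upwards [hfinite] with ω hω
    rw [Set.indicator_apply]
    split_ifs with hnc
    swap
    · exact zero_le
    have hst : π.StopsAt (Nat.find hω) ω :=
      ⟨fun s hs => Nat.find_min hω hs, Nat.find_spec hω⟩
    have hwrong : ¬ (π.decision (π.data ω (Nat.find hω)) = fun k => decide (k = m)) :=
      fun hd => hnc (Policy.correct_iff.2 ⟨_, hst, hd⟩)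
    have h1 := ENNReal.le_tsum (f := fun s =>
      if π.StopsAt s ω then ψ (π.data ω s) else 0) (Nat.find hω)
    simpa [hst, ψ, hwrong] using h1
  have hcm : MeasurableSet {ω | ¬ π.Correct m ω} := (hπ.measurableSet_correct m).compl
  have hψd : ∀ s, Measurable fun ω => if π.StopsAt s ω then ψ (π.data ω s) else 0 := fun s =>
    Measurable.ite (hπ.measurableSet_stopsAt s) (hψ.comp (hπ.measurable_data s))
      measurable_const
  rw [← lintegral_indicator_const hcm, ← lintegral_tsum fun s => (hψd s).aemeasurable]
  exact lintegral_mono_ae hsub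

end Value

/-! ### Change of measure and Bhattacharyya coefficients -/

section Bhattacharyya

variable {Y P : Type*} [MeasurableSpace Y] (S : Model Y P) (l : ℕ)

lemma Model.measurable_ratio (θ θ' : P) : Measurable fun y => S.f l θ' y / S.f l θ y :=
  (S.measurable_f l θ').div (S.measurable_f l θ)

lemma Model.law_withDensity (θ θ' : P) :
    S.law l θ' = (S.law l θ).withDensity fun y => ENNReal.ofReal (S.f l θ' y / S.f l θ y) := by
  have h1 := (S.measurable_f l θ).ennreal_ofReal
  have h2 := (S.measurable_ratio l θ θ').ennreal_ofReal
  simp only [Model.law]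
  rw [← withDensity_mul _ h1 h2]
  congr 1
  ext1 y
  simp only [Pi.mul_apply]
  rw [← ENNReal.ofReal_mul (S.f_pos l θ y).le, mul_div_cancel₀ _ (S.f_pos l θ y).ne']

lemma Model.law_absolutelyContinuous (θ θ' : P) : S.law l θ' ≪ S.law l θ := by
  rw [S.law_withDensity l θ θ']
  exact withDensity_absolutelyContinuous _ _

lemma Model.lintegral_ratio_mul (θ θ' : P) (F : Y → ℝ≥0∞) :
    ∫⁻ y, ENNReal.ofReal (S.f l θ' y / S.f l θ y) * F y ∂S.law l θ =
      ∫⁻ y, F y ∂S.law l θ' := by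
  rw [S.law_withDensity l θ θ', lintegral_withDensity_eq_lintegral_mul_non_measurable _
    (S.measurable_ratio l θ θ').ennreal_ofReal (by simp)]
  rfl

lemma Model.lintegral_ratio (θ θ' : P) :
    ∫⁻ y, ENNReal.ofReal (S.f l θ' y / S.f l θ y) ∂S.law l θ = 1 := by
  simpa using S.lintegral_ratio_mul l θ θ' fun _ => 1

lemma Model.ratio_pos (θ θ' : P) (y : Y) : 0 < S.f l θ' y / S.f l θ y :=
  div_pos (S.f_pos l θ' y) (S.f_pos l θ y)

lemma Model.integrable_ratio (θ θ' : P) :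
    Integrable (fun y => S.f l θ' y / S.f l θ y) (S.law l θ) := by
  refine ⟨(S.measurable_ratio l θ θ').aestronglyMeasurable, ?_⟩
  rw [hasFiniteIntegral_iff_ofReal (ae_of_all _ fun y => (S.ratio_pos l θ θ' y).le),
    S.lintegral_ratio]
  exact ENNReal.one_lt_top

lemma Model.integral_ratio (θ θ' : P) : ∫ y, S.f l θ' y / S.f l θ y ∂S.law l θ = 1 := by
  rw [integral_eq_lintegral_of_nonneg_ae (ae_of_all _ fun y => (S.ratio_pos l θ θ' y).le)
    (S.integrable_ratio l θ θ').aestronglyMeasurable, S.lintegral_ratio, ENNReal.toReal_one]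

/-- The square root of the likelihood ratio of `θ'` against `θ`. -/
noncomputable def Model.sqrtRatio (θ θ' : P) (y : Y) : ℝ := √(S.f l θ' y / S.f l θ y)

/-- The Bhattacharyya coefficient `∫ √(f_θ f_θ') dν` of two parameters at level `l`. -/
noncomputable def Model.bhatt (θ θ' : P) : ℝ≥0∞ :=
  ∫⁻ y, ENNReal.ofReal (S.sqrtRatio l θ θ' y) ∂S.law l θ

lemma Model.measurable_sqrtRatio (θ θ' : P) : Measurable (S.sqrtRatio l θ θ') :=
  (S.measurable_ratio l θ θ').sqrt

lemma Model.sqrtRatio_pos (θ θ' : P) (y : Y) : 0 < S.sqrtRatio l θ θ' y :=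
  Real.sqrt_pos.2 (S.ratio_pos l θ θ' y)

lemma Model.sqrtRatio_sq (θ θ' : P) (y : Y) :
    S.sqrtRatio l θ θ' y ^ 2 = S.f l θ' y / S.f l θ y :=
  Real.sq_sqrt (S.ratio_pos l θ θ' y).le

lemma Model.bhatt_symm (θ θ' : P) : S.bhatt l θ θ' = S.bhatt l θ' θ := by
  have h : ∀ a b : P, S.bhatt l a b = ∫⁻ y, ENNReal.ofReal √(S.f l a y * S.f l b y) ∂S.ν l := by
    intro a b
    unfold Model.bhatt Model.law
    rw [lintegral_withDensity_eq_lintegral_mul_non_measurable _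
      (S.measurable_f l a).ennreal_ofReal (by simp)]
    refine lintegral_congr fun y => ?_
    have ha := S.f_pos l a y
    simp only [Pi.mul_apply, Model.sqrtRatio]
    rw [← ENNReal.ofReal_mul ha.le]
    congr 1
    have h1 : S.f l a y * S.f l b y = S.f l a y ^ 2 * (S.f l b y / S.f l a y) := by
      field_simp
    rw [h1, Real.sqrt_mul (sq_nonneg _), Real.sqrt_sq ha.le]
  rw [h, h]
  simp_rw [mul_comm]

lemma Model.integrable_sqrtRatio (θ θ' : P) :
    Integrable (S.sqrtRatio l θ θ') (S.law l θ) := by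
  refine ((S.integrable_ratio l θ θ').add (integrable_const 1)).mono'
    (S.measurable_sqrtRatio l θ θ').aestronglyMeasurable (ae_of_all _ fun y => ?_)
  rw [Real.norm_of_nonneg (S.sqrtRatio_pos l θ θ' y).le]
  have := S.sqrtRatio_sq l θ θ' y
  simp only [Pi.add_apply]
  nlinarith [sq_nonneg (S.sqrtRatio l θ θ' y - 1), S.sqrtRatio_pos l θ θ' y]

lemma Model.bhatt_eq (θ θ' : P) :
    S.bhatt l θ θ' = ENNReal.ofReal (∫ y, S.sqrtRatio l θ θ' y ∂S.law l θ) :=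
  (ofReal_integral_eq_lintegral_ofReal (S.integrable_sqrtRatio l θ θ')
    (ae_of_all _ fun y => (S.sqrtRatio_pos l θ θ' y).le)).symm

/-- Different laws have Bhattacharyya coefficient less than one: `2 - 2 ∫ √r` is the integral
of `(√r - 1) ^ 2`, where `r` is the likelihood ratio. -/
lemma Model.bhatt_lt_one {θ θ' : P} (h : S.law l θ' ≠ S.law l θ) : S.bhatt l θ θ' < 1 := by
  rw [S.bhatt_eq, ENNReal.ofReal_lt_one]
  by_contra! hge
  refine h ?_
  have hi : Integrable (fun y => (S.sqrtRatio l θ θ' y - 1) ^ 2) (S.law l θ) := by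
    have : (fun y => (S.sqrtRatio l θ θ' y - 1) ^ 2) =
        fun y => S.f l θ' y / S.f l θ y - 2 * S.sqrtRatio l θ θ' y + 1 := by
      ext1 y
      rw [← S.sqrtRatio_sq]
      ring
    rw [this]
    exact ((S.integrable_ratio l θ θ').sub ((S.integrable_sqrtRatio l θ θ').const_mul 2)).add
      (integrable_const 1)
  have h0 : ∫ y, (S.sqrtRatio l θ θ' y - 1) ^ 2 ∂S.law l θ ≤ 0 := by
    have : ∫ y, (S.sqrtRatio l θ θ' y - 1) ^ 2 ∂S.law l θ =
        ∫ y, (S.f l θ' y / S.f l θ y - 2 * S.sqrtRatio l θ θ' y + 1) ∂S.law l θ := by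
      refine integral_congr_ae (ae_of_all _ fun y => ?_)
      simp only
      rw [← S.sqrtRatio_sq]
      ring
    have i1 := (S.integrable_sqrtRatio l θ θ').const_mul 2
    have i2 : Integrable (fun y => S.f l θ' y / S.f l θ y - 2 * S.sqrtRatio l θ θ' y)
        (S.law l θ) := (S.integrable_ratio l θ θ').sub i1
    rw [this, integral_add i2 (integrable_const 1), integral_sub (S.integrable_ratio l θ θ') i1,
      integral_const_mul, S.integral_ratio]
    simp
    linarith
  have h1 : (fun y => (S.sqrtRatio l θ θ' y - 1) ^ 2) =ᵐ[S.law l θ] 0 :=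
    (integral_eq_zero_iff_of_nonneg (fun y => sq_nonneg _) hi).1
      (le_antisymm h0 (integral_nonneg fun y => sq_nonneg _))
  rw [S.law_withDensity l θ θ']
  conv_rhs => rw [← withDensity_one (μ := S.law l θ)]
  refine withDensity_congr_ae ?_
  filter_upwards [h1] with y hy
  have h2 : S.sqrtRatio l θ θ' y = 1 := by
    have := pow_eq_zero_iff (two_ne_zero) |>.1 hy
    linarith
  rw [← S.sqrtRatio_sq, h2]
  simp

lemma Model.llr_law (θ θ' : P) : MeasureTheory.llr (S.law l θ) (S.law l θ') =ᵐ[S.law l θ]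
    fun y => Real.log (S.f l θ y / S.f l θ' y) := by
  have h := Measure.rnDeriv_withDensity (S.law l θ')
    (S.measurable_ratio l θ' θ).ennreal_ofReal
  have h' := (S.law_absolutelyContinuous l θ' θ).ae_le h
  filter_upwards [h'] with y hy
  rw [MeasureTheory.llr]
  conv_lhs => rw [S.law_withDensity l θ' θ]
  rw [hy, ENNReal.toReal_ofReal (S.ratio_pos l θ' θ y).le]

lemma Model.integrable_log_ratio {θ θ' : P} (h : S.kl l θ θ' ≠ ⊤) :
    Integrable (fun y => Real.log (S.f l θ y / S.f l θ' y)) (S.law l θ) :=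
  (integrable_congr (S.llr_law l θ θ')).1 (InformationTheory.klDiv_ne_top_iff.1 h).2

lemma Model.kl_ne_top {θ θ' : P}
    (h : Integrable (fun y => Real.log (S.f l θ y / S.f l θ' y)) (S.law l θ)) :
    S.kl l θ θ' ≠ ⊤ :=
  InformationTheory.klDiv_ne_top (S.law_absolutelyContinuous l θ' θ)
    ((integrable_congr (S.llr_law l θ θ')).2 h)

lemma Model.toReal_kl (θ θ' : P) :
    (S.kl l θ θ').toReal = ∫ y, Real.log (S.f l θ y / S.f l θ' y) ∂S.law l θ := by
  rw [Model.kl, InformationTheory.toReal_klDiv_of_measure_eq (S.law_absolutelyContinuous l θ' θ)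
    (by simp), integral_congr_ae (S.llr_law l θ θ')]

/-- The linear-quadratic minorant of `|e ^ (x / 2) - 1|` obtained from
`1 - e ^ (-u) ≥ u / (1 + u)` and a tangent line of `u ↦ 1 / u` at `s`. -/
lemma quadratic_le_abs_exp_half_sub_one {s : ℝ} (hs : 2 ≤ s) (x : ℝ) :
    -(2 / s - 2 / s ^ 2) * x - x ^ 2 / s ^ 2 ≤ |Real.exp (x / 2) - 1| := by
  have hs0 : 0 < s := by linarith
  have hp : 0 ≤ 2 / s - 2 / s ^ 2 := by
    rw [show 2 / s - 2 / s ^ 2 = 2 * (s - 1) / s ^ 2 by field_simp]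
    exact div_nonneg (by linarith) (by positivity)
  rcases le_or_gt 0 x with hx | hx
  · have h1 : 0 ≤ x ^ 2 / s ^ 2 := by positivity
    nlinarith [abs_nonneg (Real.exp (x / 2) - 1), mul_nonneg hp hx]
  · have h2 : Real.exp (x / 2) ≤ 2 / (2 - x) := by
      rw [le_div_iff₀ (by linarith)]
      have h3 := Real.add_one_le_exp (-(x / 2))
      have h4 : Real.exp (x / 2) * Real.exp (-(x / 2)) = 1 := by
        rw [← Real.exp_add]
        simp
      nlinarith [Real.exp_pos (x / 2)]
    have h5 : -(2 / s - 2 / s ^ 2) * x - x ^ 2 / s ^ 2 ≤ 1 - 2 / (2 - x) := by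
      have h2x : 0 < 2 - x := by linarith
      have : 1 - 2 / (2 - x) - (-(2 / s - 2 / s ^ 2) * x - x ^ 2 / s ^ 2) =
          (-x) * (s - (2 - x)) ^ 2 / (s ^ 2 * (2 - x)) := by
        field_simp
        ring
      have h6 : 0 ≤ (-x) * (s - (2 - x)) ^ 2 / (s ^ 2 * (2 - x)) :=
        div_nonneg (mul_nonneg (by linarith) (sq_nonneg _)) (by positivity)
      linarith
    have h7 := neg_le_abs (Real.exp (x / 2) - 1)
    linarith

lemma Model.sqrtRatio_eq_exp (θ θ' : P) (y : Y) :
    S.sqrtRatio l θ θ' y = Real.exp (Real.log (S.f l θ' y / S.f l θ y) / 2) := by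
  rw [Model.sqrtRatio, Real.sqrt_eq_rpow, Real.rpow_def_of_pos (S.ratio_pos l θ θ' y)]
  ring_nf

/-- Quantitative form of `Model.bhatt_lt_one`: a lower bound on the divergence from the normal
law and an upper bound on the second moment of the log-likelihood ratio keep the Bhattacharyya
coefficient away from one. -/
lemma Model.bhatt_le_of_secondMoment {Δ V s : ℝ} (hΔ : 0 < Δ) (hV : 0 ≤ V) (hs : 2 ≤ s)
    (hsV : 2 * V ≤ Δ * s) {θ : P} (hkl : ENNReal.ofReal Δ ≤ S.kl l (S.θ₀ l) θ)
    (hmom : ∫⁻ y, ENNReal.ofReal (S.llr l θ y ^ 2) ∂(S.law l (S.θ₀ l)) ≤ ENNReal.ofReal V) :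
    S.bhatt l (S.θ₀ l) θ ≤ ENNReal.ofReal (1 - (Δ / (2 * s)) ^ 2 / 2) := by
  have hs0 : 0 < s := by linarith
  set μ := S.law l (S.θ₀ l)
  set X := S.llr l θ
  have hXm : AEStronglyMeasurable X μ := (S.measurable_llr l θ).aestronglyMeasurable
  have hX2 : Integrable (fun y => X y ^ 2) μ := by
    refine ⟨hXm.pow 2, ?_⟩
    rw [hasFiniteIntegral_iff_ofReal (ae_of_all _ fun y => sq_nonneg _)]
    exact hmom.trans_lt ENNReal.ofReal_lt_top
  have hV2 : ∫ y, X y ^ 2 ∂μ ≤ V := by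
    rw [integral_eq_lintegral_of_nonneg_ae (ae_of_all _ fun y => sq_nonneg _) (hXm.pow 2)]
    exact ENNReal.toReal_le_of_le_ofReal hV hmom
  have hX : Integrable X μ := ((memLp_two_iff_integrable_sq hXm).2 hX2).integrable one_le_two
  have hneg : ∀ y, Real.log (S.f l (S.θ₀ l) y / S.f l θ y) = -X y := fun y => by
    simp only [X, Model.llr]
    rw [← Real.log_inv, inv_div]
  have hfin : S.kl l (S.θ₀ l) θ ≠ ⊤ := by
    refine S.kl_ne_top l ?_
    simp_rw [hneg]
    exact hX.neg
  have hmean : ∫ y, X y ∂μ ≤ -Δ := by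
    have h1 := S.toReal_kl l (S.θ₀ l) θ
    simp_rw [hneg] at h1
    rw [integral_neg] at h1
    have h2 := (ENNReal.ofReal_le_iff_le_toReal hfin).1 hkl
    linarith
  rw [S.bhatt_eq]
  refine ENNReal.ofReal_le_ofReal ?_
  set a := Δ / (2 * s) with ha
  have ha0 : 0 < a := by positivity
  set p := 2 / s - 2 / s ^ 2 with hp
  have hpt : ∀ y, S.sqrtRatio l (S.θ₀ l) θ y ≤ (S.f l θ y / S.f l (S.θ₀ l) y) / 2 +
      (1 + a ^ 2) / 2 + a * p * X y + a / s ^ 2 * X y ^ 2 := by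
    intro y
    have h1 := quadratic_le_abs_exp_half_sub_one hs (X y)
    have h2 := S.sqrtRatio_sq l (S.θ₀ l) θ y
    have h3 : S.sqrtRatio l (S.θ₀ l) θ y = Real.exp (X y / 2) := S.sqrtRatio_eq_exp l _ _ y
    rw [← h3] at h1
    have h4 := sq_nonneg (|S.sqrtRatio l (S.θ₀ l) θ y - 1| - a)
    rw [sub_sq, sq_abs] at h4
    have h5 := mul_le_mul_of_nonneg_left h1 ha0.le
    have h6 : a / s ^ 2 * X y ^ 2 = a * (X y ^ 2 / s ^ 2) := by ring
    rw [h6, ← h2]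
    nlinarith
  have i1 := (S.integrable_ratio l (S.θ₀ l) θ).div_const 2
  have i2 : Integrable (fun y => (S.f l θ y / S.f l (S.θ₀ l) y) / 2 + (1 + a ^ 2) / 2) μ :=
    i1.add (integrable_const _)
  have i6 := hX.const_mul (a * p)
  have i3 : Integrable (fun y => (S.f l θ y / S.f l (S.θ₀ l) y) / 2 + (1 + a ^ 2) / 2 +
      a * p * X y) μ := i2.add i6
  have i5 := hX2.const_mul (a / s ^ 2)
  have i4 : Integrable (fun y => (S.f l θ y / S.f l (S.θ₀ l) y) / 2 + (1 + a ^ 2) / 2 +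
      a * p * X y + a / s ^ 2 * X y ^ 2) μ := i3.add i5
  have hint : ∫ y, S.sqrtRatio l (S.θ₀ l) θ y ∂μ ≤
      ∫ y, ((S.f l θ y / S.f l (S.θ₀ l) y) / 2 +
      (1 + a ^ 2) / 2 + a * p * X y + a / s ^ 2 * X y ^ 2) ∂μ := by
    refine integral_mono (S.integrable_sqrtRatio l _ _) ?_ hpt
    exact i4
  rw [integral_add i3 i5, integral_add i2 i6, integral_add i1 (integrable_const _), integral_div,
    S.integral_ratio, integral_const_mul, integral_const_mul] at hint
  simp only [integral_const, probReal_univ, one_smul] at hint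
  have hp1 : 1 / s ≤ p := by
    rw [hp, div_sub_div _ _ hs0.ne' (by positivity), div_le_div_iff₀ hs0 (by positivity)]
    nlinarith [mul_pos hs0 hs0, mul_pos (mul_pos hs0 hs0) hs0]
  have hkey : a ≤ p * Δ - V / s ^ 2 := by
    have h1 : V / s ^ 2 ≤ Δ / (2 * s) := by
      rw [div_le_div_iff₀ (by positivity) (by positivity)]
      nlinarith
    have h2 : 1 / s * Δ ≤ p * Δ := mul_le_mul_of_nonneg_right hp1 hΔ.le
    have h3 : 1 / s * Δ = Δ / (2 * s) + Δ / (2 * s) := by field_simp; ring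
    linarith
  have h8 : a * p * ∫ y, X y ∂μ ≤ a * p * (-Δ) :=
    mul_le_mul_of_nonneg_left hmean (mul_nonneg ha0.le (le_trans (by positivity) hp1))
  have h9 : a / s ^ 2 * ∫ y, X y ^ 2 ∂μ ≤ a / s ^ 2 * V :=
    mul_le_mul_of_nonneg_left hV2 (by positivity)
  have h10 : a / s ^ 2 * V = a * (V / s ^ 2) := by ring
  nlinarith [mul_le_mul_of_nonneg_left hkey ha0.le]

end Bhattacharyya

/-! ### Iterated integrals and the internal test -/

section InternalTest

variable {Y P : Type*} [MeasurableSpace Y]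

/-- Expected value of `F` after `k` further independent observations with law `μ`. -/
noncomputable def iterLint (μ : Measure Y) (F : List Y → ℝ≥0∞) : ℕ → List Y → ℝ≥0∞
  | 0, ys => F ys
  | k + 1, ys => ∫⁻ y, iterLint μ F k (ys ++ [y]) ∂μ

lemma measurable_iterLint (μ : Measure Y) [SFinite μ] {F : List Y → ℝ≥0∞} (hF : Measurable F)
    (k : ℕ) : Measurable (iterLint μ F k) := by
  induction k with
  | zero => exact hF
  | succ k ih =>
    exact Measurable.lintegral_prod_right' (f := fun q : List Y × Y => iterLint μ F k (q.1 ++ [q.2]))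
      (ih.comp measurable_append_singleton)

lemma measurable_append_ofFn (ys : List Y) (k : ℕ) :
    Measurable fun z : Fin k → Y => ys ++ List.ofFn z := by
  have h : (fun z : Fin k → Y => ys ++ List.ofFn z) =
      fun z => List.ofFn (Fin.append ys.get z) := by
    ext1 z
    rw [List.ofFn_fin_append, List.ofFn_get]
  rw [h]
  refine (measurable_ofFn _).comp (measurable_pi_lambda _ fun i => ?_)
  refine Fin.addCases (fun j => ?_) (fun j => ?_) i
  · simp
  · simpa using measurable_pi_apply j

lemma lintegral_pi_ofFn (μ : Measure Y) [SigmaFinite μ] {F : List Y → ℝ≥0∞} (hF : Measurable F)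
    (k : ℕ) (ys : List Y) :
    ∫⁻ z, F (ys ++ List.ofFn z) ∂Measure.pi (fun _ : Fin k => μ) = iterLint μ F k ys := by
  induction k generalizing ys with
  | zero => simp [iterLint]
  | succ k ih =>
    have h := (measurePreserving_piFinSuccAbove (fun _ : Fin (k + 1) => μ) 0).symm
    rw [← h.lintegral_comp_emb (MeasurableEquiv.measurableEmbedding _)]
    have hm : Measurable fun q : Y × (Fin k → Y) => F ((ys ++ [q.1]) ++ List.ofFn q.2) := by
      have : (fun q : Y × (Fin k → Y) => F ((ys ++ [q.1]) ++ List.ofFn q.2)) =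
          (fun z : Fin (k + 1) → Y => F (ys ++ List.ofFn z)) ∘
            fun q : Y × (Fin k → Y) => Fin.cons q.1 q.2 := by
        ext1 q
        simp [List.ofFn_succ]
      rw [this]
      refine (hF.comp (measurable_append_ofFn ys (k + 1))).comp
        (measurable_pi_lambda _ fun i => ?_)
      refine Fin.cases ?_ (fun j => ?_) i
      · simpa using measurable_fst
      · simp only [Fin.cons_succ]
        exact (measurable_pi_apply j).comp measurable_snd
    have e : ∀ q : Y × (Fin k → Y), F (ys ++ List.ofFn
        ((MeasurableEquiv.piFinSuccAbove (fun _ : Fin (k + 1) => Y) 0).symm q)) =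
        F ((ys ++ [q.1]) ++ List.ofFn q.2) := by
      intro q
      simp [MeasurableEquiv.piFinSuccAbove, List.ofFn_succ]
    simp_rw [e]
    rw [lintegral_prod _ hm.aemeasurable]
    simp_rw [ih]
    rfl

lemma iterLint_map_prod (μ : Measure Y) {g : Y → ℝ≥0∞} (hg : Measurable g) (k : ℕ)
    (ys : List Y) : iterLint μ (fun ys => (ys.map g).prod) k ys =
      (ys.map g).prod * (∫⁻ y, g y ∂μ) ^ k := by
  induction k generalizing ys with
  | zero => simp [iterLint]
  | succ k ih =>
    simp only [iterLint, ih, List.map_append, List.prod_append, List.map_cons, List.map_nil,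
      List.prod_cons, List.prod_nil, mul_one]
    have h1 : Measurable fun y => (ys.map g).prod * g y := hg.const_mul _
    rw [lintegral_mul_const _ h1, lintegral_const_mul _ hg]
    ring

lemma measurable_list_map_prod_ennreal {g : Y → ℝ≥0∞} (hg : Measurable g) :
    Measurable fun ys : List Y => (ys.map g).prod := by
  refine measurable_list_of_ofFn fun t => ?_
  simp only [List.map_ofFn, List.prod_ofFn]
  exact Finset.measurable_prod _ fun i _ => hg.comp (measurable_pi_apply i)

variable (S : Model Y P) (l : ℕ)

lemma Model.lik_pos (θ : P) (ys : List Y) : 0 < S.lik l θ ys :=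
  List.prod_pos fun x hx => by
    obtain ⟨y, -, rfl⟩ := List.mem_map.1 hx
    exact S.f_pos l θ y

lemma Model.sum_llr (θ : P) (ys : List Y) :
    (ys.map (S.llr l θ)).sum = Real.log (S.lik l θ ys / S.lik l (S.θ₀ l) ys) := by
  induction ys with
  | nil => simp [Model.lik]
  | cons y ys ih =>
    have h1 := S.lik_pos l θ ys
    have h2 := S.lik_pos l (S.θ₀ l) ys
    have h3 : S.lik l θ (y :: ys) / S.lik l (S.θ₀ l) (y :: ys) =
        (S.f l θ y / S.f l (S.θ₀ l) y) * (S.lik l θ ys / S.lik l (S.θ₀ l) ys) := by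
      simp only [Model.lik, List.map_cons, List.prod_cons]
      exact (div_mul_div_comm _ _ _ _).symm
    rw [List.map_cons, List.sum_cons, ih, h3, Real.log_mul (S.ratio_pos l _ _ y).ne'
      (div_pos h1 h2).ne']
    rfl

lemma Model.prod_sqrtRatio (θ θ' : P) (ys : List Y) :
    (ys.map (S.sqrtRatio l θ θ')).prod = √(S.lik l θ' ys / S.lik l θ ys) := by
  induction ys with
  | nil => simp [Model.lik]
  | cons y ys ih =>
    have h3 : S.lik l θ' (y :: ys) / S.lik l θ (y :: ys) =
        (S.f l θ' y / S.f l θ y) * (S.lik l θ' ys / S.lik l θ ys) := by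
      simp only [Model.lik, List.map_cons, List.prod_cons]
      exact (div_mul_div_comm _ _ _ _).symm
    rw [List.map_cons, List.prod_cons, ih, h3, Real.sqrt_mul (S.ratio_pos l _ _ y).le]
    rfl

lemma Model.one_le_prod_sqrtRatio {θ θ' : P} {ys : List Y} (h : S.lik l θ ys ≤ S.lik l θ' ys) :
    1 ≤ (ys.map (S.sqrtRatio l θ θ')).prod := by
  rw [S.prod_sqrtRatio, Real.one_le_sqrt, one_le_div (S.lik_pos l θ ys)]
  exact h

lemma ofReal_list_prod {Y : Type*} (g : Y → ℝ) (hg : ∀ y, 0 ≤ g y) (ys : List Y) :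
    ENNReal.ofReal (ys.map g).prod = (ys.map fun y => ENNReal.ofReal (g y)).prod := by
  induction ys with
  | nil => simp
  | cons y ys ih => simp [ENNReal.ofReal_mul (hg y), ih]

/-- Chernoff bound: under `θ`, the parameter `θ'` is at least as likely as `θ` with
probability at most the `k`-th power of the Bhattacharyya coefficient. -/
lemma Model.pi_lik_le (θ θ' : P) (k : ℕ) :
    Measure.pi (fun _ : Fin k => S.law l θ)
      {z | S.lik l θ (List.ofFn z) ≤ S.lik l θ' (List.ofFn z)} ≤ S.bhatt l θ θ' ^ k := by
  set g : Y → ℝ≥0∞ := fun y => ENNReal.ofReal (S.sqrtRatio l θ θ' y)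
  have hg : Measurable g := (S.measurable_sqrtRatio l θ θ').ennreal_ofReal
  have h1 := lintegral_pi_ofFn (S.law l θ) (measurable_list_map_prod_ennreal hg) k []
  rw [iterLint_map_prod _ hg] at h1
  simp only [List.nil_append, List.map_nil, List.prod_nil, one_mul] at h1
  change _ ≤ (∫⁻ y, g y ∂S.law l θ) ^ k
  rw [← h1]
  have hm : Measurable fun z : Fin k → Y => ((List.ofFn z).map g).prod :=
    (measurable_list_map_prod_ennreal hg).comp (measurable_ofFn k)
  refine le_trans (measure_mono fun z hz => ?_)
    (le_trans (by rw [one_mul]) (mul_meas_ge_le_lintegral hm 1))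
  have := S.one_le_prod_sqrtRatio l hz
  simp only [Set.mem_ofPred_eq, g]
  rw [← ofReal_list_prod _ (fun y => (S.sqrtRatio_pos l θ θ' y).le)]
  simpa using this

variable {S l} {est : ℕ → List Y → P}

lemma gllr_eq (ys : List Y) :
    gllr S est l ys = Real.log (S.lik l (est l ys) ys / S.lik l (S.θ₀ l) ys) :=
  S.sum_llr l _ ys

lemma gllr_pos_iff (ys : List Y) :
    0 < gllr S est l ys ↔ S.lik l (S.θ₀ l) ys < S.lik l (est l ys) ys := by
  rw [gllr_eq, Real.log_pos_iff (div_pos (S.lik_pos l _ ys) (S.lik_pos l _ ys)).le,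
    one_lt_div (S.lik_pos l _ ys)]

lemma Model.IsMLE.pi_gllr_pos_le (hest : S.IsMLE est) (hfin : (S.Θ₁ l).Finite) {ρ : ℝ≥0∞}
    (hρ : ∀ θ ∈ S.Θ₁ l, S.bhatt l (S.θ₀ l) θ ≤ ρ) (k : ℕ) :
    Measure.pi (fun _ : Fin k => S.law l (S.θ₀ l)) {z | 0 < gllr S est l (List.ofFn z)} ≤
      (S.Θ₁ l).ncard * ρ ^ k := by
  have h1 : {z : Fin k → Y | 0 < gllr S est l (List.ofFn z)} ⊆ ⋃ θ ∈ hfin.toFinset,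
      {z | S.lik l (S.θ₀ l) (List.ofFn z) ≤ S.lik l θ (List.ofFn z)} := by
    intro z hz
    simp only [Set.mem_iUnion]
    exact ⟨est l (List.ofFn z), hfin.mem_toFinset.2 (hest.mem l _), ((gllr_pos_iff _).1 hz).le⟩
  refine (measure_mono h1).trans ((measure_biUnion_finset_le _ _).trans ?_)
  refine (Finset.sum_le_sum fun θ hθ => (S.pi_lik_le l (S.θ₀ l) θ k).trans
    (pow_le_pow_left' (hρ θ (hfin.mem_toFinset.1 hθ)) k)).trans ?_
  rw [Finset.sum_const, nsmul_eq_mul, Set.ncard_eq_toFinset_card _ hfin]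

lemma Model.IsMLE.pi_gllr_nonpos_le (hest : S.IsMLE est) {θ : P} (hθ : θ ∈ S.Θ₁ l) (k : ℕ) :
    Measure.pi (fun _ : Fin k => S.law l θ) {z | gllr S est l (List.ofFn z) ≤ 0} ≤
      S.bhatt l (S.θ₀ l) θ ^ k := by
  rw [S.bhatt_symm]
  refine le_trans (measure_mono fun z hz => ?_) (S.pi_lik_le l θ (S.θ₀ l) k)
  have h1 := (not_congr (gllr_pos_iff (S := S) (est := est) (l := l) (List.ofFn z))).1
    (not_lt.2 hz)
  exact (hest.max l _ θ hθ).trans (not_lt.1 h1)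

/-- A move is made with probability close to one if each of the two children gives a
misleading generalized likelihood ratio with small probability. -/
lemma le_moveProb {k : ℕ} {θa θb : P} {mv : Option Bool} {q r : ℝ} (A B : Set (Fin k → Y))
    (hA : Measure.pi (fun _ : Fin k => S.law l θa) A ≤ ENNReal.ofReal r)
    (hB : Measure.pi (fun _ : Fin k => S.law l θb) B ≤ ENNReal.ofReal r)
    (hr : 0 ≤ r) (hq : 2 * r ≤ 1 - q)
    (h : ∀ a b, a ∉ A → b ∉ B → internalMove S est l (List.ofFn a) (List.ofFn b) = mv) :
    q ≤ moveProb S est l k θa θb mv := by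
  unfold moveProb
  set μ := (Measure.pi (fun _ : Fin k => S.law l θa)).prod
    (Measure.pi (fun _ : Fin k => S.law l θb))
  set E := {z : (Fin k → Y) × (Fin k → Y) |
    internalMove S est l (List.ofFn z.1) (List.ofFn z.2) = mv}
  have hc : (Set.univ : Set ((Fin k → Y) × (Fin k → Y))) ⊆
      E ∪ (Prod.fst ⁻¹' A ∪ Prod.snd ⁻¹' B) := by
    rintro ⟨a, b⟩ -
    by_cases ha : a ∈ A
    · exact Or.inr (Or.inl ha)
    by_cases hb : b ∈ B
    · exact Or.inr (Or.inr hb)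
    · exact Or.inl (h a b ha hb)
  have h1 : μ (Prod.fst ⁻¹' A) ≤ ENNReal.ofReal r := by
    have : (Prod.fst ⁻¹' A : Set ((Fin k → Y) × (Fin k → Y))) = A ×ˢ Set.univ := by
      ext; simp
    rw [this, Measure.prod_prod, measure_univ, mul_one]
    exact hA
  have h2 : μ (Prod.snd ⁻¹' B) ≤ ENNReal.ofReal r := by
    have : (Prod.snd ⁻¹' B : Set ((Fin k → Y) × (Fin k → Y))) = Set.univ ×ˢ B := by
      ext; simp
    rw [this, Measure.prod_prod, measure_univ, one_mul]
    exact hB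
  have h3 : (1 : ℝ≥0∞) ≤ μ E + ENNReal.ofReal (2 * r) := by
    calc (1 : ℝ≥0∞) = μ Set.univ := measure_univ.symm
      _ ≤ μ E + (μ (Prod.fst ⁻¹' A) + μ (Prod.snd ⁻¹' B)) :=
        (measure_mono hc).trans ((measure_union_le _ _).trans
          (add_le_add le_rfl (measure_union_le _ _)))
      _ ≤ μ E + (ENNReal.ofReal r + ENNReal.ofReal r) := by gcongr
      _ = μ E + ENNReal.ofReal (2 * r) := by rw [← ENNReal.ofReal_add hr hr, two_mul]
  have h4 : (1 : ℝ) ≤ μ.real E + 2 * r := by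
    have := ENNReal.toReal_mono (by finiteness) h3
    rwa [ENNReal.toReal_one, ENNReal.toReal_add (by finiteness) (by finiteness),
      ENNReal.toReal_ofReal (by linarith)] at this
  linarith

lemma Model.IsMLE.internalTestGood (hest : S.IsMLE est) (hfin : (S.Θ₁ l).Finite) {J k : ℕ}
    {ρ q : ℝ} (hJ : (S.Θ₁ l).ncard ≤ J) (hJ1 : 1 ≤ J) (hρ0 : 0 ≤ ρ)
    (hρ : ∀ θ ∈ S.Θ₁ l, S.bhatt l (S.θ₀ l) θ ≤ ENNReal.ofReal ρ)
    (hk : 2 * (J * ρ ^ k) ≤ 1 - q) : InternalTestGood S est l k q := by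
  have hr : 0 ≤ J * ρ ^ k := by positivity
  have h1 : Measure.pi (fun _ : Fin k => S.law l (S.θ₀ l))
      {z | 0 < gllr S est l (List.ofFn z)} ≤ ENNReal.ofReal (J * ρ ^ k) := by
    refine (hest.pi_gllr_pos_le hfin hρ k).trans ?_
    rw [ENNReal.ofReal_mul (by positivity), ENNReal.ofReal_pow hρ0, ENNReal.ofReal_natCast]
    gcongr
  have h2 : ∀ θ ∈ S.Θ₁ l, Measure.pi (fun _ : Fin k => S.law l θ)
      {z | gllr S est l (List.ofFn z) ≤ 0} ≤ ENNReal.ofReal (J * ρ ^ k) := by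
    intro θ hθ
    refine ((hest.pi_gllr_nonpos_le hθ k).trans (pow_le_pow_left' (hρ θ hθ) k)).trans ?_
    rw [← ENNReal.ofReal_pow hρ0]
    refine ENNReal.ofReal_le_ofReal (le_mul_of_one_le_left (by positivity) (by exact_mod_cast hJ1))
  refine ⟨le_moveProb _ _ h1 h1 hr hk ?_, fun θ hθ =>
    ⟨le_moveProb _ _ (h2 θ hθ) h1 hr hk ?_, le_moveProb _ _ h1 (h2 θ hθ) hr hk ?_⟩⟩ <;>
  · intro a b ha hb
    simp only [Set.mem_ofPred_eq, not_lt, not_le] at ha hb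
    simp only [internalMove]
    split_ifs <;> first | rfl | (exfalso; grind)

lemma exists_forall_mul_pow_le (J : ℕ) {ρ q : ℝ} (hρ0 : 0 ≤ ρ) (hρ1 : ρ < 1) (hq : q < 1) :
    ∃ K₀ : ℕ, ∀ k ≥ K₀, 2 * (J * ρ ^ k) ≤ 1 - q := by
  have h := (tendsto_pow_atTop_nhds_zero_of_lt_one hρ0 hρ1).const_mul (2 * (J : ℝ))
  rw [mul_zero] at h
  obtain ⟨K₀, hK⟩ := Filter.eventually_atTop.1 (h.eventually_le_const (sub_pos.2 hq))
  exact ⟨K₀, fun k hk => by have := hK k hk; linarith⟩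

lemma Model.law_ne_of_kl_pos {Δ : ℝ} (hΔ : 0 < Δ) {θ θ' : P}
    (h : ENNReal.ofReal Δ ≤ S.kl l θ θ') : S.law l θ' ≠ S.law l θ := by
  intro he
  rw [Model.kl, he, InformationTheory.klDiv_self] at h
  simp at h
  linarith

lemma exists_bhatt_bound (hfin : (S.Θ₁ l).Finite) {A : Set P} (hA : A ⊆ S.Θ₁ l) (θ : P)
    (h : ∀ θ' ∈ A, S.law l θ' ≠ S.law l θ) :
    ∃ ρ : ℝ, 0 ≤ ρ ∧ ρ < 1 ∧ ∀ θ' ∈ A, S.bhatt l θ θ' ≤ ENNReal.ofReal ρ := by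
  classical
  have hAf := hfin.subset hA
  set r := hAf.toFinset.sup fun θ' => S.bhatt l θ θ'
  have hr : r < 1 := (Finset.sup_lt_iff (by simp)).2 fun θ' hθ' =>
    S.bhatt_lt_one l (h θ' (hAf.mem_toFinset.1 hθ'))
  refine ⟨r.toReal, ENNReal.toReal_nonneg, ?_, fun θ' hθ' => ?_⟩
  · have := ENNReal.toReal_strict_mono ENNReal.one_ne_top hr
    simpa using this
  · rw [ENNReal.ofReal_toReal hr.ne_top]
    exact Finset.le_sup (f := fun θ' => S.bhatt l θ θ') (hAf.mem_toFinset.2 hθ')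

lemma Model.IsMLE.exists_internalTestGood (hest : S.IsMLE est) (hfin : (S.Θ₁ l).Finite) {Δ : ℝ}
    (hΔ : 0 < Δ) (hAS1 : S.KLSeparated Δ) {q : ℝ} (hq : q < 1) :
    ∃ K₀ : ℕ, ∀ k ≥ K₀, InternalTestGood S est l k q := by
  obtain ⟨ρ, hρ0, hρ1, hρ⟩ := exists_bhatt_bound hfin subset_rfl (S.θ₀ l)
    fun θ hθ => S.law_ne_of_kl_pos hΔ (hAS1 l θ hθ).1
  obtain ⟨K₀, hK⟩ := exists_forall_mul_pow_le ((S.Θ₁ l).ncard + 1) hρ0 hρ1 hq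
  exact ⟨K₀, fun k hk => hest.internalTestGood hfin (Nat.le_succ _) (by omega) hρ0 hρ (hK k hk)⟩

lemma Model.IsMLE.exists_internalTestGood_uniform (hest : S.IsMLE est)
    (hfin : ∀ l, (S.Θ₁ l).Finite) {Δ : ℝ} (hΔ : 0 < Δ) (hAS1 : S.KLSeparated Δ) {J : ℕ} {V : ℝ}
    (hJ : ∀ l, (S.Θ₁ l).ncard ≤ J)
    (hV : ∀ l, ∀ θ ∈ S.Θ₁ l,
      ∫⁻ y, ENNReal.ofReal (S.llr l θ y ^ 2) ∂(S.law l (S.θ₀ l)) ≤ ENNReal.ofReal V)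
    {q : ℝ} (hq : q < 1) : ∃ K₀ : ℕ, ∀ l, ∀ k ≥ K₀, InternalTestGood S est l k q := by
  set s : ℝ := Max.max 2 (2 * Max.max V 0 / Δ)
  set κ := (Δ / (2 * s)) ^ 2 / 2
  have hs : 2 ≤ s := le_max_left _ _
  have hsV : 2 * Max.max V 0 ≤ Δ * s := by
    have := (div_le_iff₀ hΔ).1 (le_max_right (2 : ℝ) (2 * Max.max V 0 / Δ))
    linarith
  have hκ : 0 < κ := by positivity
  obtain ⟨K₀, hK⟩ := exists_forall_mul_pow_le (J + 1) (le_max_right (1 - κ) 0)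
    (max_lt (by linarith) one_pos) hq
  refine ⟨K₀, fun l k hk => hest.internalTestGood (hfin l) ((hJ l).trans (Nat.le_succ J))
    (by omega) (le_max_right _ _) (fun θ hθ => ?_) (hK k hk)⟩
  refine (S.bhatt_le_of_secondMoment l hΔ (le_max_right V 0) hs hsV (hAS1 l θ hθ).1
    ((hV l θ hθ).trans (ENNReal.ofReal_le_ofReal (le_max_left _ _)))).trans ?_
  exact ENNReal.ofReal_le_ofReal (le_max_left _ _)

end InternalTest

/-! ### Lyapunov functions for random walks -/

section RandomWalk

variable {Y : Type*} [MeasurableSpace Y] {μ : Measure Y}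

lemma lintegral_ofReal_le {f g : Y → ℝ} {c : ℝ} (hg : Integrable g μ) (hg0 : ∀ y, 0 ≤ g y)
    (hfg : ∀ y, f y ≤ g y) (hc : ∫ y, g y ∂μ ≤ c) :
    ∫⁻ y, ENNReal.ofReal (f y) ∂μ ≤ ENNReal.ofReal c := by
  refine (lintegral_mono fun y => ENNReal.ofReal_le_ofReal (hfg y)).trans ?_
  rw [← ofReal_integral_eq_lintegral_ofReal hg (ae_of_all _ hg0)]
  exact ENNReal.ofReal_le_ofReal hc

lemma sq_max_add_le (t x : ℝ) : (max t 0) ^ 2 + 2 * x * max t 0 ≤ (max (t + x) 0) ^ 2 := by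
  rcases le_total t 0 with h | h
  · rw [max_eq_right h]
    nlinarith [sq_nonneg (max (t + x) 0)]
  · rw [max_eq_left h]
    rcases le_total (t + x) 0 with h' | h'
    · rw [max_eq_right h']
      nlinarith
    · rw [max_eq_left h']
      nlinarith [sq_nonneg x]

/-- A random walk with increments of mean `D > 0` and finite second moment, at distance `u`
from its target, needs at most `u / D + φ u` expected steps to pass it, with `φ` bounded. The
bound on the overshoot is that of Lorden; here it comes from the concave correction
`φ u = κ ∫ ((X + a)⁺² - (X - u)⁺²) / 2`, whose slope `κ E (X - u)⁺` pays for the part of the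
increment beyond the target. Truncating increments at `a` keeps `φ` nonnegative where it is
evaluated. -/
lemma exists_overshoot_correction [IsProbabilityMeasure μ] {X : Y → ℝ} (hX : MemLp X 2 μ)
    {D : ℝ} (hD : 0 < D) (hmean : ∫ y, X y ∂μ = D) :
    ∃ (φ : ℝ → ℝ) (M : ℝ), (∀ u, 0 ≤ u → 0 ≤ φ u ∧ φ u ≤ M) ∧ ∀ u, 0 ≤ u →
      1 + ∫⁻ y, ENNReal.ofReal (if X y ≤ u then (u - X y) / D + φ (u - X y) else 0) ∂μ ≤
        ENNReal.ofReal (u / D + φ u) := by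
  have hXi : Integrable X μ := hX.integrable one_le_two
  have hX2 : Integrable (fun y => X y ^ 2) μ := hX.integrable_sq
  set V := ∫ y, X y ^ 2 ∂μ
  have hV : 0 ≤ V := integral_nonneg fun y => sq_nonneg _
  set a := V / D + 1 with ha
  have ha0 : 0 < a := by positivity
  have hpos : ∀ v : ℝ, Integrable (fun y => max (X y - v) 0) μ := fun v =>
    (hXi.sub (integrable_const v)).pos_part
  have hmin : Integrable (fun y => min (X y) a) μ := hXi.inf (integrable_const a)
  have hsq : ∀ v : ℝ, Integrable (fun y => (max (X y - v) 0) ^ 2) μ := by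
    intro v
    refine ((hX.sub (memLp_const v)).integrable_sq).mono'
      ((hpos v).aestronglyMeasurable.pow 2) (ae_of_all _ fun y => ?_)
    rw [Real.norm_of_nonneg (sq_nonneg _)]
    simp only [Pi.sub_apply]
    rcases le_total (X y - v) 0 with h | h
    · rw [max_eq_right h]
      nlinarith [sq_nonneg (X y - v)]
    · rw [max_eq_left h]
  set Da := ∫ y, min (X y) a ∂μ
  have hDa : 0 < Da := by
    have h1 : ∀ y, X y - X y ^ 2 / (4 * a) ≤ min (X y) a := by
      intro y
      refine le_min (by have : 0 ≤ X y ^ 2 / (4 * a) := by positivity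
                        linarith) ?_
      rw [sub_le_iff_le_add, ← sub_le_iff_le_add', le_div_iff₀ (by positivity)]
      nlinarith [sq_nonneg (X y - 2 * a)]
    have h2 : ∫ y, (X y - X y ^ 2 / (4 * a)) ∂μ ≤ Da :=
      integral_mono (hXi.sub (hX2.div_const _)) hmin h1
    rw [integral_sub hXi (hX2.div_const _), integral_div, hmean] at h2
    have h3 : V / (4 * a) < D := by
      rw [div_lt_iff₀ (by positivity), ha]
      have : D * (4 * (V / D + 1)) = 4 * V + 4 * D := by field_simp
      linarith
    linarith
  set κ := 1 / (D * Da)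
  have hκ : 0 < κ := by positivity
  set q : ℝ → ℝ := fun u => ∫ y, ((max (X y + a) 0) ^ 2 - (max (X y - u) 0) ^ 2) / 2 ∂μ with hq
  set r : ℝ → ℝ := fun u => ∫ y, max (X y - u) 0 ∂μ
  have hsqa : Integrable (fun y => (max (X y + a) 0) ^ 2) μ := by
    simpa using hsq (-a)
  have hqi : ∀ u, Integrable
      (fun y => ((max (X y + a) 0) ^ 2 - (max (X y - u) 0) ^ 2) / 2) μ := fun u =>
    (hsqa.sub (hsq u)).div_const 2
  have hqmono : ∀ u v, u ≤ v → q u ≤ q v := fun u v huv =>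
    integral_mono (hqi u) (hqi v) fun y => by
      have : (max (X y - v) 0) ^ 2 ≤ (max (X y - u) 0) ^ 2 := by gcongr
      simp only
      linarith
  have hq0 : ∀ u, -a ≤ u → 0 ≤ q u := fun u hu => integral_nonneg fun y => by
    have : (max (X y - u) 0) ^ 2 ≤ (max (X y + a) 0) ^ 2 := by
      gcongr
      linarith
    simp only [Pi.zero_apply]
    linarith
  have hqM : ∀ u, q u ≤ ∫ y, (max (X y + a) 0) ^ 2 / 2 ∂μ := fun u =>
    integral_mono (hqi u) (hsqa.div_const 2) fun y => by
      have := sq_nonneg (max (X y - u) 0)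
      simp only
      linarith
  have hqconc : ∀ u x, q (u - x) ≤ q u - x * r u := by
    intro u x
    have : q u - x * r u = ∫ y, (((max (X y + a) 0) ^ 2 - (max (X y - u) 0) ^ 2) / 2 -
        x * max (X y - u) 0) ∂μ := by
      rw [integral_sub (hqi u) ((hpos u).const_mul x), integral_const_mul]
    rw [this]
    refine integral_mono (hqi _) ((hqi u).sub ((hpos u).const_mul x)) fun y => ?_
    have h1 := sq_max_add_le (X y - u) x
    rw [show X y - u + x = X y - (u - x) by ring] at h1
    simp only
    linarith
  refine ⟨fun u => κ * q u, κ * ∫ y, (max (X y + a) 0) ^ 2 / 2 ∂μ, fun u hu =>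
    ⟨mul_nonneg hκ.le (hq0 u (by linarith)), mul_le_mul_of_nonneg_left (hqM u) hκ.le⟩,
    fun u hu => ?_⟩
  set f : Y → ℝ := fun y => if X y ≤ u then (u - X y) / D + κ * q (u - X y) else 0
  set g : Y → ℝ := fun y => (u - X y) / D + max (X y - u) 0 / D + (κ * q u - κ * r u * min (X y) a)
  have hfg : ∀ y, f y ≤ g y := by
    intro y
    have h1 := hqconc u (min (X y) a)
    have h2 := hqmono (u - X y) (u - min (X y) a) (by linarith [min_le_left (X y) a])
    have h3 := hq0 (u - min (X y) a) (by linarith [min_le_right (X y) a])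
    simp only [f, g]
    split_ifs with h
    · rw [max_eq_right (by linarith)]
      have := mul_le_mul_of_nonneg_left (h2.trans h1) hκ.le
      simp only [zero_div, add_zero]
      linarith
    · rw [max_eq_left (by linarith)]
      have := mul_le_mul_of_nonneg_left (h3.trans h1) hκ.le
      rw [mul_zero] at this
      have e : (u - X y) / D + (X y - u) / D = 0 := by ring
      rw [e]
      linarith
  have hf0 : ∀ y, 0 ≤ f y := by
    intro y
    simp only [f]
    split_ifs with h
    · exact add_nonneg (div_nonneg (by linarith) hD.le) (mul_nonneg hκ.le (hq0 _ (by linarith)))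
    · exact le_rfl
  have i1 : Integrable (fun y => (u - X y) / D) μ := ((integrable_const u).sub hXi).div_const D
  have i2 : Integrable (fun y => max (X y - u) 0 / D) μ := (hpos u).div_const D
  have i3 : Integrable (fun y => κ * q u - κ * r u * min (X y) a) μ :=
    (integrable_const _).sub (hmin.const_mul _)
  have i12 : Integrable (fun y => (u - X y) / D + max (X y - u) 0 / D) μ := i1.add i2
  have hgint : ∫ y, g y ∂μ = u / D + κ * q u - 1 := by
    have e1 : ∫ y, (u - X y) / D ∂μ = (u - D) / D := by
      rw [integral_div, integral_sub (integrable_const u) hXi, hmean]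
      simp
    have e2 : ∫ y, max (X y - u) 0 / D ∂μ = r u / D := integral_div _ _
    have e3 : ∫ y, (κ * q u - κ * r u * min (X y) a) ∂μ = κ * q u - κ * r u * Da := by
      rw [integral_sub (integrable_const _) (hmin.const_mul _), integral_const_mul (κ * r u)]
      simp [Da]
    simp only [g]
    rw [integral_add i12 i3, integral_add i1 i2, e1, e2, e3]
    simp only [κ]
    field_simp
    ring
  have h1 : 0 ≤ u / D + κ * q u - 1 := by
    rw [← hgint]
    exact integral_nonneg fun y => (hf0 y).trans (hfg y)
  have h2 := lintegral_ofReal_le (μ := μ) (i12.add i3) (fun y => (hf0 y).trans (hfg y)) hfg hgint.le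
  calc (1 : ℝ≥0∞) + ∫⁻ y, ENNReal.ofReal (f y) ∂μ
      ≤ ENNReal.ofReal 1 + ENNReal.ofReal (u / D + κ * q u - 1) := by
        rw [ENNReal.ofReal_one]
        gcongr
    _ = ENNReal.ofReal (u / D + κ * q u) := by
        rw [← ENNReal.ofReal_add zero_le_one h1]
        congr 1
        ring

/-- A superharmonic bound on the probability that a random walk started at `s` becomes negative,
below one even at `s = 0`; the increment `X` is a log-likelihood ratio, so that `e ^ (-X)` has
mean one. -/
noncomputable def ruinBound (δ s : ℝ) : ℝ := if s < 0 then 1 else min (Real.exp (-s)) (1 - δ)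

lemma measurable_ruinBound (δ : ℝ) : Measurable (ruinBound δ) :=
  Measurable.ite measurableSet_Iio measurable_const
    ((Real.measurable_exp.comp measurable_neg).min measurable_const)

lemma ruinBound_nonneg {δ : ℝ} (hδ : δ ≤ 1) (s : ℝ) : 0 ≤ ruinBound δ s := by
  unfold ruinBound
  split_ifs
  · exact zero_le_one
  · exact le_min (Real.exp_pos _).le (by linarith)

lemma ruinBound_le_one {δ : ℝ} (hδ : 0 ≤ δ) (s : ℝ) : ruinBound δ s ≤ 1 := by
  unfold ruinBound
  split_ifs
  · exact le_rfl
  · exact (min_le_right _ _).trans (by linarith)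

lemma ruinBound_le_exp (δ s : ℝ) : ruinBound δ s ≤ Real.exp (-s) := by
  unfold ruinBound
  split_ifs with h
  · exact Real.one_le_exp (by linarith)
  · exact min_le_left _ _

lemma exists_ruinBound [IsProbabilityMeasure μ] {X : Y → ℝ} (hXm : Measurable X)
    (hmean : 0 < ∫ y, X y ∂μ)
    (hexp : Integrable (fun y => Real.exp (-X y)) μ) (hexp1 : ∫ y, Real.exp (-X y) ∂μ = 1) :
    ∃ δ : ℝ, 0 < δ ∧ δ < 1 ∧ ∀ s, 0 ≤ s →
      ∫⁻ y, ENNReal.ofReal (ruinBound δ (s + X y)) ∂μ ≤ ENNReal.ofReal (ruinBound δ s) := by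
  obtain ⟨a, ha, hpa⟩ : ∃ a : ℝ, 0 < a ∧ 0 < μ.real {y | a ≤ X y} := by
    by_contra! h
    have h1 : ∀ n : ℕ, ∀ᵐ y ∂μ, X y < 1 / ((n : ℝ) + 1) := by
      intro n
      have h2 := le_antisymm (h (1 / ((n : ℝ) + 1)) (by positivity)) measureReal_nonneg
      rw [measureReal_eq_zero_iff] at h2
      rw [ae_iff]
      simpa using h2
    have h3 : ∀ᵐ y ∂μ, X y ≤ 0 := by
      filter_upwards [ae_all_iff.2 h1] with y hy
      exact ge_of_tendsto' tendsto_one_div_add_atTop_nhds_zero_nat fun n => (hy n).le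
    have := integral_nonpos_of_ae h3
    linarith
  set δ := μ.real {y | a ≤ X y} * (1 - Real.exp (-a)) with hδ
  have he : Real.exp (-a) < 1 := Real.exp_lt_one_iff.2 (by linarith)
  have he0 := Real.exp_pos (-a)
  have hδ0 : 0 < δ := mul_pos hpa (by linarith)
  have hδ1 : δ < 1 := by
    have : μ.real {y | a ≤ X y} ≤ 1 := measureReal_le_one
    nlinarith
  refine ⟨δ, hδ0, hδ1, fun s hs => ?_⟩
  have hm : MeasurableSet {y | a ≤ X y} := hXm measurableSet_Ici
  have hA : ∫⁻ y, ENNReal.ofReal (ruinBound δ (s + X y)) ∂μ ≤ ENNReal.ofReal (Real.exp (-s)) := by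
    refine lintegral_ofReal_le (hexp.const_mul (Real.exp (-s)))
      (fun y => by positivity) (fun y => ?_) ?_
    · rw [← Real.exp_add]
      refine (ruinBound_le_exp δ _).trans (le_of_eq ?_)
      ring_nf
    · rw [integral_const_mul, hexp1, mul_one]
  have hB : ∫⁻ y, ENNReal.ofReal (ruinBound δ (s + X y)) ∂μ ≤ ENNReal.ofReal (1 - δ) := by
    refine lintegral_ofReal_le (g := fun y => 1 - {y | a ≤ X y}.indicator
      (fun _ => 1 - Real.exp (-a)) y)
      ((integrable_const 1).sub ((integrable_const _).indicator hm)) (fun y => ?_) (fun y => ?_) ?_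
    · rw [Set.indicator_apply]
      split_ifs <;> linarith
    · rw [Set.indicator_apply]
      split_ifs with h
      · have h' : a ≤ X y := h
        refine (ruinBound_le_exp δ _).trans ?_
        rw [sub_sub_cancel]
        exact Real.exp_le_exp.2 (by linarith)
      · rw [sub_zero]
        exact ruinBound_le_one hδ0.le _
    · rw [integral_sub (integrable_const 1) ((integrable_const _).indicator hm),
        integral_indicator_const _ hm]
      simp [hδ]
  rw [show ruinBound δ s = min (Real.exp (-s)) (1 - δ) by simp [ruinBound, not_lt.2 hs],
    ENNReal.ofReal_min]
  exact le_min hA hB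

end RandomWalk

/-! ### The leaf test -/

section LeafTest

variable {Y P : Type*} [MeasurableSpace Y] {S : Model Y P} {est : ℕ → List Y → P}

lemma one_add_ofReal_le {x z : ℝ} {w : ℝ≥0∞} (hw : w ≤ ENNReal.ofReal x) (hx : 0 ≤ x)
    (h : 1 + x ≤ z) : 1 + w ≤ ENNReal.ofReal z :=
  calc 1 + w ≤ ENNReal.ofReal 1 + ENNReal.ofReal x := by
        rw [ENNReal.ofReal_one]
        gcongr
    _ = ENNReal.ofReal (1 + x) := (ENNReal.ofReal_add zero_le_one hx).symm
    _ ≤ ENNReal.ofReal z := ENNReal.ofReal_le_ofReal h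

lemma Model.exp_llr (l : ℕ) (θ : P) (y : Y) :
    Real.exp (S.llr l θ y) = S.f l θ y / S.f l (S.θ₀ l) y :=
  Real.exp_log (S.ratio_pos l _ _ y)

lemma Model.exp_half_llr (l : ℕ) (θ : P) (y : Y) :
    Real.exp (S.llr l θ y / 2) = S.sqrtRatio l (S.θ₀ l) θ y :=
  (S.sqrtRatio_eq_exp l _ _ y).symm

/-- Drift of the leaf test at a normal leaf. In a normal leaf `e ^ S` is a martingale, which
bounds the probability of a false alarm, and `e ^ (S / 2)` decreases geometrically, which bounds
the duration of the test. -/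
lemma normalLeaf_drift {ρ κ Z s : ℝ} (hρ1 : ρ < 1) (hκ : 0 ≤ κ) (hZ : 0 ≤ Z) (hs : 0 ≤ s) {θ : P}
    (hb : S.bhatt 0 (S.θ₀ 0) θ ≤ ENNReal.ofReal ρ) (hρ0 : 0 ≤ ρ) :
    1 + ∫⁻ y, ENNReal.ofReal ((1 - ρ)⁻¹ * Real.exp ((s + S.llr 0 θ y) / 2) +
        κ * Real.exp (s + S.llr 0 θ y) + Z) ∂S.law 0 (S.θ₀ 0) ≤
      ENNReal.ofReal ((1 - ρ)⁻¹ * Real.exp (s / 2) + κ * Real.exp s + Z) := by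
  have hr : 0 < (1 - ρ)⁻¹ := inv_pos.2 (by linarith)
  have hB : ∫ y, S.sqrtRatio 0 (S.θ₀ 0) θ y ∂S.law 0 (S.θ₀ 0) ≤ ρ := by
    rw [S.bhatt_eq] at hb
    exact (ENNReal.ofReal_le_ofReal_iff hρ0).1 hb
  have i1 := (S.integrable_sqrtRatio 0 (S.θ₀ 0) θ).const_mul ((1 - ρ)⁻¹ * Real.exp (s / 2))
  have i2 := (S.integrable_ratio 0 (S.θ₀ 0) θ).const_mul (κ * Real.exp s)
  have i12 : Integrable (fun y => (1 - ρ)⁻¹ * Real.exp (s / 2) * S.sqrtRatio 0 (S.θ₀ 0) θ y +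
      κ * Real.exp s * (S.f 0 θ y / S.f 0 (S.θ₀ 0) y)) (S.law 0 (S.θ₀ 0)) := i1.add i2
  have hint := lintegral_ofReal_le (c := (1 - ρ)⁻¹ * Real.exp (s / 2) * ρ + κ * Real.exp s + Z)
    (f := fun y => (1 - ρ)⁻¹ * Real.exp ((s + S.llr 0 θ y) / 2) +
      κ * Real.exp (s + S.llr 0 θ y) + Z)
    (i12.add (integrable_const Z)) (fun y => ?_) (fun y => le_of_eq ?_) ?_
  · refine one_add_ofReal_le hint (by positivity) ?_
    have h1 : 1 ≤ Real.exp (s / 2) := Real.one_le_exp (by linarith)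
    have h2 : (1 - ρ)⁻¹ * Real.exp (s / 2) - (1 - ρ)⁻¹ * Real.exp (s / 2) * ρ =
        Real.exp (s / 2) := by
      have : 1 - ρ ≠ 0 := by linarith
      field_simp
    linarith
  · have h1 := S.sqrtRatio_pos 0 (S.θ₀ 0) θ y
    have h2 := S.ratio_pos 0 (S.θ₀ 0) θ y
    simp only [Pi.add_apply]
    positivity
  · simp only [Pi.add_apply]
    rw [add_div, Real.exp_add, Real.exp_add, S.exp_half_llr, S.exp_llr]
    ring
  · simp only [Pi.add_apply]
    rw [integral_add i12 (integrable_const Z), integral_add i1 i2, integral_const_mul,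
      integral_const_mul, S.integral_ratio]
    simp only [integral_const, probReal_univ, one_smul, mul_one]
    have := mul_le_mul_of_nonneg_left hB (by positivity : 0 ≤ (1 - ρ)⁻¹ * Real.exp (s / 2))
    linarith

lemma Model.ratio_ae_eq_one {l : ℕ} {θ e : P} (h : S.law l e = S.law l θ) :
    ∀ᵐ y ∂S.law l θ, S.f l e y = S.f l θ y := by
  have h1 := Measure.rnDeriv_withDensity (S.law l θ) (S.measurable_ratio l θ e).ennreal_ofReal
  rw [← S.law_withDensity l θ e, h] at h1
  filter_upwards [h1, Measure.rnDeriv_self (S.law l θ)] with y hy hy'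
  rw [hy'] at hy
  have h2 : S.f l e y / S.f l θ y = 1 := by
    rw [← ENNReal.toReal_ofReal (S.ratio_pos l θ e y).le, ← hy, ENNReal.toReal_one]
  rw [div_eq_one_iff_eq (S.f_pos l θ y).ne'] at h2
  exact h2

lemma sq_max_log_le {w : ℝ} (hw : 0 < w) : (max (Real.log w) 0) ^ 2 ≤ 4 * w := by
  rcases le_total (Real.log w) 0 with h | h
  · rw [max_eq_right h]
    nlinarith
  · rw [max_eq_left h]
    have h1 : Real.log w = 2 * Real.log √w := by
      rw [Real.log_sqrt hw.le]
      ring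
    have h2 := Real.log_le_sub_one_of_pos (Real.sqrt_pos.2 hw)
    have h3 : Real.log w ≤ 2 * √w := by linarith
    nlinarith [Real.sq_sqrt hw.le]

/-- The positive part of an increment is integrable against a square-root likelihood ratio,
with a bound that does not involve the parameters `e` and `θ'`. -/
lemma Model.sqrtRatio_mul_llr_le (θ e θ' : P) (y : Y) :
    S.sqrtRatio 0 θ θ' y * max (S.llr 0 e y) 0 ≤
      (S.f 0 θ' y / S.f 0 θ y + 8 * (S.f 0 e y / S.f 0 θ y) + 2 * S.llr 0 θ y ^ 2) / 2 := by
  have h1 : S.llr 0 e y = Real.log (S.f 0 e y / S.f 0 θ y) + S.llr 0 θ y := by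
    rw [Model.llr, Model.llr, ← Real.log_mul (S.ratio_pos 0 _ _ y).ne' (S.ratio_pos 0 _ _ y).ne',
      div_mul_div_cancel₀ (S.f_pos 0 θ y).ne']
  have h2 : max (S.llr 0 e y) 0 ≤ max (Real.log (S.f 0 e y / S.f 0 θ y)) 0 + |S.llr 0 θ y| := by
    rw [h1]
    refine max_le ?_ (by positivity)
    exact add_le_add (le_max_left _ _) (le_abs_self _)
  have h3 := sq_max_log_le (S.ratio_pos 0 θ e y)
  have h4 := S.sqrtRatio_sq 0 θ θ' y
  have h5 : 0 ≤ max (S.llr 0 e y) 0 := le_max_right _ _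
  have h6 := sq_abs (S.llr 0 θ y)
  nlinarith [sq_nonneg (S.sqrtRatio 0 θ θ' y - max (S.llr 0 e y) 0),
    sq_nonneg (max (Real.log (S.f 0 e y / S.f 0 θ y)) 0 - |S.llr 0 θ y|),
    pow_le_pow_left₀ h5 h2 2]

/-- The sum over `B` of the square-root likelihood ratios against `θ`. Where the estimate lies
in `B` it is at least one, and it decreases geometrically in mean under `θ`. -/
noncomputable def Model.confusion (S : Model Y P) (B : Finset P) (θ : P) (ys : List Y) : ℝ :=
  ∑ θ' ∈ B, (ys.map (S.sqrtRatio 0 θ θ')).prod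

lemma Model.prod_sqrtRatio_pos (θ θ' : P) (ys : List Y) :
    0 < (ys.map (S.sqrtRatio 0 θ θ')).prod :=
  List.prod_pos fun x hx => by
    obtain ⟨y, -, rfl⟩ := List.mem_map.1 hx
    exact S.sqrtRatio_pos 0 θ θ' y

lemma Model.confusion_nonneg (B : Finset P) (θ : P) (ys : List Y) : 0 ≤ S.confusion B θ ys :=
  Finset.sum_nonneg fun θ' _ => (S.prod_sqrtRatio_pos θ θ' ys).le

lemma Model.confusion_nil (B : Finset P) (θ : P) : S.confusion B θ [] = B.card := by
  simp [Model.confusion]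

lemma Model.measurable_confusion (B : Finset P) (θ : P) : Measurable (S.confusion B θ) :=
  Finset.measurable_sum _ fun θ' _ => measurable_list_map_prod (S.measurable_sqrtRatio 0 θ θ')

lemma Model.IsMLE.one_le_confusion (hest : S.IsMLE est) {B : Finset P} {θ : P}
    (hθ : θ ∈ S.Θ₁ 0) {ys : List Y} (h : est 0 ys ∈ B) : 1 ≤ S.confusion B θ ys :=
  (S.one_le_prod_sqrtRatio 0 (hest.max 0 ys θ hθ)).trans
    (Finset.single_le_sum (f := fun θ' => (ys.map (S.sqrtRatio 0 θ θ')).prod)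
      (fun θ' _ => (S.prod_sqrtRatio_pos θ θ' ys).le) h)

/-- Drift of `confusion`, also when multiplied by an affine function of an increment of the
adaptive log-likelihood ratio. -/
lemma Model.confusion_drift {B : Finset P} {θ : P} {ρ w α : ℝ} (hρ0 : 0 ≤ ρ) (hw : 0 ≤ w)
    (hα : 0 ≤ α) (hB : ∀ θ' ∈ B, S.bhatt 0 θ θ' ≤ ENNReal.ofReal ρ)
    (hmom : Integrable (fun y => S.llr 0 θ y ^ 2) (S.law 0 θ)) (e : P) (ys : List Y) :
    ∫⁻ y, ENNReal.ofReal ((w + α * max (S.llr 0 e y) 0) * S.confusion B θ (ys ++ [y]))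
        ∂S.law 0 θ ≤
      ENNReal.ofReal ((ρ * w + α * ((9 + 2 * ∫ y, S.llr 0 θ y ^ 2 ∂S.law 0 θ) / 2)) *
        S.confusion B θ ys) := by
  set H := (9 + 2 * ∫ y, S.llr 0 θ y ^ 2 ∂S.law 0 θ) / 2
  set g : P → Y → ℝ := fun θ' y => (S.f 0 θ' y / S.f 0 θ y + 8 * (S.f 0 e y / S.f 0 θ y) +
    2 * S.llr 0 θ y ^ 2) / 2
  have ig : ∀ θ', Integrable (g θ') (S.law 0 θ) := fun θ' =>
    (((S.integrable_ratio 0 θ θ').add ((S.integrable_ratio 0 θ e).const_mul 8)).add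
      (hmom.const_mul 2)).div_const 2
  have hg : ∀ θ', ∫ y, g θ' y ∂S.law 0 θ = H := by
    intro θ'
    have i1 : Integrable (fun y => S.f 0 θ' y / S.f 0 θ y + 8 * (S.f 0 e y / S.f 0 θ y))
      (S.law 0 θ) := (S.integrable_ratio 0 θ θ').add ((S.integrable_ratio 0 θ e).const_mul 8)
    simp only [g]
    rw [integral_div, integral_add i1 (hmom.const_mul 2), integral_add (S.integrable_ratio 0 θ θ')
      ((S.integrable_ratio 0 θ e).const_mul 8), integral_const_mul, integral_const_mul,
      S.integral_ratio, S.integral_ratio]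
    norm_num [H]
  have iterm : ∀ θ', Integrable (fun y => w * S.sqrtRatio 0 θ θ' y + α * g θ' y) (S.law 0 θ) :=
    fun θ' => ((S.integrable_sqrtRatio 0 θ θ').const_mul w).add ((ig θ').const_mul α)
  have hg0 : ∀ θ' y, 0 ≤ g θ' y := fun θ' y => by
    have h1 := S.ratio_pos 0 θ θ' y
    have h2 := S.ratio_pos 0 θ e y
    positivity
  refine lintegral_ofReal_le (g := fun y => ∑ θ' ∈ B, (ys.map (S.sqrtRatio 0 θ θ')).prod *
    (w * S.sqrtRatio 0 θ θ' y + α * g θ' y))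
    (integrable_finsetSum _ fun θ' _ => (iterm θ').const_mul _) (fun y => ?_) (fun y => ?_) ?_
  · refine Finset.sum_nonneg fun θ' _ => ?_
    have h1 := S.prod_sqrtRatio_pos θ θ' ys
    have h2 := S.sqrtRatio_pos 0 θ θ' y
    have h3 := hg0 θ' y
    positivity
  · rw [Model.confusion, Finset.mul_sum]
    refine Finset.sum_le_sum fun θ' _ => ?_
    have h1 := S.prod_sqrtRatio_pos θ θ' ys
    have h2 := S.sqrtRatio_mul_llr_le θ e θ' y
    rw [List.map_append, List.prod_append]
    simp only [List.map_cons, List.map_nil, List.prod_cons, List.prod_nil, mul_one]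
    have h3 := mul_le_mul_of_nonneg_left h2 hα
    have h4 := mul_le_mul_of_nonneg_left h3 h1.le
    simp only [g]
    linarith
  · rw [integral_finsetSum _ fun θ' _ => (iterm θ').const_mul _, Model.confusion, Finset.mul_sum]
    refine Finset.sum_le_sum fun θ' hθ' => ?_
    rw [integral_const_mul, integral_add ((S.integrable_sqrtRatio 0 θ θ').const_mul w)
      ((ig θ').const_mul α), integral_const_mul, integral_const_mul, hg]
    have h1 := hB θ' hθ'
    rw [S.bhatt_eq] at h1
    have h2 := (ENNReal.ofReal_le_ofReal_iff hρ0).1 h1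
    have h3 := S.prod_sqrtRatio_pos θ θ' ys
    have h4 := mul_le_mul_of_nonneg_left (mul_le_mul_of_nonneg_left h2 hw) h3.le
    linarith

/-- Lyapunov function of the leaf test at the anomalous leaf, with threshold `b` and value
`b / D + C₂` of the state after a failed test. The potential is the sum of

* the bound `u / D + φ u` for a random walk at distance `u = b - S` from the threshold,
* `C₂` times a bound on the failure probability, which starts strictly below one,
* an affine function of `S` times `confusion`, which pays for the steps with a wrong estimate:
  such a step may lose all of `S`, but no more, since the test ends when `S` becomes negative.

That the initial value is at most `b / D + C₂ - A` leaves room for the cost `A` of returning to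
the leaf, while the coefficient of `b` stays exactly `1 / D`. -/
lemma Model.IsMLE.exists_anomalousLeaf_potential (hest : S.IsMLE est) (hfin : (S.Θ₁ 0).Finite)
    {θ : P} (hθ : θ ∈ S.Θ₁ 0) (hmom : MemLp (S.llr 0 θ) 2 (S.law 0 θ)) {D : ℝ} (hD : 0 < D)
    (hmean : ∫ y, S.llr 0 θ y ∂S.law 0 θ = D) :
    ∃ n₀ : ℕ, ∀ N₀ ≥ n₀, ∀ A : ℝ, 0 ≤ A → ∃ C₂ : ℝ, A ≤ C₂ ∧ ∀ b : ℝ, 0 ≤ b →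
      ∃ T : List Y → ℝ≥0∞, T [] ≤ ENNReal.ofReal (b / D + C₂ - A) ∧
        (∀ ys, ys.length < N₀ → 1 + ∫⁻ y, T (ys ++ [y]) ∂S.law 0 θ ≤ T ys) ∧
        (∀ ys, N₀ ≤ ys.length → 0 ≤ allr S est N₀ ys → allr S est N₀ ys ≤ b →
          1 + ∫⁻ y, (if b < allr S est N₀ (ys ++ [y]) then 0
            else if allr S est N₀ (ys ++ [y]) < 0 then ENNReal.ofReal (b / D + C₂)
            else T (ys ++ [y])) ∂S.law 0 θ ≤ T ys) := by
  classical
  set μ := S.law 0 θ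
  set X := S.llr 0 θ
  have hX2 : Integrable (fun y => X y ^ 2) μ := hmom.integrable_sq
  obtain ⟨φ, M, hφ, hφdrift⟩ := exists_overshoot_correction hmom hD hmean
  have hM : 0 ≤ M := (hφ 0 le_rfl).1.trans (hφ 0 le_rfl).2
  have hexp : ∀ y, Real.exp (-X y) = S.f 0 (S.θ₀ 0) y / S.f 0 θ y := fun y => by
    rw [Real.exp_neg, S.exp_llr, inv_div]
  obtain ⟨δ, hδ0, hδ1, hruin⟩ := exists_ruinBound (μ := μ) (X := X) (S.measurable_llr 0 θ)
    (by rw [hmean]; exact hD) (by simp_rw [hexp]; exact S.integrable_ratio 0 _ _)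
    (by simp_rw [hexp]; exact S.integral_ratio 0 _ _)
  set Bs : Set P := {θ' ∈ S.Θ₁ 0 | S.law 0 θ' ≠ S.law 0 θ}
  have hBs : Bs ⊆ S.Θ₁ 0 := fun θ' h => h.1
  obtain ⟨ρ, hρ0, hρ1, hρ⟩ := exists_bhatt_bound hfin hBs θ fun θ' h => h.2
  set B := (hfin.subset hBs).toFinset
  have hBρ : ∀ θ' ∈ B, S.bhatt 0 θ θ' ≤ ENNReal.ofReal ρ := fun θ' h =>
    hρ θ' ((hfin.subset hBs).mem_toFinset.1 h)
  have hBmem : ∀ θ', θ' ∈ S.Θ₁ 0 → S.law 0 θ' ≠ S.law 0 θ → θ' ∈ B := fun θ' h h' =>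
    (hfin.subset hBs).mem_toFinset.2 ⟨h, h'⟩
  clear_value B
  have hconfusion : ∀ w α : ℝ, 0 ≤ w → 0 ≤ α → ∀ e ys,
      ∫⁻ y, ENNReal.ofReal ((w + α * Max.max (S.llr 0 e y) 0) * S.confusion B θ (ys ++ [y])) ∂μ ≤
        ENNReal.ofReal ((ρ * w + α * ((9 + 2 * ∫ y, X y ^ 2 ∂μ) / 2)) * S.confusion B θ ys) :=
    fun w α hw hα => S.confusion_drift hρ0 hw hα hBρ hX2
  set H := (9 + 2 * ∫ y, X y ^ 2 ∂μ) / 2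
  have hH : 0 ≤ H := by
    have : 0 ≤ ∫ y, X y ^ 2 ∂μ := integral_nonneg fun y => sq_nonneg _
    positivity
  clear_value H
  have h1ρ : 0 < 1 - ρ := by linarith
  set α := 1 / (D * (1 - ρ)) with hα
  set γ := (α * H + M + 1) / (1 - ρ) with hγ
  have hα0 : 0 < α := by positivity
  have hγ0 : 0 < γ := by positivity
  clear_value α γ
  obtain ⟨n₀, hn₀⟩ : ∃ n₀ : ℕ, ∀ n ≥ n₀, B.card * ρ ^ n / (1 - ρ) ≤ δ / 2 := by
    obtain ⟨n₀, hn⟩ := exists_forall_mul_pow_le B.card hρ0 hρ1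
      (q := 1 - δ * (1 - ρ)) (by have := mul_pos hδ0 h1ρ; linarith)
    refine ⟨n₀, fun n h => ?_⟩
    rw [div_le_iff₀ h1ρ]
    have := hn n h
    linarith
  refine ⟨n₀, fun N₀ hN₀ A hA => ?_⟩
  set C₂ := 2 * (A + N₀ + M + γ * B.card) / δ with hC₂
  have hsum : 0 ≤ A + N₀ + M + γ * B.card := by positivity
  have hC₂δ : C₂ * (δ / 2) = A + N₀ + M + γ * B.card := by
    rw [hC₂]
    field_simp
  have hC₂0 : 0 ≤ C₂ := by positivity
  have hAC : A ≤ C₂ := by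
    have h1 : 0 ≤ N₀ + M + γ * B.card := by positivity
    nlinarith
  set β := γ + C₂ / (1 - ρ) with hβ
  have hβ0 : 0 ≤ β := by positivity
  clear_value C₂ β
  refine ⟨C₂, hAC, fun b hb => ?_⟩
  set St : List Y → ℝ := allr S est N₀
  set Λ : List Y → ℝ := S.confusion B θ
  have hΛ0 : ∀ ys, 0 ≤ Λ ys := S.confusion_nonneg B θ
  obtain ⟨pot, hpot⟩ : ∃ pot : List Y → ℝ, ∀ ys, pot ys = ((N₀ - ys.length : ℕ) : ℝ) +
      (b - St ys) / D + φ (b - St ys) + C₂ * ruinBound δ (St ys) +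
      (α * St ys + β) * (ρ ^ (N₀ - ys.length) * Λ ys) := ⟨_, fun _ => rfl⟩
  have hv0 : ruinBound δ 0 = 1 - δ := by
    simp [ruinBound, hδ0.le]
  refine ⟨fun ys => ENNReal.ofReal (pot ys), ?_, ?_, ?_⟩
  · refine ENNReal.ofReal_le_ofReal ?_
    have hS : St [] = 0 := allr_nil _ _ _
    have hΛ : Λ [] = B.card := S.confusion_nil B θ
    simp only [hpot, hS, hΛ, hv0, List.length_nil, Nat.sub_zero, sub_zero, mul_zero, zero_add]
    have h1 := (hφ b hb).2
    have h2 := hn₀ N₀ hN₀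
    have h3 : ρ ^ N₀ ≤ 1 := pow_le_one₀ hρ0 hρ1.le
    have h4 : β * (ρ ^ N₀ * B.card) = γ * B.card * ρ ^ N₀ + C₂ * (B.card * ρ ^ N₀ / (1 - ρ)) := by
      rw [hβ]
      ring
    have h5 := mul_le_mul_of_nonneg_left h2 hC₂0
    have h6 : γ * B.card * ρ ^ N₀ ≤ γ * B.card * 1 := by gcongr
    linarith
  · intro ys hlen
    have hS : St ys = 0 := allr_eq_zero _ _ hlen.le
    have hS' : ∀ y, St (ys ++ [y]) = 0 := fun y => allr_eq_zero _ _ (by simpa using hlen)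
    have hl : ∀ y, N₀ - (ys ++ [y]).length = N₀ - ys.length - 1 := fun y => by simp; omega
    have hl' : N₀ - ys.length = (N₀ - ys.length - 1) + 1 := by omega
    set n := N₀ - ys.length - 1
    set Z := (n : ℝ) + b / D + φ b + C₂ * (1 - δ)
    have hZ : 0 ≤ Z := by
      have h1 := (hφ b hb).1
      have h2 : 0 ≤ 1 - δ := by linarith
      positivity
    have hconf := hconfusion β 0 hβ0 le_rfl θ ys
    simp only [zero_mul, add_zero] at hconf
    have e : ∀ y, ENNReal.ofReal (pot (ys ++ [y])) = ENNReal.ofReal Z +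
        ENNReal.ofReal (ρ ^ n) * ENNReal.ofReal (β * Λ (ys ++ [y])) := by
      intro y
      rw [← ENNReal.ofReal_mul (by positivity), ← ENNReal.ofReal_add hZ
        (mul_nonneg (by positivity) (mul_nonneg hβ0 (hΛ0 _)))]
      congr 1
      simp only [hpot, hS' y, hl y, hv0, sub_zero, mul_zero, zero_add, Z]
      ring
    have hint : ∫⁻ y, ENNReal.ofReal (pot (ys ++ [y])) ∂μ ≤
        ENNReal.ofReal (Z + ρ ^ n * (ρ * β * Λ ys)) := by
      simp_rw [e]
      rw [lintegral_add_left measurable_const, lintegral_const_mul' _ _ ENNReal.ofReal_ne_top,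
        ENNReal.ofReal_add hZ (mul_nonneg (by positivity) (mul_nonneg (by positivity) (hΛ0 _))),
        ENNReal.ofReal_mul (by positivity), lintegral_const]
      simp only [measure_univ, mul_one]
      gcongr
    refine one_add_ofReal_le hint
      (add_nonneg hZ (mul_nonneg (by positivity) (mul_nonneg (by positivity) (hΛ0 _)))) ?_
    simp only [hpot, hS, hv0, sub_zero, mul_zero, zero_add, Z]
    rw [hl', pow_succ]
    push_cast
    apply le_of_eq
    ring
  · intro ys hlen hS0 hSb
    set e := est 0 ys
    set s := St ys
    have hs0 : 0 ≤ s := hS0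
    have hsb : s ≤ b := hSb
    set w := α * s + β with hwdef
    have hw : 0 ≤ w := by positivity
    have hS' : ∀ y, St (ys ++ [y]) = s + S.llr 0 e y := fun y => by
      simp only [St, allr_append_singleton, hlen, if_true]
      rfl
    have hl : ∀ y, N₀ - (ys ++ [y]).length = 0 := fun y => by simp; omega
    have hl' : N₀ - ys.length = 0 := by omega
    have hpot' : ∀ y, pot (ys ++ [y]) = (b - (s + S.llr 0 e y)) / D + φ (b - (s + S.llr 0 e y)) +
        C₂ * ruinBound δ (s + S.llr 0 e y) + (w + α * S.llr 0 e y) * Λ (ys ++ [y]) := by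
      intro y
      simp only [hpot, hS' y, hl y, w]
      push_cast
      ring
    have hpot0 : pot ys = (b - s) / D + φ (b - s) + C₂ * ruinBound δ s + w * Λ ys := by
      simp only [hpot, hl', w, s]
      push_cast
      ring
    set g3 : Y → ℝ≥0∞ := fun y =>
      ENNReal.ofReal ((w + α * Max.max (S.llr 0 e y) 0) * Λ (ys ++ [y]))
    have hconf : ∫⁻ y, g3 y ∂μ ≤ ENNReal.ofReal ((ρ * w + α * H) * Λ ys) :=
      hconfusion w α hw hα0.le e ys
    have hmajor : ∀ y, ENNReal.ofReal ((w + α * S.llr 0 e y) * Λ (ys ++ [y])) ≤ g3 y := fun y => by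
      refine ENNReal.ofReal_le_ofReal ?_
      have := hΛ0 (ys ++ [y])
      gcongr
      exact le_max_left _ _
    have hg3m : Measurable g3 := by
      refine Measurable.ennreal_ofReal (Measurable.mul ?_ ?_)
      · exact (((S.measurable_llr 0 e).max measurable_const).const_mul α).const_add w
      · exact (S.measurable_confusion B θ).comp (measurable_append_right ys)
    have hΛy := hΛ0 ys
    have hφs := hφ (b - s) (by linarith)
    have hdrift : s / D + M + 1 + C₂ ≤ (1 - ρ) * w - α * H := by
      have h1 : (1 - ρ) * w = s / D + (α * H + M + 1) + C₂ := by
        have a1 : (1 - ρ) * α = 1 / D := by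
          rw [hα]
          field_simp
        have a2 : (1 - ρ) * γ = α * H + M + 1 := by
          rw [hγ, mul_div_cancel₀ _ h1ρ.ne']
        have a3 : (1 - ρ) * (C₂ / (1 - ρ)) = C₂ := mul_div_cancel₀ _ h1ρ.ne'
        rw [hwdef, hβ]
        linear_combination s * a1 + a2 + a3
      linarith
    have hnn : 0 ≤ (ρ * w + α * H) * Λ ys := by positivity
    by_cases he : e ∈ B
    · -- A step with a wrong estimate: the whole value is charged to `confusion`.
      have hΛ1 : 1 ≤ Λ ys := hest.one_le_confusion hθ he
      have hbd : ∀ y, (if b < St (ys ++ [y]) then 0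
          else if St (ys ++ [y]) < 0 then ENNReal.ofReal (b / D + C₂)
          else ENNReal.ofReal (pot (ys ++ [y]))) ≤ ENNReal.ofReal (b / D + M + C₂) + g3 y := by
        intro y
        split_ifs with h1 h2
        · exact zero_le
        · exact le_add_right (ENNReal.ofReal_le_ofReal (by linarith))
        · rw [hpot' y]
          rw [hS' y] at h1 h2
          push Not at h1 h2
          refine ENNReal.ofReal_add_le.trans (add_le_add (ENNReal.ofReal_le_ofReal ?_) (hmajor y))
          have h3 := (hφ (b - (s + S.llr 0 e y)) (by linarith)).2
          have h4 : (b - (s + S.llr 0 e y)) / D ≤ b / D := by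
            gcongr
            linarith
          have h5 : C₂ * ruinBound δ (s + S.llr 0 e y) ≤ C₂ :=
            mul_le_of_le_one_right hC₂0 (ruinBound_le_one hδ0.le _)
          linarith
      have hint := (lintegral_mono (μ := μ) hbd)
      rw [lintegral_add_left measurable_const, lintegral_const, measure_univ, mul_one] at hint
      have hb1 : 0 ≤ b / D + M + C₂ := by positivity
      have hint' := hint.trans (add_le_add le_rfl hconf)
      rw [← ENNReal.ofReal_add hb1 hnn] at hint'
      refine one_add_ofReal_le hint' (by linarith) ?_
      rw [hpot0, sub_div]
      have h1 : 0 ≤ C₂ * ruinBound δ s := mul_nonneg hC₂0 (ruinBound_nonneg hδ1.le s)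
      have h2 : s / D + M + 1 + C₂ ≤ ((1 - ρ) * w - α * H) * Λ ys := by
        have : 0 ≤ s / D + M + 1 + C₂ := by positivity
        nlinarith
      linarith
    · -- With an estimate equivalent to `θ`, the increments are those of the walk under `θ`.
      have hlaw : S.law 0 e = S.law 0 θ := by
        by_contra hne
        exact he (hBmem e (hest.mem 0 ys) hne)
      set g1 : Y → ℝ≥0∞ := fun y => ENNReal.ofReal
        (if X y ≤ b - s then (b - s - X y) / D + φ (b - s - X y) else 0)
      set g2 : Y → ℝ≥0∞ := fun y => ENNReal.ofReal (C₂ * ruinBound δ (s + X y))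
      have hbd : ∀ᵐ y ∂μ, (if b < St (ys ++ [y]) then 0
          else if St (ys ++ [y]) < 0 then ENNReal.ofReal (b / D + C₂)
          else ENNReal.ofReal (pot (ys ++ [y]))) ≤ g1 y + g2 y + g3 y := by
        filter_upwards [S.ratio_ae_eq_one hlaw] with y hy
        have hXe : S.llr 0 e y = X y := by simp only [X, Model.llr, hy]
        split_ifs with h1 h2
        · exact zero_le
        · rw [hS' y, hXe] at h2
          refine le_add_right ?_
          have h3 : X y ≤ b - s := by linarith
          simp only [g1, g2, h3, if_true]
          refine (ENNReal.ofReal_le_ofReal ?_).trans ENNReal.ofReal_add_le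
          have h4 : ruinBound δ (s + X y) = 1 := by simp [ruinBound, h2]
          have h5 := (hφ (b - s - X y) (by linarith)).1
          have h6 : b / D ≤ (b - s - X y) / D := by
            gcongr
            linarith
          rw [h4]
          linarith
        · rw [hS' y, hXe] at h1 h2
          have h3 : X y ≤ b - s := by linarith
          rw [hpot' y]
          refine ENNReal.ofReal_add_le.trans (add_le_add ?_ (hmajor y))
          refine ENNReal.ofReal_add_le.trans (le_of_eq ?_)
          simp only [g1, g2, h3, if_true, hXe, sub_sub]
      have hg2m : Measurable g2 := by
        refine Measurable.ennreal_ofReal (Measurable.const_mul ?_ C₂)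
        exact (measurable_ruinBound δ).comp ((S.measurable_llr 0 θ).const_add s)
      have h2 : ∫⁻ y, g2 y ∂μ ≤ ENNReal.ofReal (C₂ * ruinBound δ s) := by
        simp only [g2, ENNReal.ofReal_mul hC₂0]
        rw [lintegral_const_mul' _ _ ENNReal.ofReal_ne_top]
        gcongr
        exact hruin s hs0
      have h1 := hφdrift (b - s) (by linarith)
      calc 1 + ∫⁻ y, (if b < St (ys ++ [y]) then 0
            else if St (ys ++ [y]) < 0 then ENNReal.ofReal (b / D + C₂)
            else ENNReal.ofReal (pot (ys ++ [y]))) ∂μ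
          ≤ 1 + ∫⁻ y, (g1 y + g2 y + g3 y) ∂μ := by
            gcongr 1 + ?_
            exact lintegral_mono_ae hbd
        _ = (1 + ∫⁻ y, g1 y ∂μ) + ∫⁻ y, g2 y ∂μ + ∫⁻ y, g3 y ∂μ := by
            rw [lintegral_add_right _ hg3m, lintegral_add_right _ hg2m]
            ring
        _ ≤ ENNReal.ofReal ((b - s) / D + φ (b - s)) + ENNReal.ofReal (C₂ * ruinBound δ s) +
            ENNReal.ofReal ((ρ * w + α * H) * Λ ys) := by gcongr
        _ = ENNReal.ofReal ((b - s) / D + φ (b - s) + C₂ * ruinBound δ s +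
            (ρ * w + α * H) * Λ ys) := by
            have n1 : 0 ≤ (b - s) / D + φ (b - s) :=
              add_nonneg (div_nonneg (by linarith) hD.le) hφs.1
            have n2 : 0 ≤ C₂ * ruinBound δ s := mul_nonneg hC₂0 (ruinBound_nonneg hδ1.le s)
            rw [ENNReal.ofReal_add (add_nonneg n1 n2) hnn, ENNReal.ofReal_add n1 n2]
        _ ≤ ENNReal.ofReal (pot ys) := by
            refine ENNReal.ofReal_le_ofReal ?_
            rw [hpot0]
            have h3 : 0 ≤ ((1 - ρ) * w - α * H) * Λ ys := by
              refine mul_nonneg (le_trans ?_ hdrift) hΛy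
              positivity
            linarith

end LeafTest

/-! ### The walk on the tree -/

section Tree

/-- Distance in the tree from the node `p` to the leaf `m`. A step away from the root brings
the leaf closer exactly when it stays on the path to `m`. -/
noncomputable def treeDist (m : List Bool) : List Bool → ℝ
  | [] => m.length
  | b :: p => open Classical in if (b :: p) <:+ m then treeDist m p - 1 else treeDist m p + 1

lemma treeDist_of_suffix {m p : List Bool} (h : p <:+ m) :
    treeDist m p = m.length - p.length := by
  induction p with
  | nil => simp [treeDist]
  | cons b p ih =>
    rw [treeDist, if_pos h, ih ((List.suffix_cons b p).trans h)]
    push_cast [List.length_cons]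
    ring

lemma treeDist_nonneg (m p : List Bool) : 0 ≤ treeDist m p := by
  induction p with
  | nil => simp [treeDist]
  | cons b p ih =>
    by_cases h : (b :: p) <:+ m
    · rw [treeDist_of_suffix h, sub_nonneg]
      exact_mod_cast h.length_le
    · rw [treeDist, if_neg h]
      linarith

lemma treeDist_cons_le (m p : List Bool) (b : Bool) : treeDist m (b :: p) ≤ treeDist m p + 1 := by
  rw [treeDist]
  split_ifs <;> linarith

lemma treeDist_tail_le (m p : List Bool) : treeDist m p.tail ≤ treeDist m p + 1 := by
  cases p with
  | nil => simp
  | cons b p =>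
    rw [List.tail_cons, treeDist]
    split_ifs <;> linarith

lemma treeDist_tail_of_not_suffix {m p : List Bool} (h : ¬ p <:+ m) :
    treeDist m p.tail = treeDist m p - 1 := by
  cases p with
  | nil => exact absurd List.nil_suffix h
  | cons b p =>
    rw [List.tail_cons, treeDist, if_neg h]
    ring

lemma one_le_treeDist {m p : List Bool} (h : p ≠ m) (hp : p.length ≤ m.length) :
    1 ≤ treeDist m p := by
  by_cases hs : p <:+ m
  · have h1 : p.length ≠ m.length := fun he => h (hs.eq_of_length he)
    have h2 : p.length + 1 ≤ m.length := by omega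
    rw [treeDist_of_suffix hs, le_sub_iff_add_le]
    have : ((p.length + 1 : ℕ) : ℝ) ≤ m.length := by exact_mod_cast h2
    push_cast at this
    linarith
  · have := treeDist_tail_of_not_suffix hs
    have := treeDist_nonneg m p.tail
    linarith

lemma cons_suffix_unique {m p : List Bool} {a b : Bool} (ha : (a :: p) <:+ m)
    (hb : (b :: p) <:+ m) : a = b := by
  have h := (List.suffix_of_suffix_length_le ha hb (by simp)).eq_of_length (by simp)
  simpa using h

lemma exists_cons_suffix {m p : List Bool} (h : p <:+ m) (hl : p.length < m.length) :
    ∃ b, (b :: p) <:+ m := by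
  obtain ⟨t, rfl⟩ := h
  rcases List.eq_nil_or_concat t with rfl | ⟨t', b, rfl⟩
  · simp at hl
  · exact ⟨b, t', by simp⟩

open Classical in
/-- The move from the node `p` in the direction of the leaf `m`. -/
noncomputable def correctMove (m p : List Bool) : Option Bool :=
  if (false :: p) <:+ m then some false else if (true :: p) <:+ m then some true else none

variable {L : ℕ}

/-- The node reached by a move. -/
def Node.move (p : Node L) : Option Bool → Node L
  | none => p.parent
  | some d => p.child d

lemma Node.child_val {p : Node L} (hp : p.1.length < L) (d : Bool) : (p.child d).1 = d :: p.1 := by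
  simp [Node.child, hp]

lemma Node.child_of_leaf {p : Node L} (hp : ¬ p.1.length < L) (d : Bool) : p.child d = p := by
  simp [Node.child, hp]

lemma treeDist_move_le {p : Node L} (m : List Bool) (hp : p.1.length < L) (mv : Option Bool) :
    treeDist m (p.move mv).1 ≤ treeDist m p.1 + 1 := by
  rcases mv with _ | d
  · exact treeDist_tail_le m p.1
  · rw [Node.move, Node.child_val hp]
    exact treeDist_cons_le m p.1 d

lemma treeDist_correctMove {p : Node L} {m : List Bool} (hm : m.length = L)
    (hp : p.1.length < L) :
    treeDist m (p.move (correctMove m p.1)).1 = treeDist m p.1 - 1 := by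
  unfold correctMove
  split_ifs with h1 h2
  · rw [Node.move, Node.child_val hp, treeDist, if_pos h1]
  · rw [Node.move, Node.child_val hp, treeDist, if_pos h2]
  · refine treeDist_tail_of_not_suffix fun hs => ?_
    obtain ⟨b, hb⟩ := exists_cons_suffix hs (by omega)
    cases b
    · exact h1 hb
    · exact h2 hb

end Tree

/-! ### The potential of the search -/

section Search

variable {Y P : Type*} [MeasurableSpace Y] {S : Model Y P} {est : ℕ → List Y → P} {L : ℕ}

lemma nodeLaw_child (θ : ℕ → P) (m : Leaf L) {p : Node L} (hp : p.1.length < L) (d : Bool)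
    [Decidable ((d :: p.1) <:+ m.1)] :
    nodeLaw S θ m (p.child d) = S.law (p.level - 1)
      (if (d :: p.1) <:+ m.1 then θ (p.level - 1) else S.θ₀ (p.level - 1)) := by
  have h1 := Node.child_val hp d
  have h2 : (p.child d).level = p.level - 1 := by
    simp only [Node.level, h1, List.length_cons]
    omega
  simp only [nodeLaw, h2, h1]

lemma nodeLaw_leaf (θ : ℕ → P) (m : Leaf L) {p : Node L} (hp : ¬ p.1.length < L)
    [Decidable (p.1 = m.1)] :
    nodeLaw S θ m p = S.law 0 (if p.1 = m.1 then θ 0 else S.θ₀ 0) := by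
  have h0 : p.1.length = L := le_antisymm p.2 (not_lt.1 hp)
  have h1 : p.level = 0 := by simp [Node.level, h0]
  have h2 : p.1 <:+ m.1 ↔ p.1 = m.1 :=
    ⟨fun h => h.eq_of_length (by rw [h0]; exact m.2.symm), fun h => h ▸ List.suffix_rfl⟩
  simp only [nodeLaw, h1, h2]

lemma le_moveProb_correctMove {k : ℕ} {q : ℝ} {θ : ℕ → P} (hθ : ∀ l, θ l ∈ S.Θ₁ l) {l : ℕ}
    (hgood : InternalTestGood S est l k q) (m p : List Bool)
    [Decidable ((false :: p) <:+ m)] [Decidable ((true :: p) <:+ m)] :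
    q ≤ moveProb S est l k (if (false :: p) <:+ m then θ l else S.θ₀ l)
      (if (true :: p) <:+ m then θ l else S.θ₀ l) (correctMove m p) := by
  unfold correctMove
  by_cases h1 : (false :: p) <:+ m
  · have h2 : ¬ (true :: p) <:+ m := fun h2 => by simpa using cons_suffix_unique h1 h2
    simp only [h1, h2, if_true, if_false]
    exact (hgood.2 _ (hθ l)).1
  · by_cases h2 : (true :: p) <:+ m
    · simp only [h1, h2, if_true, if_false]
      exact (hgood.2 _ (hθ l)).2
    · simp only [h1, h2, if_false]
      exact hgood.1

open Classical in
/-- Indicator that the internal test at level `l` with data `ys` makes a move other than `mv`. -/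
noncomputable def wrongMove (S : Model Y P) (est : ℕ → List Y → P) (l k : ℕ) (mv : Option Bool)
    (ys : List Y) : ℝ≥0∞ :=
  if internalMove S est l (ys.take k) (ys.drop k) = mv then 0 else 1

/-- Conditional probability, given the data `ys` collected so far, that an internal test with `k`
samples from the law `μa` and `k` samples from the law `μb` makes a move other than `mv`. -/
noncomputable def wrongMoveProb (S : Model Y P) (est : ℕ → List Y → P) (l k : ℕ)
    (μa μb : Measure Y) (mv : Option Bool) (ys : List Y) : ℝ≥0∞ :=
  if ys.length < k then
    iterLint μa (iterLint μb (wrongMove S est l k mv) k) (k - ys.length) ys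
  else iterLint μb (wrongMove S est l k mv) (2 * k - ys.length) ys

lemma Model.IsMLE.measurable_wrongMove (hest : S.IsMLE est) {l : ℕ} (hfin : (S.Θ₁ l).Finite)
    (k : ℕ) (mv : Option Bool) : Measurable (wrongMove S est l k mv) :=
  Measurable.ite (measurable_internalMove_comp hest hfin (measurable_list_take k)
    (measurable_list_drop k) mv) measurable_const measurable_const

/-- The conditional error probability of the internal test is a martingale. -/
lemma lintegral_wrongMoveProb (S : Model Y P) (est : ℕ → List Y → P) (l : ℕ) {k : ℕ}
    (μa μb : Measure Y) (mv : Option Bool) {ys : List Y} (h : ys.length < 2 * k) :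
    ∫⁻ y, wrongMoveProb S est l k μa μb mv (ys ++ [y])
      ∂(if k ≤ ys.length then μb else μa) = wrongMoveProb S est l k μa μb mv ys := by
  have hl : ∀ y, (ys ++ [y]).length = ys.length + 1 := fun y => by simp
  unfold wrongMoveProb
  simp_rw [hl]
  by_cases h1 : k ≤ ys.length
  · have h2 : ¬ ys.length + 1 < k := by omega
    have h3 : 2 * k - ys.length = (2 * k - (ys.length + 1)) + 1 := by omega
    simp only [h1, h2, not_lt.2 h1, if_true, if_false]
    rw [h3]
    rfl
  · have h1' : ys.length < k := not_le.1 h1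
    simp only [h1, h1', if_true, if_false]
    by_cases h2 : ys.length + 1 < k
    · have h3 : k - ys.length = (k - (ys.length + 1)) + 1 := by omega
      simp only [h2, if_true]
      rw [h3]
      rfl
    · have h3 : k - ys.length = 0 + 1 := by omega
      have h4 : 2 * k - (ys.length + 1) = k := by omega
      simp only [h2, if_false]
      rw [h3, h4]
      rfl

lemma Model.IsMLE.wrongMoveProb_nil (hest : S.IsMLE est) {l : ℕ} (hfin : (S.Θ₁ l).Finite) {k : ℕ}
    (hk : 1 ≤ k) (θa θb : P) (mv : Option Bool) :
    wrongMoveProb S est l k (S.law l θa) (S.law l θb) mv [] =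
      ENNReal.ofReal (1 - moveProb S est l k θa θb mv) := by
  have hF := hest.measurable_wrongMove hfin k mv
  have hF2 := measurable_iterLint (S.law l θb) hF k
  have h0 : ([] : List Y).length < k := hk
  rw [wrongMoveProb, if_pos h0, List.length_nil, Nat.sub_zero, ← lintegral_pi_ofFn _ hF2]
  simp_rw [List.nil_append, ← lintegral_pi_ofFn _ hF]
  set ν := (Measure.pi (fun _ : Fin k => S.law l θa)).prod
    (Measure.pi (fun _ : Fin k => S.law l θb))
  set E := {z : (Fin k → Y) × (Fin k → Y) |
    internalMove S est l (List.ofFn z.1) (List.ofFn z.2) = mv}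
  have hE : MeasurableSet E := measurable_internalMove_comp hest hfin
    ((measurable_ofFn k).comp measurable_fst) ((measurable_ofFn k).comp measurable_snd) mv
  have h1 : ∀ a b : Fin k → Y, wrongMove S est l k mv (List.ofFn a ++ List.ofFn b) =
      Eᶜ.indicator (fun _ => 1) (a, b) := by
    intro a b
    rw [wrongMove, List.take_left' (by simp), List.drop_left' (by simp), Set.indicator_apply]
    by_cases h : internalMove S est l (List.ofFn a) (List.ofFn b) = mv <;> simp [E, h]
  simp_rw [h1]
  rw [← lintegral_prod (μ := Measure.pi (fun _ : Fin k => S.law l θa))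
    (ν := Measure.pi (fun _ : Fin k => S.law l θb)) _
    (measurable_const.indicator hE.compl).aemeasurable,
    lintegral_indicator_const hE.compl, one_mul]
  change ν Eᶜ = ENNReal.ofReal (1 - ν.real E)
  rw [← probReal_compl_eq_one_sub hE, ofReal_measureReal]

open Classical in
/-- Potential of a state of the search when `m` is the anomalous process: a bound on the
expected remaining number of samples plus `1 / c` times the probability of a wrong declaration.
A node at distance `d` from `m` is charged `A * d + G` on arrival; `T` is the potential of the
test at the anomalous leaf. States that the search does not visit have potential `⊤`. -/
noncomputable def searchPotential (S : Model Y P) (est : ℕ → List Y → P) (K : ℕ → ℕ) (N₀ : ℕ)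
    (c : ℝ) (θ : ℕ → P) (m : Leaf L) (A G ρ : ℝ) (T : List Y → ℝ≥0∞)
    (s : SearchState L Y) : ℝ≥0∞ :=
  if s.done then if s.node.1 = m.1 then 0 else ENNReal.ofReal (1 / c)
  else if s.node.1.length < L then
    if s.buf.length < 2 * K (s.node.level - 1) then
      ENNReal.ofReal ((2 * K (s.node.level - 1) - s.buf.length : ℕ) +
        (A * (treeDist m.1 s.node.1 - 1) + G)) +
      ENNReal.ofReal (2 * A) * wrongMoveProb S est (s.node.level - 1) (K (s.node.level - 1))
        (nodeLaw S θ m (s.node.child false)) (nodeLaw S θ m (s.node.child true))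
        (correctMove m.1 s.node.1) s.buf
    else ⊤
  else if 0 ≤ allr S est N₀ s.buf ∧ allr S est N₀ s.buf ≤ Real.log (L / c) then
    if s.node.1 = m.1 then T s.buf
    else ENNReal.ofReal ((N₀ - s.buf.length : ℕ) +
      ((1 - ρ)⁻¹ * Real.exp (allr S est N₀ s.buf / 2) +
        1 / L * Real.exp (allr S est N₀ s.buf) + (A * (treeDist m.1 s.node.1 - 1) + G)))
  else ⊤

variable {K : ℕ → ℕ} {N₀ : ℕ} {c : ℝ} {θ : ℕ → P} {m : Leaf L} {A G ρ η : ℝ}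
  {T : List Y → ℝ≥0∞}

lemma Node.ne_leaf {p : Node L} (hp : p.1.length < L) (m : Leaf L) : p.1 ≠ m.1 := fun h => by
  have := m.2
  rw [h] at hp
  omega

/-- Arrival at a node costs at most `A` per unit of distance to the anomaly plus `G`. -/
lemma searchPotential_arrival (hest : S.IsMLE est) (hfin : ∀ l, (S.Θ₁ l).Finite)
    (hθ : ∀ l, θ l ∈ S.Θ₁ l) (hK1 : ∀ l, 1 ≤ K l)
    (hgood : ∀ l, InternalTestGood S est l (K l) (1 / 2 + η)) (hb : 0 ≤ Real.log (L / c))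
    (hA0 : 0 ≤ A) (hG : 0 ≤ G) (hKA : ∀ l, (K l : ℝ) ≤ η * A)
    (hNA : N₀ + (1 - ρ)⁻¹ + 1 / L ≤ A) (hT : T [] ≤ ENNReal.ofReal G) (p : Node L) :
    searchPotential S est K N₀ c θ m A G ρ T ⟨p, [], false⟩ ≤
      ENNReal.ofReal (A * treeDist m.1 p.1 + G) := by
  classical
  have hm := m.2
  simp only [searchPotential, Bool.false_eq_true, if_false]
  by_cases hp : p.1.length < L
  · simp only [hp, if_true]
    set l := p.level - 1
    have hd := one_le_treeDist (Node.ne_leaf hp m) (by rw [hm]; exact hp.le)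
    have hk : ([] : List Y).length < 2 * K l := by have := hK1 l; simp; omega
    simp only [hk, if_true]
    rw [nodeLaw_child θ m hp, nodeLaw_child θ m hp, hest.wrongMoveProb_nil (hfin l) (hK1 l),
      ← ENNReal.ofReal_mul (by positivity)]
    have hq := le_moveProb_correctMove hθ (hgood l) m.1 p.1
    set q := moveProb S est l (K l) (if (false :: p.1) <:+ m.1 then θ l else S.θ₀ l)
      (if (true :: p.1) <:+ m.1 then θ l else S.θ₀ l) (correctMove m.1 p.1)
    have hq1 : q ≤ 1 := measureReal_le_one
    have h1 := mul_nonneg hA0 (sub_nonneg.2 hd)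
    rw [← ENNReal.ofReal_add (by positivity) (mul_nonneg (by positivity) (by linarith))]
    refine ENNReal.ofReal_le_ofReal ?_
    have h2 := hKA l
    have h3 := mul_le_mul_of_nonneg_left hq hA0
    simp only [List.length_nil, Nat.sub_zero]
    push_cast
    linarith
  · have h0 : allr S est N₀ ([] : List Y) = 0 := allr_nil S est N₀
    simp only [hp, if_false, h0, le_refl, hb, and_self, if_true]
    by_cases hpm : p.1 = m.1
    · simp only [hpm, if_true]
      refine hT.trans (ENNReal.ofReal_le_ofReal ?_)
      have := mul_nonneg hA0 (treeDist_nonneg m.1 m.1)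
      linarith
    · simp only [hpm, if_false]
      refine ENNReal.ofReal_le_ofReal ?_
      simp only [List.length_nil, Nat.sub_zero, zero_div, Real.exp_zero, mul_one]
      linarith

/-- Drift of the potential during an internal test. -/
lemma searchPotential_internal (hA0 : 0 ≤ A) (hG : 0 ≤ G)
    (harr : ∀ p : Node L, searchPotential S est K N₀ c θ m A G ρ T ⟨p, [], false⟩ ≤
      ENNReal.ofReal (A * treeDist m.1 p.1 + G)) {p : Node L} (hp : p.1.length < L)
    {ys : List Y} (hys : ys.length < 2 * K (p.level - 1)) :
    1 + ∫⁻ y, searchPotential S est K N₀ c θ m A G ρ T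
        (searchStep S est K N₀ c ⟨p, ys, false⟩ y)
        ∂nodeLaw S θ m (p.child (decide (K (p.level - 1) ≤ ys.length))) ≤
      searchPotential S est K N₀ c θ m A G ρ T ⟨p, ys, false⟩ := by
  classical
  have hm := m.2
  set l := p.level - 1 with hl
  set mv := correctMove m.1 p.1
  set μa := nodeLaw S θ m (p.child false)
  set μb := nodeLaw S θ m (p.child true)
  set W := wrongMoveProb S est l (K l) μa μb mv
  have hlaw : nodeLaw S θ m (p.child (decide (K l ≤ ys.length))) =
      if K l ≤ ys.length then μb else μa := by
    by_cases h : K l ≤ ys.length <;> simp [h, μa, μb]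
  have hd := one_le_treeDist (Node.ne_leaf hp m) (by rw [hm]; exact hp.le)
  have h0 : 0 ≤ A * (treeDist m.1 p.1 - 1) + G :=
    add_nonneg (mul_nonneg hA0 (sub_nonneg.2 hd)) hG
  have hbound : ∀ y, searchPotential S est K N₀ c θ m A G ρ T
      (searchStep S est K N₀ c ⟨p, ys, false⟩ y) ≤
      ENNReal.ofReal ((2 * K l - (ys.length + 1) : ℕ) + (A * (treeDist m.1 p.1 - 1) + G)) +
        ENNReal.ofReal (2 * A) * W (ys ++ [y]) := by
    intro y
    by_cases hlast : ys.length + 1 < 2 * K l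
    · have h1 : searchStep S est K N₀ c ⟨p, ys, false⟩ y = ⟨p, ys ++ [y], false⟩ := by
        simp [searchStep, hp, hlast, ← hl]
      rw [h1]
      have h2 : (ys ++ [y]).length < 2 * K l := by simpa using hlast
      simp only [searchPotential, Bool.false_eq_true, if_false, hp, if_true, ← hl, h2]
      rw [List.length_append, List.length_singleton]
    · set mv' := internalMove S est l ((ys ++ [y]).take (K l)) ((ys ++ [y]).drop (K l))
      have h1 : searchStep S est K N₀ c ⟨p, ys, false⟩ y = ⟨p.move mv', [], false⟩ := by
        have h2 : ¬ (ys ++ [y]).length < 2 * K l := by simpa using hlast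
        simp only [searchStep, Bool.false_eq_true, if_false, hp, if_true, ← hl, h2]
        change (match mv' with
          | none => (⟨p.parent, [], false⟩ : SearchState L Y)
          | some d => ⟨p.child d, [], false⟩) = _
        rcases mv' with _ | d <;> rfl
      have hW : W (ys ++ [y]) = if mv' = mv then 0 else 1 := by
        have h2 : ¬ (ys ++ [y]).length < K l := by simp; omega
        have h3 : 2 * K l - (ys ++ [y]).length = 0 := by simp; omega
        simp only [W, wrongMoveProb, h2, h3, if_false]
        rfl
      have h4 : 2 * K l - (ys.length + 1) = 0 := by omega
      rw [h1, hW, h4]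
      refine (harr _).trans ?_
      split_ifs with h
      · rw [h, treeDist_correctMove hm hp]
        simp
      · rw [mul_one, ← ENNReal.ofReal_add (by simpa using h0) (by positivity)]
        refine ENNReal.ofReal_le_ofReal ?_
        have := mul_le_mul_of_nonneg_left (treeDist_move_le m.1 hp mv') hA0
        push_cast
        linarith
  have hint := lintegral_mono (μ := nodeLaw S θ m (p.child (decide (K l ≤ ys.length)))) hbound
  rw [lintegral_add_left measurable_const, lintegral_const, measure_univ, mul_one,
    lintegral_const_mul' _ _ ENNReal.ofReal_ne_top, hlaw,
    lintegral_wrongMoveProb S est l μa μb mv hys] at hint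
  have hR : searchPotential S est K N₀ c θ m A G ρ T ⟨p, ys, false⟩ =
      ENNReal.ofReal ((2 * K l - ys.length : ℕ) + (A * (treeDist m.1 p.1 - 1) + G)) +
        ENNReal.ofReal (2 * A) * W ys := by
    simp only [searchPotential, Bool.false_eq_true, if_false, hp, if_true, ← hl, hys]
    rfl
  rw [hR, hlaw]
  refine (add_le_add le_rfl hint).trans ?_
  rw [← add_assoc]
  refine add_le_add ?_ le_rfl
  refine one_add_ofReal_le le_rfl (by positivity) ?_
  have h5 : 2 * K l - ys.length = (2 * K l - (ys.length + 1)) + 1 := by omega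
  rw [h5]
  push_cast
  linarith

/-- Drift of the potential during a leaf test. -/
lemma searchPotential_leaf (hest : S.IsMLE est) (hL : 1 ≤ L) (hc : 0 < c)
    (hb : 0 ≤ Real.log (L / c)) (hA0 : 0 ≤ A) (hG : 0 ≤ G) (hρ0 : 0 ≤ ρ) (hρ1 : ρ < 1)
    (hρ : ∀ θ ∈ S.Θ₁ 0, S.bhatt 0 (S.θ₀ 0) θ ≤ ENNReal.ofReal ρ)
    (harr : ∀ p : Node L, searchPotential S est K N₀ c θ m A G ρ T ⟨p, [], false⟩ ≤
      ENNReal.ofReal (A * treeDist m.1 p.1 + G))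
    (hT1 : ∀ ys, ys.length < N₀ → 1 + ∫⁻ y, T (ys ++ [y]) ∂S.law 0 (θ 0) ≤ T ys)
    (hT2 : ∀ ys, N₀ ≤ ys.length → 0 ≤ allr S est N₀ ys → allr S est N₀ ys ≤ Real.log (L / c) →
      1 + ∫⁻ y, (if Real.log (L / c) < allr S est N₀ (ys ++ [y]) then 0
        else if allr S est N₀ (ys ++ [y]) < 0 then ENNReal.ofReal (A + G)
        else T (ys ++ [y])) ∂S.law 0 (θ 0) ≤ T ys)
    {p : Node L} (hp : ¬ p.1.length < L) (ys : List Y) :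
    1 + ∫⁻ y, searchPotential S est K N₀ c θ m A G ρ T
        (searchStep S est K N₀ c ⟨p, ys, false⟩ y) ∂nodeLaw S θ m p ≤
      searchPotential S est K N₀ c θ m A G ρ T ⟨p, ys, false⟩ := by
  classical
  have hm := m.2
  set b := Real.log (L / c) with hbdef
  have hLc : 0 < (L : ℝ) / c := by positivity
  by_cases hval : 0 ≤ allr S est N₀ ys ∧ allr S est N₀ ys ≤ b
  swap
  · have : searchPotential S est K N₀ c θ m A G ρ T ⟨p, ys, false⟩ = ⊤ := by
      simp only [searchPotential, Bool.false_eq_true, if_false, hp, ← hbdef, hval]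
    rw [this]
    exact le_top
  have hlen : ∀ y, (ys ++ [y]).length = ys.length + 1 := fun y => by simp
  rw [nodeLaw_leaf θ m hp]
  by_cases hN : ys.length < N₀
  · -- Initialization of the estimate.
    have h1 : ∀ y, searchStep S est K N₀ c ⟨p, ys, false⟩ y = ⟨p, ys ++ [y], false⟩ := fun y => by
      have : ys.length + 1 ≤ N₀ := hN
      simp [searchStep, hp, this]
    have h2 : ∀ y, allr S est N₀ (ys ++ [y]) = 0 := fun y =>
      allr_eq_zero S est (by rw [hlen]; exact hN)
    have h3 : allr S est N₀ ys = 0 := allr_eq_zero S est hN.le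
    simp_rw [h1]
    simp only [searchPotential, Bool.false_eq_true, if_false, hp, ← hbdef, h2, h3, le_refl, hb,
      and_self, if_true]
    by_cases hpm : p.1 = m.1
    · simp only [hpm, if_true]
      exact hT1 ys hN
    · simp only [hpm, if_false, hlen, lintegral_const, measure_univ, mul_one]
      have hd := one_le_treeDist hpm (by rw [hm]; exact p.2)
      have h4 := mul_nonneg hA0 (sub_nonneg.2 hd)
      have h5 : 0 ≤ (1 - ρ)⁻¹ := inv_nonneg.2 (by linarith)
      refine one_add_ofReal_le le_rfl (by positivity) ?_
      have h6 : N₀ - ys.length = (N₀ - (ys.length + 1)) + 1 := by omega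
      rw [h6]
      push_cast
      linarith
  · have hN' : N₀ ≤ ys.length := not_lt.1 hN
    have h1 : ∀ y, searchStep S est K N₀ c ⟨p, ys, false⟩ y =
        if b < allr S est N₀ (ys ++ [y]) then ⟨p, ys ++ [y], true⟩
        else if allr S est N₀ (ys ++ [y]) < 0 then ⟨p.parent, [], false⟩
        else ⟨p, ys ++ [y], false⟩ := fun y => by
      have : ¬ ys.length + 1 ≤ N₀ := by omega
      simp [searchStep, hp, this, ← hbdef]
    by_cases hpm : p.1 = m.1
    · have hR : searchPotential S est K N₀ c θ m A G ρ T ⟨p, ys, false⟩ = T ys := by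
        simp only [searchPotential, Bool.false_eq_true, if_false, hm, lt_self_iff_false, ← hbdef,
          hval, and_self, if_true, hpm]
      rw [hR, if_pos hpm]
      refine le_trans (add_le_add le_rfl (lintegral_mono fun y => ?_)) (hT2 ys hN' hval.1 hval.2)
      rw [h1 y]
      split_ifs with h2 h3
      · simp [searchPotential, hpm]
      · refine (harr _).trans (ENNReal.ofReal_le_ofReal ?_)
        have h4 : treeDist m.1 p.parent.1 ≤ 1 := by
          refine (treeDist_tail_le m.1 p.1).trans ?_
          rw [hpm, treeDist_of_suffix List.suffix_rfl]
          simp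
        have := mul_le_mul_of_nonneg_left h4 hA0
        linarith
      · push Not at h2 h3
        simp [searchPotential, ← hbdef, h2, h3, hpm, hm]
    · have hd := one_le_treeDist hpm (by rw [hm]; exact p.2)
      have hsuf : ¬ p.1 <:+ m.1 := fun h =>
        hpm (h.eq_of_length (by rw [hm]; exact le_antisymm p.2 (not_lt.1 hp)))
      have hZ : 0 ≤ A * (treeDist m.1 p.1 - 1) + G :=
        add_nonneg (mul_nonneg hA0 (sub_nonneg.2 hd)) hG
      have h5 : 0 ≤ (1 - ρ)⁻¹ := inv_nonneg.2 (by linarith)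
      have hdrift := normalLeaf_drift hρ1 (by positivity : (0 : ℝ) ≤ 1 / L) hZ hval.1
        (hρ _ (hest.mem 0 ys)) hρ0
      have hR : searchPotential S est K N₀ c θ m A G ρ T ⟨p, ys, false⟩ =
          ENNReal.ofReal ((1 - ρ)⁻¹ * Real.exp (allr S est N₀ ys / 2) +
            1 / L * Real.exp (allr S est N₀ ys) + (A * (treeDist m.1 p.1 - 1) + G)) := by
        have h6 : N₀ - ys.length = 0 := by omega
        simp only [searchPotential, Bool.false_eq_true, if_false, hp, ← hbdef, hval, and_self,
          if_true, hpm, h6, Nat.cast_zero, zero_add]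
      rw [hR, if_neg hpm]
      refine le_trans (add_le_add le_rfl (lintegral_mono fun y => ?_)) hdrift
      have hS : allr S est N₀ (ys ++ [y]) = allr S est N₀ ys + S.llr 0 (est 0 ys) y := by
        rw [allr_append_singleton, if_pos hN']
      rw [h1 y, ← hS]
      split_ifs with h2 h3
      · -- A false alarm costs `1 / c = e ^ b / L`.
        simp only [searchPotential, if_true, hpm, if_false]
        refine ENNReal.ofReal_le_ofReal ?_
        have h6 : (L : ℝ) / c ≤ Real.exp (allr S est N₀ (ys ++ [y])) := by
          rw [← Real.log_le_iff_le_exp hLc]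
          exact h2.le
        have h7 : 1 / c ≤ 1 / L * Real.exp (allr S est N₀ (ys ++ [y])) := by
          have hL' : (0 : ℝ) < L := by exact_mod_cast hL
          calc 1 / c = 1 / L * (L / c) := by field_simp
            _ ≤ _ := by gcongr
        have h8 : 0 ≤ (1 - ρ)⁻¹ * Real.exp (allr S est N₀ (ys ++ [y]) / 2) := by positivity
        linarith
      · refine (harr _).trans (ENNReal.ofReal_le_ofReal ?_)
        have h6 : treeDist m.1 p.parent.1 = treeDist m.1 p.1 - 1 :=
          treeDist_tail_of_not_suffix hsuf
        rw [h6]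
        have h8 : 0 ≤ (1 - ρ)⁻¹ * Real.exp (allr S est N₀ (ys ++ [y]) / 2) +
          1 / L * Real.exp (allr S est N₀ (ys ++ [y])) := by positivity
        linarith
      · push Not at h2 h3
        have h6 : N₀ - (ys ++ [y]).length = 0 := by rw [hlen]; omega
        simp only [searchPotential, Bool.false_eq_true, if_false, hp, ← hbdef, h2, h3, and_self,
          if_true, hpm, h6, Nat.cast_zero, zero_add, le_refl]

end Search

/-! ### The risk of the hierarchical dynamic search -/

section HDSRisk

variable {Y P : Type*} [MeasurableSpace Y] {S : Model Y P} {est : ℕ → List Y → P}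

lemma Model.kl_leaf_ne_top {θ : P} (hmom : MemLp (S.llr 0 θ) 2 (S.law 0 θ)) :
    S.kl 0 θ (S.θ₀ 0) ≠ ⊤ :=
  S.kl_ne_top 0 (hmom.integrable one_le_two)

lemma toReal_kl_leaf_ge {Δ : ℝ} {θ : P} (hAS1 : S.KLSeparated Δ) (hθ : θ ∈ S.Θ₁ 0)
    (hmom : MemLp (S.llr 0 θ) 2 (S.law 0 θ)) : Δ ≤ (S.kl 0 θ (S.θ₀ 0)).toReal :=
  (ENNReal.ofReal_le_iff_le_toReal (S.kl_leaf_ne_top hmom)).1 (hAS1 0 θ hθ).2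

lemma risk_eq (S : Model Y P) {L : ℕ} (θ : ℕ → P) (prior : PMF (Leaf L)) (c : ℝ)
    (π : Policy L Y) : risk S θ prior c π =
      ∑ m, prior m * (obsLaw S θ m {ω | ¬ π.Correct m ω} +
        ENNReal.ofReal c * ∫⁻ ω, π.stopTime ω ∂obsLaw S θ m) := by
  rw [risk, errProb, sampleComplexity, Finset.mul_sum, ← Finset.sum_add_distrib]
  exact Finset.sum_congr rfl fun m _ => by ring

lemma sum_prior {L : ℕ} (prior : PMF (Leaf L)) : ∑ m, prior m = 1 := by
  rw [← tsum_fintype (L := .unconditional _)]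
  exact prior.tsum_coe

/-- Under the drift inequalities, the potential of the initial state bounds the cost of the
search. -/
lemma hds_cost_le (hest : S.IsMLE est) (hfin : ∀ l, (S.Θ₁ l).Finite) {K : ℕ → ℕ} {N₀ L : ℕ}
    {c A G ρ η : ℝ} {θ : ℕ → P} {T : List Y → ℝ≥0∞} (hθ : ∀ l, θ l ∈ S.Θ₁ l)
    (hK1 : ∀ l, 1 ≤ K l) (hgood : ∀ l, InternalTestGood S est l (K l) (1 / 2 + η))
    (hL : 1 ≤ L) (hc : 0 < c) (hb : 0 ≤ Real.log (L / c)) (hA0 : 0 ≤ A) (hG : 0 ≤ G)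
    (hKA : ∀ l, (K l : ℝ) ≤ η * A) (hρ0 : 0 ≤ ρ) (hρ1 : ρ < 1)
    (hρ : ∀ θ ∈ S.Θ₁ 0, S.bhatt 0 (S.θ₀ 0) θ ≤ ENNReal.ofReal ρ)
    (hNA : N₀ + (1 - ρ)⁻¹ + 1 / L ≤ A) (hT : T [] ≤ ENNReal.ofReal G)
    (hT1 : ∀ ys, ys.length < N₀ → 1 + ∫⁻ y, T (ys ++ [y]) ∂S.law 0 (θ 0) ≤ T ys)
    (hT2 : ∀ ys, N₀ ≤ ys.length → 0 ≤ allr S est N₀ ys → allr S est N₀ ys ≤ Real.log (L / c) →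
      1 + ∫⁻ y, (if Real.log (L / c) < allr S est N₀ (ys ++ [y]) then 0
        else if allr S est N₀ (ys ++ [y]) < 0 then ENNReal.ofReal (A + G)
        else T (ys ++ [y])) ∂S.law 0 (θ 0) ≤ T ys) (m : Leaf L) :
    ENNReal.ofReal (1 / c) * obsLaw S θ m {ω | ¬ (hds S est K N₀ c L).Correct m ω} +
      ∫⁻ ω, (hds S est K N₀ c L).stopTime ω ∂obsLaw S θ m ≤ ENNReal.ofReal (A * L + G) := by
  have harr := searchPotential_arrival (c := c) (m := m) hest hfin hθ hK1 hgood hb hA0 hG hKA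
    hNA hT
  have hm := m.2
  refine ((hds_isMeasurable hest hfin K N₀ c L).cost_le (ENNReal.ofReal (1 / c))
    (fun ys => searchPotential S est K N₀ c θ m A G ρ T (searchState S est K N₀ c L ys))
    ?_ ?_).trans ((harr (Node.root L)).trans (le_of_eq ?_))
  · intro ys hhalt hdec
    have hd : (searchState S est K N₀ c L ys).done = true := hhalt
    have hne : (searchState S est K N₀ c L ys).node.1 ≠ m.1 := by
      intro he
      refine hdec (funext fun k => ?_)
      change decide (k.1 = (searchState S est K N₀ c L ys).node.1) = decide (k = m)
      rw [he]
      exact decide_eq_decide.2 Subtype.ext_iff.symm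
    simp [searchPotential, hd, hne]
  · intro ys hhalt
    have hd : (searchState S est K N₀ c L ys).done = false := by
      simpa [hds] using hhalt
    simp_rw [searchState_append_singleton]
    change 1 + ∫⁻ y, _ ∂nodeLaw S θ m ((searchState S est K N₀ c L ys).node.child
      (decide (K ((searchState S est K N₀ c L ys).node.level - 1) ≤
        (searchState S est K N₀ c L ys).buf.length))) ≤ _
    generalize searchState S est K N₀ c L ys = s at hd ⊢
    obtain ⟨p, buf, d⟩ := s
    dsimp only at hd ⊢
    subst hd
    by_cases hp : p.1.length < L
    · by_cases hbuf : buf.length < 2 * K (p.level - 1)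
      · exact searchPotential_internal hA0 hG harr hp hbuf
      · refine le_top.trans (le_of_eq ?_)
        simp [searchPotential, hp, hbuf]
    · simp only [Node.child_of_leaf hp]
      exact searchPotential_leaf hest hL hc hb hA0 hG hρ0 hρ1 hρ harr hT1 hT2 hp buf
  · simp [Node.root, treeDist, hm]

/-- The risk bound, with constants that do not depend on the tree, the cost, the prior and the
parameters. -/
lemma Model.IsMLE.exists_hds_risk_le (hest : S.IsMLE est) (hfin : ∀ l, (S.Θ₁ l).Finite)
    (hne : ∀ l, (S.Θ₁ l).Nonempty) {Δ : ℝ} (hΔ : 0 < Δ) (hAS1 : S.KLSeparated Δ)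
    (hmom : ∀ θ ∈ S.Θ₁ 0, MemLp (S.llr 0 θ) 2 (S.law 0 θ)) :
    ∃ n₀ : ℕ, ∀ N₀ ≥ n₀, ∀ (K : ℕ → ℕ) (η : ℝ), 0 < η → BddAbove (Set.range K) →
      (∀ l, InternalTestGood S est l (K l) (1 / 2 + η)) →
      ∃ C B : ℝ, ∀ L : ℕ, 1 ≤ L → ∀ c : ℝ, 0 < c → c < 1 →
        ∀ θ : ℕ → P, (∀ l, θ l ∈ S.Θ₁ l) → ∀ prior : PMF (Leaf L),
          risk S θ prior c (hds S est K N₀ c L) ≤ ENNReal.ofReal (c * C * L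
            + c * Real.log (L / c) / (S.kl 0 (θ 0) (S.θ₀ 0)).toReal + B * c) := by
  have hD : ∀ θ ∈ S.Θ₁ 0, 0 < (S.kl 0 θ (S.θ₀ 0)).toReal := fun θ hθ =>
    hΔ.trans_le (toReal_kl_leaf_ge hAS1 hθ (hmom θ hθ))
  have hpot := fun θ hθ => hest.exists_anomalousLeaf_potential (hfin 0) hθ (hmom θ hθ) (hD θ hθ)
    (S.toReal_kl 0 θ (S.θ₀ 0)).symm
  have hev := (Filter.eventually_all_finite (hfin 0) (l := Filter.atTop)).2 fun θ hθ =>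
    Filter.eventually_atTop.2 (hpot θ hθ)
  obtain ⟨n₀, hn₀⟩ := Filter.eventually_atTop.1 hev
  obtain ⟨ρ, hρ0, hρ1, hρ⟩ := exists_bhatt_bound (hfin 0) subset_rfl (S.θ₀ 0)
    fun θ hθ => S.law_ne_of_kl_pos hΔ (hAS1 0 θ hθ).1
  refine ⟨n₀, fun N₀ hN₀ K η hη hKb hgood => ?_⟩
  obtain ⟨Kmax, hKmax⟩ := hKb
  have hK1 : ∀ l, 1 ≤ K l := by
    -- Without samples the test always moves to the parent.
    intro l
    by_contra hl
    have hl0 : K l = 0 := by omega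
    obtain ⟨θ, hθ⟩ := hne l
    have h1 := ((hgood l).2 θ hθ).1
    rw [hl0] at h1
    have h2 : moveProb S est l 0 θ (S.θ₀ l) (some false) = 0 := by
      simp [moveProb, internalMove, gllr]
    linarith
  have hinv : 0 < (1 - ρ)⁻¹ := inv_pos.2 (by linarith)
  set A : ℝ := Max.max (Kmax / η) (N₀ + (1 - ρ)⁻¹ + 1)
  have hA1 : (N₀ : ℝ) + (1 - ρ)⁻¹ + 1 ≤ A := le_max_right _ _
  have hA0 : 0 ≤ A := le_trans (by positivity) hA1
  have hKA : ∀ l, (K l : ℝ) ≤ η * A := by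
    intro l
    have h1 : (K l : ℝ) ≤ Kmax := by exact_mod_cast hKmax ⟨l, rfl⟩
    have h2 : (Kmax : ℝ) / η ≤ A := le_max_left _ _
    rw [div_le_iff₀ hη] at h2
    linarith
  have hC := fun θ hθ => hn₀ N₀ hN₀ θ hθ A hA0
  choose! C₂ hAC hT using hC
  obtain ⟨B, hB⟩ := ((hfin 0).image C₂).bddAbove
  refine ⟨A, B, fun L hL c hc hc1 θ hθ prior => ?_⟩
  have hL' : (1 : ℝ) ≤ L := by exact_mod_cast hL
  have hb : 0 ≤ Real.log (L / c) :=
    Real.log_nonneg ((one_le_div hc).2 (hc1.le.trans hL'))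
  obtain ⟨T, hT0, hT1, hT2⟩ := hT (θ 0) (hθ 0) (Real.log (L / c)) hb
  set D := (S.kl 0 (θ 0) (S.θ₀ 0)).toReal
  have hD0 : 0 < D := hD _ (hθ 0)
  set G := Real.log (L / c) / D + C₂ (θ 0) - A with hGdef
  have hG : 0 ≤ G := by
    have := hAC _ (hθ 0)
    have : 0 ≤ Real.log (L / c) / D := by positivity
    linarith
  have hAG : Real.log (L / c) / D + C₂ (θ 0) = A + G := by rw [hGdef]; ring
  rw [hAG] at hT2
  have hNA : N₀ + (1 - ρ)⁻¹ + 1 / (L : ℝ) ≤ A := by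
    have : 1 / (L : ℝ) ≤ 1 := (div_le_one (by linarith)).2 hL'
    linarith
  have hcost := hds_cost_le hest hfin hθ hK1 hgood hL hc hb hA0 hG hKA hρ0 hρ1 hρ hNA hT0 hT1 hT2
  rw [risk_eq]
  calc ∑ m, prior m * (obsLaw S θ m {ω | ¬ (hds S est K N₀ c L).Correct m ω} +
        ENNReal.ofReal c * ∫⁻ ω, (hds S est K N₀ c L).stopTime ω ∂obsLaw S θ m)
      ≤ ∑ m, prior m * ENNReal.ofReal (c * (A * L + G)) := by
        refine Finset.sum_le_sum fun m _ => mul_le_mul_right (le_of_eq_of_le ?_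
          (le_of_le_of_eq (mul_le_mul_right (hcost m) (ENNReal.ofReal c)) ?_)) _
        · rw [mul_add, ← mul_assoc, ← ENNReal.ofReal_mul hc.le, mul_one_div_cancel hc.ne',
            ENNReal.ofReal_one, one_mul]
        · rw [← ENNReal.ofReal_mul hc.le]
    _ = ENNReal.ofReal (c * (A * L + G)) := by rw [← Finset.sum_mul, sum_prior, one_mul]
    _ ≤ _ := by
        refine ENNReal.ofReal_le_ofReal ?_
        have h1 : C₂ (θ 0) ≤ B := hB ⟨θ 0, hθ 0, rfl⟩
        have h2 : c * (A * L + G) = c * A * L + c * Real.log (L / c) / D + (C₂ (θ 0) - A) * c := by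
          rw [hGdef]
          ring
        rw [h2]
        have h3 : (C₂ (θ 0) - A) * c ≤ B * c := by
          gcongr
          linarith
        linarith

end HDSRisk

/-! ### The probability of a declaration -/

section Declare

variable {Y P : Type*} [MeasurableSpace Y] {L : ℕ} {S : Model Y P} {θ : ℕ → P} {m : Leaf L}
  {π : Policy L Y}

open Classical in
/-- The indicator of the data on which the decision of `π` is to declare exactly `k`
anomalous. -/
noncomputable def Policy.declares {Y : Type*} (π : Policy L Y) (k : Leaf L) (ys : List Y) :
    ℝ≥0∞ :=
  if π.decision ys = fun j => decide (j = k) then 1 else 0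

lemma Policy.declares_le_one {Y : Type*} (π : Policy L Y) (k : Leaf L) (ys : List Y) :
    π.declares k ys ≤ 1 := by
  unfold Policy.declares
  split_ifs <;> simp

lemma Policy.IsMeasurable.measurable_declares (hπ : π.IsMeasurable) (k : Leaf L) :
    Measurable (π.declares k) :=
  Measurable.ite (hπ.measurableSet_decision _) measurable_const measurable_const

lemma eq_of_indicator_eq {j k : Leaf L}
    (h : (fun i => decide (i = j)) = fun i => decide (i = k)) : j = k := by
  simpa using congrFun h j

/-- A decision declares at most one process. -/
lemma Policy.sum_declares_le_one {Y : Type*} (π : Policy L Y) (ys : List Y) :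
    ∑ k, π.declares k ys ≤ 1 := by
  classical
  by_cases h : ∃ k, π.decision ys = fun j => decide (j = k)
  · obtain ⟨k, hk⟩ := h
    rw [Finset.sum_eq_single k]
    · exact π.declares_le_one k ys
    · intro j _ hj
      rw [Policy.declares, if_neg]
      exact fun h => hj (eq_of_indicator_eq (h.symm.trans hk))
    · simp
  · push Not at h
    simp [Policy.declares, h]

lemma Policy.StopsAt.unique {Y : Type*} {π : Policy L Y} {ω : ℕ × Node L → Y} {s t : ℕ}
    (hs : π.StopsAt s ω) (ht : π.StopsAt t ω) : s = t := by
  rcases lt_trichotomy s t with h | h | h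
  · exact absurd hs.2 (ht.1 s h)
  · exact h
  · exact absurd ht.2 (hs.1 t h)

/-- The policy stops before time `n` and declares `k`. -/
def Policy.DeclaresBefore {Y : Type*} (π : Policy L Y) (k : Leaf L) (n : ℕ)
    (ω : ℕ × Node L → Y) : Prop :=
  ∃ s < n, π.StopsAt s ω ∧ π.decision (π.data ω s) = fun j => decide (j = k)

lemma Policy.IsMeasurable.value_declares_nil (hπ : π.IsMeasurable) (k : Leaf L) (n : ℕ) :
    value S θ m π 0 (π.declares k) n [] = obsLaw S θ m {ω | π.DeclaresBefore k n ω} := by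
  classical
  let E : ℕ → Set (ℕ × Node L → Y) := fun s => {ω | π.StopsAt s ω} ∩
    (fun ω => π.data ω s) ⁻¹' {ys | π.decision ys = fun j => decide (j = k)}
  have hE : ∀ s, MeasurableSet (E s) := fun s => (hπ.measurableSet_stopsAt s).inter
    (hπ.measurable_data s (hπ.measurableSet_decision _))
  have hU : {ω | π.DeclaresBefore k n ω} = ⋃ s ∈ Finset.range n, E s := by
    ext ω
    simp [E, Policy.DeclaresBefore, and_left_comm]
  rw [hπ.value_nil (hπ.measurable_declares k), hU, measure_biUnion_finset _ fun s _ => hE s]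
  · refine Finset.sum_congr rfl fun s _ => ?_
    rw [zero_mul, add_zero, ← lintegral_indicator_one (hE s)]
    refine lintegral_congr fun ω => ?_
    by_cases h1 : π.StopsAt s ω <;>
      by_cases h2 : π.decision (π.data ω s) = fun j => decide (j = k) <;>
      simp [E, Policy.declares, h1, h2]
  · intro s _ t _ hst
    exact Set.disjoint_left.2 fun ω hs ht => hst (hs.1.unique ht.1)

lemma Policy.tendsto_declaresBefore :
    Filter.Tendsto (fun n => obsLaw S θ m {ω | π.DeclaresBefore m n ω}) Filter.atTop
      (nhds (obsLaw S θ m {ω | π.Correct m ω})) := by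
  have hU : {ω | π.Correct m ω} = ⋃ n, {ω | π.DeclaresBefore m n ω} := by
    ext ω
    simp only [Policy.correct_iff, Policy.DeclaresBefore, Set.mem_iUnion, Set.mem_ofPred_eq]
    exact ⟨fun ⟨t, ht⟩ => ⟨t + 1, t, t.lt_succ_self, ht⟩, fun ⟨_, t, _, ht⟩ => ⟨t, ht⟩⟩
  rw [hU]
  exact tendsto_measure_iUnion_atTop fun i j hij ω ⟨s, hs, h⟩ => ⟨s, hs.trans_le hij, h⟩

lemma Policy.DeclaresBefore.not_correct {Y : Type*} {π : Policy L Y} {ω : ℕ × Node L → Y}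
    {k : Leaf L} {n : ℕ} (h : π.DeclaresBefore k n ω) (hkm : k ≠ m) : ¬ π.Correct m ω := by
  intro hc
  obtain ⟨s, _, hs, hd⟩ := h
  obtain ⟨t, ht, hd'⟩ := Policy.correct_iff.1 hc
  obtain rfl := hs.unique ht
  exact hkm (eq_of_indicator_eq (hd.symm.trans hd'))

lemma value_le {c w : ℝ≥0∞} {ψ : List Y → ℝ≥0∞} (hψ : ∀ ys, ψ ys ≤ w) (n : ℕ) (ys : List Y) :
    value S θ m π c ψ n ys ≤ w + n * c := by
  induction n generalizing ys with
  | zero => simp [value]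
  | succ n ih =>
    by_cases h : π.halt ys
    · simpa [value, h] using (hψ ys).trans le_self_add
    · simp only [value, h, if_false]
      refine (add_le_add_right (lintegral_mono fun y => ih _) c).trans (le_of_eq ?_)
      rw [lintegral_const, measure_univ, mul_one]
      push_cast
      ring

lemma Policy.IsMeasurable.value_time_nil_le (hπ : π.IsMeasurable) (n : ℕ) :
    value S θ m π 1 0 n [] ≤ ∫⁻ ω, π.stopTime ω ∂obsLaw S θ m := by
  rw [hπ.value_nil (measurable_zero : Measurable (0 : List Y → ℝ≥0∞)),
    hπ.lintegral_stopTime]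
  simpa using ENNReal.sum_le_tsum (f := fun s => obsLaw S θ m {ω | π.Alive (s + 1) ω})
    (Finset.range n)

end Declare

/-! ### Change of measure between sibling leaves -/

section LowerBound

variable {Y P : Type*} [MeasurableSpace Y] {L : ℕ} {S : Model Y P} {θ : ℕ → P} {m m' : Leaf L}
  {π : Policy L Y}

/-- The Donsker-Varadhan inequality for two laws of the model. -/
lemma Model.integral_log_le (S : Model Y P) (l : ℕ) {a b : P} (hkl : S.kl l a b ≠ ⊤)
    {g : Y → ℝ} (hg : Measurable g) {C : ℝ} (hg1 : ∀ y, 1 ≤ g y) (hgC : ∀ y, g y ≤ C) :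
    ∫ y, Real.log (g y) ∂S.law l a ≤
      Real.log (∫ y, g y ∂S.law l b) + (S.kl l a b).toReal := by
  have hgb : ∀ μ : Measure Y, IsProbabilityMeasure μ → Integrable g μ := fun μ _ =>
    Integrable.of_bound hg.aestronglyMeasurable C (ae_of_all _ fun y => by
      rw [Real.norm_of_nonneg (zero_le_one.trans (hg1 y))]; exact hgC y)
  have hlog : Integrable (fun y => Real.log (g y)) (S.law l a) :=
    Integrable.of_bound (Real.measurable_log.comp hg).aestronglyMeasurable (Real.log C)
      (ae_of_all _ fun y => by
        rw [Real.norm_of_nonneg (Real.log_nonneg (hg1 y))]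
        exact Real.log_le_log (zero_lt_one.trans_le (hg1 y)) (hgC y))
  set Z := ∫ y, g y ∂S.law l b with hZ
  have hZ0 : 0 < Z := by
    have := integral_mono (integrable_const (1 : ℝ)) (hgb (S.law l b) inferInstance) hg1
    simp only [integral_const, probReal_univ, smul_eq_mul, mul_one] at this
    linarith
  have hR := S.integrable_log_ratio l hkl
  have hrg : Integrable (fun y => S.f l b y / S.f l a y * g y) (S.law l a) :=
    (S.integrable_ratio l a b).mul_bdd (c := C) hg.aestronglyMeasurable (ae_of_all _ fun y => by
      rw [Real.norm_of_nonneg (zero_le_one.trans (hg1 y))]; exact hgC y)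
  have hint : ∫ y, S.f l b y / S.f l a y * g y ∂S.law l a = Z := by
    rw [hZ, S.law_withDensity l a b, integral_withDensity_eq_integral_toReal_smul
      (S.measurable_ratio l a b).ennreal_ofReal (by simp)]
    refine integral_congr_ae (ae_of_all _ fun y => ?_)
    simp only [smul_eq_mul]
    rw [ENNReal.toReal_ofReal (S.ratio_pos l a b y).le]
  have hpt : ∀ y, Real.log (g y) - Real.log Z - Real.log (S.f l a y / S.f l b y) ≤
      Z⁻¹ * (S.f l b y / S.f l a y * g y) - 1 := by
    intro y
    have hg0 : 0 < g y := zero_lt_one.trans_le (hg1 y)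
    have ha := S.f_pos l a y
    have hb := S.f_pos l b y
    have h1 : Real.log (g y) - Real.log Z - Real.log (S.f l a y / S.f l b y) =
        Real.log (Z⁻¹ * (S.f l b y / S.f l a y * g y)) := by
      rw [Real.log_mul (by positivity) (by positivity), Real.log_mul (by positivity) hg0.ne',
        Real.log_inv, Real.log_div ha.ne' hb.ne', Real.log_div hb.ne' ha.ne']
      ring
    rw [h1]
    exact Real.log_le_sub_one_of_pos (by positivity)
  have hle := integral_mono ((hlog.sub (integrable_const _)).sub hR)
    ((hrg.const_mul Z⁻¹).sub (integrable_const 1)) hpt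
  simp only [Pi.sub_apply] at hle
  rw [integral_sub (f := fun y => Real.log (g y) - Real.log Z) (hlog.sub (integrable_const _)) hR,
    integral_sub hlog (integrable_const _), integral_sub (hrg.const_mul Z⁻¹) (integrable_const 1),
    integral_const_mul, hint, inv_mul_cancel₀ hZ0.ne', ← S.toReal_kl] at hle
  simp only [integral_const, probReal_univ, smul_eq_mul, mul_one, sub_self, one_mul] at hle
  linarith

/-- The laws of the observations under two sibling leaves differ at these two leaves only. -/
lemma kl_sibling_le (hmm : m.1.tail = m'.1.tail)
    (hkl : S.kl 0 (S.θ₀ 0) (θ 0) ≤ S.kl 0 (θ 0) (S.θ₀ 0)) (p : Node L) :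
    S.kl p.level (if p.1 <:+ m.1 then θ p.level else S.θ₀ p.level)
      (if p.1 <:+ m'.1 then θ p.level else S.θ₀ p.level) ≤ S.kl 0 (θ 0) (S.θ₀ 0) := by
  have hself : ∀ l a, S.kl l a a = 0 := fun l a => InformationTheory.klDiv_self _
  have htail : ∀ k : Leaf L, p.1.length < L → (p.1 <:+ k.1 ↔ p.1 <:+ k.1.tail) := by
    intro k hp
    obtain ⟨l, hk⟩ := k
    refine ⟨fun h => ?_, fun h => h.trans (List.tail_suffix _)⟩
    dsimp only at h ⊢
    obtain _ | ⟨b, t⟩ := l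
    · exact h
    · rcases List.suffix_cons_iff.1 h with h | h
      · rw [h, hk] at hp
        exact absurd hp (lt_irrefl _)
      · simpa using h
  by_cases hp : p.1.length < L
  · have h : p.1 <:+ m.1 ↔ p.1 <:+ m'.1 := by rw [htail m hp, htail m' hp, hmm]
    rw [if_congr h rfl rfl, hself]
    exact zero_le
  · have hl : p.level = 0 := by
      simp [Node.level]
      omega
    rw [hl]
    split_ifs
    · rw [hself]; exact zero_le
    · exact le_rfl
    · exact hkl
    · rw [hself]; exact zero_le

/-- The change-of-measure inequality along the dynamic-programming recursion: under the leaf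
`m` the declaration of `m` is likely only if it is not too unlikely under the sibling `m'`,
unless many observations are taken. -/
lemma mul_value_declares_le (hπ : π.IsMeasurable) (hmm : m.1.tail = m'.1.tail)
    (hkl : S.kl 0 (S.θ₀ 0) (θ 0) ≤ S.kl 0 (θ 0) (S.θ₀ 0)) (hD : S.kl 0 (θ 0) (S.θ₀ 0) ≠ ⊤)
    {lam : ℝ} (hlam : 0 ≤ lam) (n : ℕ) (ys : List Y) :
    lam * (value S θ m π 0 (π.declares m) n ys).toReal ≤
      Real.log (1 + (Real.exp lam - 1) * (value S θ m' π 0 (π.declares m) n ys).toReal) +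
      (S.kl 0 (θ 0) (S.θ₀ 0)).toReal * (value S θ m π 1 0 n ys).toReal := by
  induction n generalizing ys with
  | zero => simp [value]
  | succ n ih =>
    have hexp : 0 ≤ Real.exp lam - 1 := by linarith [Real.add_one_le_exp lam]
    by_cases h : π.halt ys
    · by_cases h' : π.decision ys = fun j => decide (j = m) <;>
        simp [value, h, Policy.declares, h']
    · simp only [value, h, if_false, zero_add]
      set μ := nodeLaw S θ m (π.select ys) with hμ
      set μ' := nodeLaw S θ m' (π.select ys) with hμ'
      set D := (S.kl 0 (θ 0) (S.θ₀ 0)).toReal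
      have hA : ∀ (k : Leaf L) zs, value S θ k π 0 (π.declares m) n zs ≤ 1 := fun k zs => by
        simpa using value_le (S := S) (θ := θ) (m := k) (π := π) (c := 0)
          (π.declares_le_one m) n zs
      have hT : ∀ zs, value S θ m π 1 0 n zs ≤ n := fun zs => by
        simpa using value_le (S := S) (θ := θ) (m := m) (π := π) (c := 1) (ψ := 0) (w := 0)
          (fun _ => le_rfl) n zs
      have happ : Measurable fun y : Y => ys ++ [y] :=
        measurable_append_singleton.comp (measurable_const.prodMk measurable_id)
      have mA : ∀ k, Measurable fun y => value S θ k π 0 (π.declares m) n (ys ++ [y]) :=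
        fun k => (hπ.measurable_value (hπ.measurable_declares m) n).comp happ
      have mT : Measurable fun y => value S θ m π 1 0 n (ys ++ [y]) :=
        (hπ.measurable_value (measurable_zero : Measurable (0 : List Y → ℝ≥0∞))
          n).comp happ
      have rA : ∀ k, ∀ μ : Measure Y, IsProbabilityMeasure μ →
          Integrable (fun y => (value S θ k π 0 (π.declares m) n (ys ++ [y])).toReal) μ :=
        fun k μ _ => Integrable.of_bound (mA k).ennreal_toReal.aestronglyMeasurable 1
          (ae_of_all _ fun y => by
            rw [Real.norm_of_nonneg ENNReal.toReal_nonneg]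
            exact ENNReal.toReal_mono ENNReal.one_ne_top (hA k _))
      have rT : Integrable (fun y => (value S θ m π 1 0 n (ys ++ [y])).toReal) μ :=
        Integrable.of_bound mT.ennreal_toReal.aestronglyMeasurable n
          (ae_of_all _ fun y => by
            rw [Real.norm_of_nonneg ENNReal.toReal_nonneg]
            exact ENNReal.toReal_mono (ENNReal.natCast_ne_top n) (hT _))
      have iA : ∀ k, ∀ μ : Measure Y, IsProbabilityMeasure μ →
          (∫⁻ y, value S θ k π 0 (π.declares m) n (ys ++ [y]) ∂μ).toReal =
          ∫ y, (value S θ k π 0 (π.declares m) n (ys ++ [y])).toReal ∂μ := fun k μ _ =>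
        (integral_toReal (mA k).aemeasurable
          (ae_of_all _ fun y => (hA k _).trans_lt ENNReal.one_lt_top)).symm
      have iT : (1 + ∫⁻ y, value S θ m π 1 0 n (ys ++ [y]) ∂μ).toReal =
          1 + ∫ y, (value S θ m π 1 0 n (ys ++ [y])).toReal ∂μ := by
        rw [ENNReal.toReal_add ENNReal.one_ne_top, ENNReal.toReal_one,
          integral_toReal mT.aemeasurable
          (ae_of_all _ fun y => (hT _).trans_lt (ENNReal.natCast_lt_top n))]
        refine ((lintegral_mono fun y => hT _).trans_lt ?_).ne
        simp
      rw [iA m μ inferInstance, iA m' μ' inferInstance, iT]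
      set g : Y → ℝ := fun y =>
        1 + (Real.exp lam - 1) * (value S θ m' π 0 (π.declares m) n (ys ++ [y])).toReal with hg
      have mg : Measurable g := ((mA m').ennreal_toReal.const_mul _).const_add _
      have hg1 : ∀ y, 1 ≤ g y := fun y => by
        have := mul_nonneg hexp (ENNReal.toReal_nonneg
          (a := value S θ m' π 0 (π.declares m) n (ys ++ [y])))
        simp only [hg]
        linarith
      have hgC : ∀ y, g y ≤ 1 + (Real.exp lam - 1) * 1 := fun y => by
        have := ENNReal.toReal_mono ENNReal.one_ne_top (hA m' (ys ++ [y]))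
        rw [ENNReal.toReal_one] at this
        simp only [hg]
        gcongr
      have hkp := kl_sibling_le (S := S) (θ := θ) hmm hkl (π.select ys)
      have hDV := S.integral_log_le _ (ne_top_of_le_ne_top hD hkp) mg hg1 hgC
      have hkD := ENNReal.toReal_mono hD hkp
      change ∫ y, Real.log (g y) ∂μ ≤ Real.log (∫ y, g y ∂μ') + _ at hDV
      have hlog : Integrable (fun y => Real.log (g y)) μ :=
        Integrable.of_bound (Real.measurable_log.comp mg).aestronglyMeasurable
          (Real.log (1 + (Real.exp lam - 1) * 1)) (ae_of_all _ fun y => by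
            rw [Real.norm_of_nonneg (Real.log_nonneg (hg1 y))]
            exact Real.log_le_log (zero_lt_one.trans_le (hg1 y)) (hgC y))
      have hint : ∫ y, g y ∂μ' = 1 + (Real.exp lam - 1) *
          ∫ y, (value S θ m' π 0 (π.declares m) n (ys ++ [y])).toReal ∂μ' := by
        simp only [hg]
        rw [integral_add (integrable_const _) ((rA m' μ' inferInstance).const_mul _),
          integral_const_mul]
        simp
      rw [hint] at hDV
      have hmono := integral_mono ((rA m μ inferInstance).const_mul lam)
        (hlog.add (rT.const_mul D)) fun y => ih (ys ++ [y])
      simp only [Pi.add_apply] at hmono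
      rw [integral_add hlog (rT.const_mul D), integral_const_mul, integral_const_mul] at hmono
      linarith

/-- Lower bound on the expected stopping time when the error probability under the sibling is
small. -/
lemma mul_prob_correct_le (hπ : π.IsMeasurable) (hne : m ≠ m') (hmm : m.1.tail = m'.1.tail)
    (hkl : S.kl 0 (S.θ₀ 0) (θ 0) ≤ S.kl 0 (θ 0) (S.θ₀ 0)) (hD : S.kl 0 (θ 0) (S.θ₀ 0) ≠ ⊤)
    (hT : ∫⁻ ω, π.stopTime ω ∂obsLaw S θ m ≠ ⊤) {lam : ℝ} (hlam : 0 ≤ lam) :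
    lam * (obsLaw S θ m).real {ω | π.Correct m ω} ≤
      Real.log (1 + (Real.exp lam - 1) * (obsLaw S θ m').real {ω | ¬ π.Correct m' ω}) +
      (S.kl 0 (θ 0) (S.θ₀ 0)).toReal * (∫⁻ ω, π.stopTime ω ∂obsLaw S θ m).toReal := by
  have hexp : 0 ≤ Real.exp lam - 1 := by linarith [Real.add_one_le_exp lam]
  have hlim := (ENNReal.tendsto_toReal (measure_ne_top (obsLaw S θ m) _)).comp
    (Policy.tendsto_declaresBefore (S := S) (θ := θ) (m := m) (π := π))
  refine le_of_tendsto (hlim.const_mul lam) (Filter.Eventually.of_forall fun n => ?_)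
  have h := mul_value_declares_le hπ hmm hkl hD hlam n []
  rw [hπ.value_declares_nil, hπ.value_declares_nil] at h
  refine h.trans (add_le_add (Real.log_le_log ?_ ?_) ?_)
  · have := mul_nonneg hexp
      (ENNReal.toReal_nonneg (a := obsLaw S θ m' {ω | π.DeclaresBefore m n ω}))
    linarith
  · have : (obsLaw S θ m' {ω | π.DeclaresBefore m n ω}).toReal ≤
        (obsLaw S θ m').real {ω | ¬ π.Correct m' ω} :=
      measureReal_mono fun ω hω => hω.not_correct hne
    gcongr
  · exact mul_le_mul_of_nonneg_left (ENNReal.toReal_mono hT (hπ.value_time_nil_le n))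
      ENNReal.toReal_nonneg

lemma exists_sibling (hL : 1 ≤ L) (m : Leaf L) : ∃ m' : Leaf L, m ≠ m' ∧ m.1.tail = m'.1.tail := by
  obtain ⟨l, hl⟩ := m
  obtain _ | ⟨b, t⟩ := l
  · simp at hl
    omega
  · refine ⟨⟨(!b) :: t, by simpa using hl⟩, fun h => ?_, rfl⟩
    have := congrArg Subtype.val h
    simp at this

/-- A policy of risk below `U` has error probability at most `U / p` under every leaf, which
forces it to take about `log (p / U) / D` observations. -/
lemma le_optRisk (hL : 1 ≤ L) {prior : PMF (Leaf L)} {p U c : ℝ} (hp : 0 < p)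
    (hprior : ∀ m, ENNReal.ofReal p ≤ prior m) (hU : 0 < U) (hUp : U ≤ p) (hc : 0 < c)
    (hkl : S.kl 0 (S.θ₀ 0) (θ 0) ≤ S.kl 0 (θ 0) (S.θ₀ 0)) (hD : S.kl 0 (θ 0) (S.θ₀ 0) ≠ ⊤)
    (hD0 : 0 < (S.kl 0 (θ 0) (S.θ₀ 0)).toReal) :
    ENNReal.ofReal (min U (c * (((1 - U / p) * -Real.log (U / p) - Real.log 2) /
      (S.kl 0 (θ 0) (S.θ₀ 0)).toReal))) ≤ optRisk S θ prior c := by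
  refine le_iInf₂ fun π hπ => ?_
  by_cases hR : ENNReal.ofReal U ≤ risk S θ prior c π
  · exact (ENNReal.ofReal_le_ofReal (min_le_left _ _)).trans hR
  rw [not_le] at hR
  refine (ENNReal.ofReal_le_ofReal (min_le_right _ _)).trans ?_
  set α := U / p
  have hα0 : 0 < α := div_pos hU hp
  have hα1 : α ≤ 1 := (div_le_one hp).2 hUp
  set D := (S.kl 0 (θ 0) (S.θ₀ 0)).toReal
  have herr : ∀ k, (obsLaw S θ k).real {ω | ¬ π.Correct k ω} ≤ α := by
    intro k
    have h1 : ENNReal.ofReal p * obsLaw S θ k {ω | ¬ π.Correct k ω} ≤ ENNReal.ofReal U := by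
      refine le_trans ?_ hR.le
      refine le_trans (mul_le_mul_left (hprior k) _) (le_trans ?_ le_self_add)
      exact Finset.single_le_sum
        (f := fun k => prior k * obsLaw S θ k {ω | ¬ π.Correct k ω})
        (fun _ _ => zero_le) (Finset.mem_univ k)
    have h2 := ENNReal.toReal_mono ENNReal.ofReal_ne_top h1
    rw [ENNReal.toReal_mul, ENNReal.toReal_ofReal hp.le, ENNReal.toReal_ofReal hU.le] at h2
    rw [le_div_iff₀ hp, mul_comm]
    exact h2
  have htime : ∀ k, ENNReal.ofReal (((1 - α) * -Real.log α - Real.log 2) / D) ≤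
      ∫⁻ ω, π.stopTime ω ∂obsLaw S θ k := by
    intro k
    by_cases hT : ∫⁻ ω, π.stopTime ω ∂obsLaw S θ k = ⊤
    · rw [hT]
      exact le_top
    obtain ⟨k', hne, hkk⟩ := exists_sibling hL k
    have hlam : 0 ≤ -Real.log α := neg_nonneg.2 (Real.log_nonpos hα0.le hα1)
    have h := mul_prob_correct_le hπ hne hkk hkl hD hT hlam
    refine ENNReal.ofReal_le_of_le_toReal ((div_le_iff₀ hD0).2 ?_)
    have hcor : 1 - α ≤ (obsLaw S θ k).real {ω | π.Correct k ω} := by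
      have h1 := probReal_compl_eq_one_sub (μ := obsLaw S θ k) (hπ.measurableSet_correct k)
      have h2 := herr k
      change (obsLaw S θ k).real {ω | ¬ π.Correct k ω} = _ at h1
      linarith
    have hexp : Real.exp (-Real.log α) = α⁻¹ := by rw [Real.exp_neg, Real.exp_log hα0]
    have hlog : Real.log (1 + (Real.exp (-Real.log α) - 1) *
        (obsLaw S θ k').real {ω | ¬ π.Correct k' ω}) ≤ Real.log 2 := by
      rw [hexp]
      have h1 : 0 ≤ α⁻¹ - 1 := sub_nonneg.2 ((one_le_inv₀ hα0).2 hα1)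
      have h2 : (α⁻¹ - 1) * (obsLaw S θ k').real {ω | ¬ π.Correct k' ω} ≤ (α⁻¹ - 1) * α :=
        mul_le_mul_of_nonneg_left (herr k') h1
      have h3 : (α⁻¹ - 1) * α = 1 - α := by
        rw [sub_mul, inv_mul_cancel₀ hα0.ne', one_mul]
      have h4 := mul_nonneg h1 (measureReal_nonneg (μ := obsLaw S θ k')
        (s := {ω | ¬ π.Correct k' ω}))
      exact Real.log_le_log (by linarith) (by linarith)
    have h5 := mul_le_mul_of_nonneg_left hcor hlam
    linarith
  refine le_trans ?_ (le_add_self : _ ≤ risk S θ prior c π)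
  rw [ENNReal.ofReal_mul hc.le]
  refine mul_le_mul_right ?_ _
  calc ENNReal.ofReal (((1 - α) * -Real.log α - Real.log 2) / D)
      = ∑ k, prior k * ENNReal.ofReal (((1 - α) * -Real.log α - Real.log 2) / D) := by
        rw [← Finset.sum_mul, sum_prior, one_mul]
    _ ≤ _ := Finset.sum_le_sum fun k _ => mul_le_mul_right (htime k) _

/-- The upper and the lower bound on the risk agree to first order as the cost vanishes. Here
`x` stands for `log (1 / c)`, and both bounds are divided by `c * x / D`. -/
lemma tendsto_bounds {κ D p : ℝ} (hκ : 0 < κ) (hD : 0 < D) (hp : 0 < p) :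
    Filter.Tendsto (fun x : ℝ => Real.exp (-x) * (κ + x / D)) Filter.atTop (nhds 0) ∧
    Filter.Tendsto (fun x : ℝ => (κ + x / D) / (x / D)) Filter.atTop (nhds 1) ∧
    Filter.Tendsto (fun x : ℝ => ((1 - Real.exp (-x) * (κ + x / D) / p) *
      -Real.log (Real.exp (-x) * (κ + x / D) / p) - Real.log 2) / x) Filter.atTop (nhds 1) := by
  have hinv : Filter.Tendsto (fun x : ℝ => x⁻¹) Filter.atTop (nhds 0) := tendsto_inv_atTop_zero
  have h1 : Filter.Tendsto (fun x : ℝ => Real.exp (-x) * (κ + x / D)) Filter.atTop (nhds 0) := by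
    have e0 := Real.tendsto_exp_neg_atTop_nhds_zero
    have e1 := Real.tendsto_pow_mul_exp_neg_atTop_nhds_zero 1
    have := (e0.const_mul κ).add (e1.const_mul D⁻¹)
    simp only [mul_zero, add_zero] at this
    refine this.congr fun x => ?_
    rw [pow_one, div_eq_mul_inv]
    ring
  have h2 : Filter.Tendsto (fun x : ℝ => (κ + x / D) / (x / D)) Filter.atTop (nhds 1) := by
    have := (hinv.const_mul (κ * D)).add_const 1
    rw [mul_zero, zero_add] at this
    refine this.congr' ?_
    filter_upwards [Filter.eventually_gt_atTop 0] with x hx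
    field_simp
  refine ⟨h1, h2, ?_⟩
  have hu : Filter.Tendsto (fun x : ℝ => κ + x / D) Filter.atTop Filter.atTop :=
    Filter.tendsto_atTop_add_const_left _ _ (Filter.tendsto_id.atTop_div_const hD)
  have h3 : Filter.Tendsto (fun x : ℝ => Real.log (κ + x / D) / x) Filter.atTop (nhds 0) := by
    have hl := Real.isLittleO_log_id_atTop.tendsto_div_nhds_zero.comp hu
    have := (hl.mul h2).mul_const D⁻¹
    rw [zero_mul, zero_mul] at this
    refine this.congr' ?_
    filter_upwards [Filter.eventually_gt_atTop 0] with x hx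
    have : 0 < κ + x / D := by positivity
    simp only [Function.comp_apply, id_eq]
    field_simp
  have h4 := (((h1.div_const p).const_sub 1).mul
    (((hinv.const_mul (Real.log p)).const_add 1).sub h3)).sub (hinv.const_mul (Real.log 2))
  simp only [zero_div, sub_zero, mul_zero, add_zero, mul_one] at h4
  refine h4.congr' ?_
  filter_upwards [Filter.eventually_gt_atTop 0] with x hx
  have : 0 < κ + x / D := by positivity
  rw [Real.log_div (by positivity) hp.ne', Real.log_mul (Real.exp_ne_zero _) this.ne',
    Real.log_exp]
  field_simp
  ring

/-- Asymptotic optimality of any family of policies with the first-order optimal risk. -/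
lemma tendsto_risk_div_optRisk (hL : 1 ≤ L) {prior : PMF (Leaf L)} (hprior : ∀ m, prior m ≠ 0)
    (hkl : S.kl 0 (S.θ₀ 0) (θ 0) ≤ S.kl 0 (θ 0) (S.θ₀ 0)) (hD : S.kl 0 (θ 0) (S.θ₀ 0) ≠ ⊤)
    (hD0 : 0 < (S.kl 0 (θ 0) (S.θ₀ 0)).toReal) {π : ℝ → Policy L Y}
    (hπ : ∀ c, (π c).IsMeasurable) {κ : ℝ} (hκ : 0 < κ)
    (hrisk : ∀ c, 0 < c → c < 1 → risk S θ prior c (π c) ≤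
      ENNReal.ofReal (c * (κ + -Real.log c / (S.kl 0 (θ 0) (S.θ₀ 0)).toReal))) :
    Filter.Tendsto (fun c => risk S θ prior c (π c) / optRisk S θ prior c)
      (nhdsWithin 0 (Set.Ioi 0)) (nhds 1) := by
  set D := (S.kl 0 (θ 0) (S.θ₀ 0)).toReal
  obtain ⟨p, hp, hpp⟩ : ∃ p : ℝ, 0 < p ∧ ∀ m, ENNReal.ofReal p ≤ prior m := by
    have hne : Nonempty (Leaf L) := ⟨⟨List.replicate L true, by simp⟩⟩
    obtain ⟨m₀, hm₀⟩ := Finite.exists_min fun m => prior m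
    refine ⟨(prior m₀).toReal, ENNReal.toReal_pos (hprior m₀) (prior.apply_ne_top m₀), fun m => ?_⟩
    rw [ENNReal.ofReal_toReal (prior.apply_ne_top m₀)]
    exact hm₀ m
  obtain ⟨t1, t2, t3⟩ := tendsto_bounds hκ hD0 hp
  set u : ℝ → ℝ := fun x => (κ + x / D) / (x / D)
  set v : ℝ → ℝ := fun x => ((1 - Real.exp (-x) * (κ + x / D) / p) *
      -Real.log (Real.exp (-x) * (κ + x / D) / p) - Real.log 2) / x
  have hx : Filter.Tendsto (fun c : ℝ => -Real.log c) (nhdsWithin 0 (Set.Ioi 0)) Filter.atTop :=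
    Filter.tendsto_neg_atBot_atTop.comp Real.tendsto_log_nhdsGT_zero
  have hupper : Filter.Tendsto (fun c : ℝ => ENNReal.ofReal (u (-Real.log c) /
      min (u (-Real.log c)) (v (-Real.log c)))) (nhdsWithin 0 (Set.Ioi 0)) (nhds 1) := by
    have := (t2.div (t2.min t3) (by simp)).comp hx
    simp only [min_self, div_one] at this
    have h1 := ENNReal.tendsto_ofReal this
    rwa [ENNReal.ofReal_one] at h1
  have hev : ∀ᶠ c : ℝ in nhdsWithin 0 (Set.Ioi 0), 0 < c ∧ c < 1 ∧ 0 < v (-Real.log c) ∧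
      Real.exp (-(-Real.log c)) * (κ + -Real.log c / D) < p := by
    filter_upwards [self_mem_nhdsWithin, mem_nhdsWithin_of_mem_nhds (Iio_mem_nhds one_pos),
      hx.eventually (t3.eventually (lt_mem_nhds one_pos)),
      hx.eventually (t1.eventually (gt_mem_nhds hp))] with c h1 h2 h3 h4
    exact ⟨h1, h2, h3, h4⟩
  have hbd : ∀ᶠ c : ℝ in nhdsWithin 0 (Set.Ioi 0),
      1 ≤ risk S θ prior c (π c) / optRisk S θ prior c ∧
      risk S θ prior c (π c) / optRisk S θ prior c ≤
        ENNReal.ofReal (u (-Real.log c) / min (u (-Real.log c)) (v (-Real.log c))) := by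
    filter_upwards [hev] with c ⟨hc, hc1, hv, hU⟩
    set x := -Real.log c with hxdef
    have hx0 : 0 < x := neg_pos.2 (Real.log_neg hc hc1)
    have hcx : Real.exp (-x) = c := by rw [hxdef, neg_neg, Real.exp_log hc]
    rw [hcx] at hU
    have hU0 : 0 < c * (κ + x / D) := by positivity
    have hs : 0 < c * (x / D) := by positivity
    have hu : 0 < u x := by positivity
    have hmin : 0 < min (u x) (v x) := lt_min hu hv
    have hopt := le_optRisk (S := S) (θ := θ) hL hp hpp hU0 hU.le hc hkl hD hD0
    have e1 : c * (κ + x / D) = c * (x / D) * u x := by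
      simp only [u]
      field_simp
    have e2 : c * (((1 - c * (κ + x / D) / p) * -Real.log (c * (κ + x / D) / p) -
        Real.log 2) / D) = c * (x / D) * v x := by
      simp only [v, hcx]
      field_simp
    rw [e2, e1, ← mul_min_of_nonneg _ _ hs.le] at hopt
    have hr := hrisk c hc hc1
    rw [← hxdef, e1] at hr
    have hle : optRisk S θ prior c ≤ risk S θ prior c (π c) := iInf₂_le (π c) (hπ c)
    have hpos : 0 < ENNReal.ofReal (c * (x / D) * min (u x) (v x)) :=
      ENNReal.ofReal_pos.2 (by positivity)
    have hopt0 : optRisk S θ prior c ≠ 0 := (hpos.trans_le hopt).ne'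
    have hoptT : optRisk S θ prior c ≠ ⊤ :=
      ne_top_of_le_ne_top ENNReal.ofReal_ne_top (hle.trans hr)
    refine ⟨(ENNReal.le_div_iff_mul_le (Or.inl hopt0) (Or.inl hoptT)).2 (by rwa [one_mul]), ?_⟩
    refine (ENNReal.div_le_div hr hopt).trans (le_of_eq ?_)
    rw [← ENNReal.ofReal_div_of_pos (by positivity), mul_div_mul_left _ _ hs.ne']
  exact tendsto_of_tendsto_of_tendsto_of_le_of_le' tendsto_const_nhds hupper
    (hbd.mono fun _ h => h.1) (hbd.mono fun _ h => h.2)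

end LowerBound

/-! ### The number of processes that few observations can identify -/

section Counting

variable {Y P : Type*} [MeasurableSpace Y] {L : ℕ} {S : Model Y P} {θ : ℕ → P} {m : Leaf L}
  {π : Policy L Y}

/-- Since a node has only two possible laws, every observation at most doubles the sum over all
processes `m` of the probability of declaring `m` correctly. -/
lemma sum_value_declares_le (hπ : π.IsMeasurable) (n : ℕ) (ys : List Y) :
    ∑ m, value S θ m π 0 (π.declares m) (n + 1) ys ≤ 2 ^ n := by
  classical
  induction n generalizing ys with
  | zero =>
    by_cases h : π.halt ys
    · simpa [value, h] using π.sum_declares_le_one ys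
    · simp [value, h]
  | succ n ih =>
    by_cases h : π.halt ys
    · simp only [value, h, if_true]
      exact (π.sum_declares_le_one ys).trans (one_le_pow₀ one_le_two)
    · have happ : Measurable fun y : Y => ys ++ [y] :=
        measurable_append_singleton.comp (measurable_const.prodMk measurable_id)
      have hm : ∀ k, Measurable fun y =>
          value S θ k π 0 (π.declares k) (n + 1) (ys ++ [y]) := fun k =>
        (hπ.measurable_value (hπ.measurable_declares k) (n + 1)).comp happ
      have hpart : ∀ (s : Finset (Leaf L)) (μ : Measure Y), IsProbabilityMeasure μ →
          ∑ k ∈ s, ∫⁻ y, value S θ k π 0 (π.declares k) (n + 1) (ys ++ [y]) ∂μ ≤ 2 ^ n := by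
        intro s μ _
        rw [← lintegral_finsetSum _ fun k _ => hm k]
        calc _ ≤ ∫⁻ _, 2 ^ n ∂μ := lintegral_mono fun y =>
              (Finset.sum_le_sum_of_subset (Finset.subset_univ s)).trans (ih _)
          _ = 2 ^ n := by simp
      set p := π.select ys
      have hstep : ∀ k, value S θ k π 0 (π.declares k) (n + 1 + 1) ys =
          ∫⁻ y, value S θ k π 0 (π.declares k) (n + 1) (ys ++ [y]) ∂nodeLaw S θ k p := by
        intro k
        rw [value, if_neg h, zero_add]
      simp_rw [hstep]
      rw [← Finset.sum_filter_add_sum_filter_not Finset.univ fun k : Leaf L => p.1 <:+ k.1,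
        pow_succ, mul_two]
      refine add_le_add (le_of_eq_of_le (Finset.sum_congr rfl fun k hk => ?_)
          (hpart _ (S.law p.level (θ p.level)) inferInstance))
        (le_of_eq_of_le (Finset.sum_congr rfl fun k hk => ?_)
          (hpart _ (S.law p.level (S.θ₀ p.level)) inferInstance))
      · rw [nodeLaw, if_pos (Finset.mem_filter.1 hk).2]
      · rw [nodeLaw, if_neg (Finset.mem_filter.1 hk).2]

lemma mul_prob_alive_le (hπ : π.IsMeasurable) (n : ℕ) :
    n * obsLaw S θ m {ω | π.Alive n ω} ≤ ∫⁻ ω, π.stopTime ω ∂obsLaw S θ m := by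
  rw [hπ.lintegral_stopTime]
  refine le_trans ?_ (ENNReal.sum_le_tsum (Finset.range n))
  calc n * obsLaw S θ m {ω | π.Alive n ω}
      = ∑ _s ∈ Finset.range n, obsLaw S θ m {ω | π.Alive n ω} := by simp
    _ ≤ ∑ s ∈ Finset.range n, obsLaw S θ m {ω | π.Alive (s + 1) ω} := by
        refine Finset.sum_le_sum fun s hs => measure_mono fun ω (hω : π.Alive n ω) r hr => ?_
        have := Finset.mem_range.1 hs
        exact hω r (by omega)

lemma one_le_declares_add_error_add_alive (hπ : π.IsMeasurable) (n : ℕ) :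
    1 ≤ value S θ m π 0 (π.declares m) n [] + obsLaw S θ m {ω | ¬ π.Correct m ω} +
      obsLaw S θ m {ω | π.Alive n ω} := by
  rw [hπ.value_declares_nil, ← measure_univ (μ := obsLaw S θ m)]
  refine le_trans (measure_mono fun ω _ => ?_)
    ((measure_union_le _ _).trans (add_le_add_left (measure_union_le _ _) _))
  by_cases hA : π.Alive n ω
  · exact Or.inr hA
  by_cases hC : π.Correct m ω
  · refine Or.inl (Or.inl ?_)
    obtain ⟨t, ht, hd⟩ := Policy.correct_iff.1 hC
    refine ⟨t, ?_, ht, hd⟩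
    by_contra! hn
    exact hA fun s hs => ht.1 s (hs.trans_le hn)
  · exact Or.inl (Or.inr hC)

/-- The trade-off between sample complexity and error probability under the uniform prior. -/
lemma le_sampleComplexity_add (hπ : π.IsMeasurable) (n : ℕ) :
    ((n + 1 : ℕ) : ℝ≥0∞) ≤ sampleComplexity S θ (PMF.uniformOfFintype (Leaf L)) π +
      (n + 1 : ℕ) * (errProb S θ (PMF.uniformOfFintype (Leaf L)) π + 2 ^ n / 2 ^ L) := by
  have hw : ∀ m, PMF.uniformOfFintype (Leaf L) m = (2 ^ L)⁻¹ := fun m => by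
    rw [PMF.uniformOfFintype_apply, card_vector]
    simp
  have hcount := mul_le_mul_right (sum_value_declares_le (S := S) (θ := θ) hπ n [])
    ((2 : ℝ≥0∞) ^ L)⁻¹
  rw [Finset.mul_sum] at hcount
  calc ((n + 1 : ℕ) : ℝ≥0∞)
      = (n + 1 : ℕ) * ∑ m, PMF.uniformOfFintype (Leaf L) m := by rw [sum_prior, mul_one]
    _ ≤ (n + 1 : ℕ) * ∑ m, PMF.uniformOfFintype (Leaf L) m *
          (value S θ m π 0 (π.declares m) (n + 1) [] + obsLaw S θ m {ω | ¬ π.Correct m ω} +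
            obsLaw S θ m {ω | π.Alive (n + 1) ω}) := by
        refine mul_le_mul_right (Finset.sum_le_sum fun m _ => ?_) _
        exact le_mul_of_one_le_right zero_le (one_le_declares_add_error_add_alive hπ _)
    _ = ∑ m, PMF.uniformOfFintype (Leaf L) m *
          ((n + 1 : ℕ) * obsLaw S θ m {ω | π.Alive (n + 1) ω}) +
        (n + 1 : ℕ) * (errProb S θ (PMF.uniformOfFintype (Leaf L)) π +
          ∑ m, (2 ^ L)⁻¹ * value S θ m π 0 (π.declares m) (n + 1) []) := by
        simp only [errProb, hw, Finset.mul_sum, ← Finset.sum_add_distrib]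
        exact Finset.sum_congr rfl fun m _ => by ring
    _ ≤ _ := by
        refine add_le_add (Finset.sum_le_sum fun m _ => mul_le_mul_right
          (mul_prob_alive_le hπ _) _) (mul_le_mul_right (add_le_add_right ?_ _) _)
        rwa [ENNReal.div_eq_inv_mul]

/-- With error probability at most `ε < 1`, the risk is at least of the order of the height of
the tree. -/
lemma exists_height_le_risk (S : Model Y P) {ε : ℝ} (hε : ε < 1) : ∃ M : ℝ, 0 ≤ M ∧
    ∀ c : ℝ, 0 < c → c < 1 → ∀ L : ℕ, 1 ≤ L →
      ∀ (θ : ℕ → P) (π : Policy L Y), π.IsMeasurable →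
        errProb S θ (PMF.uniformOfFintype (Leaf L)) π ≤ ENNReal.ofReal ε →
        ENNReal.ofReal (c * L) ≤
          ENNReal.ofReal M * risk S θ (PMF.uniformOfFintype (Leaf L)) c π := by
  set δ := (1 - max ε 0) / 2 with hδ
  have hδ0 : 0 < δ := by
    have : max ε 0 < 1 := max_lt hε one_pos
    linarith
  obtain ⟨k, hk⟩ := exists_pow_lt_of_lt_one hδ0 (by norm_num : (1 / 2 : ℝ) < 1)
  refine ⟨2 * k + 1 / δ, by positivity, ?_⟩
  intro c hc hc1 L hL θ π hπ herr
  set w := PMF.uniformOfFintype (Leaf L)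
  have hL' : (1 : ℝ) ≤ L := by exact_mod_cast hL
  -- Without any observation at most half of the prior mass is declared correctly.
  have hhalf : ENNReal.ofReal (c * (1 / 2)) ≤ risk S θ w c π := by
    have h := le_sampleComplexity_add (S := S) (θ := θ) hπ 0
    have h2 : (2 : ℝ≥0∞) ^ 0 / 2 ^ L ≤ ENNReal.ofReal (1 / 2) := by
      rw [pow_zero, ENNReal.ofReal_div_of_pos two_pos, ENNReal.ofReal_one]
      refine ENNReal.div_le_div le_rfl ?_
      simpa using pow_le_pow_right₀ (one_le_two : (1 : ℝ≥0∞) ≤ 2) hL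
    simp only [zero_add, Nat.cast_one, one_mul] at h
    have h3 : ENNReal.ofReal (1 / 2) ≤ sampleComplexity S θ w π + errProb S θ w π := by
      have h4 : ENNReal.ofReal (1 / 2) + ENNReal.ofReal (1 / 2) ≤
          sampleComplexity S θ w π + errProb S θ w π + ENNReal.ofReal (1 / 2) := by
        rw [← ENNReal.ofReal_add (by norm_num) (by norm_num)]
        norm_num
        rw [add_assoc]
        refine h.trans (add_le_add_right (add_le_add_right ?_ _) _)
        simpa using h2
      exact (ENNReal.add_le_add_iff_right ENNReal.ofReal_ne_top).1 h4
    rw [ENNReal.ofReal_mul hc.le]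
    refine (mul_le_mul_right h3 _).trans ?_
    rw [mul_add, add_comm, risk]
    refine add_le_add_left (mul_le_of_le_one_left zero_le ?_) _
    simpa using hc1.le
  have hlarge : k ≤ L → ENNReal.ofReal (c * ((L - k : ℝ) * δ)) ≤ risk S θ w c π := by
    intro hkL
    obtain ⟨n, rfl⟩ := Nat.exists_eq_add_of_le hkL
    have h := le_sampleComplexity_add (S := S) (θ := θ) hπ n
    have hpow : (2 : ℝ≥0∞) ^ n / 2 ^ (k + n) ≤ ENNReal.ofReal δ := by
      refine le_trans (le_of_eq ?_) (ENNReal.ofReal_le_ofReal hk.le)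
      rw [ENNReal.ofReal_pow (by norm_num), ENNReal.ofReal_div_of_pos two_pos, pow_add,
        ENNReal.ofReal_one, ENNReal.div_eq_inv_mul,
        ENNReal.mul_inv (Or.inl (by simp)) (Or.inl (by simp)), mul_assoc,
        ENNReal.inv_mul_cancel (by simp) (by simp), mul_one, one_div, ENNReal.inv_pow]
      norm_num
    have herr' : errProb S θ w π ≤ ENNReal.ofReal (max ε 0) :=
      herr.trans (ENNReal.ofReal_le_ofReal (le_max_left _ _))
    have h2 : ((n + 1 : ℕ) : ℝ≥0∞) ≤ sampleComplexity S θ w π +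
        ENNReal.ofReal ((n + 1) * (1 - δ)) := by
      refine h.trans (add_le_add_right ?_ _)
      rw [ENNReal.ofReal_mul (by positivity)]
      refine mul_le_mul' (by rw [← ENNReal.ofReal_natCast]; simp) ?_
      refine (add_le_add herr' hpow).trans (le_of_eq ?_)
      rw [← ENNReal.ofReal_add (le_max_right _ _) hδ0.le]
      congr 1
      rw [hδ]
      ring
    have h1δ : 0 ≤ 1 - δ := by
      have := le_max_right ε 0
      linarith
    have h3 : ENNReal.ofReal (n * δ) ≤ sampleComplexity S θ w π := by
      have h4 : ENNReal.ofReal (n * δ) + ENNReal.ofReal ((n + 1) * (1 - δ)) ≤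
          sampleComplexity S θ w π + ENNReal.ofReal ((n + 1) * (1 - δ)) := by
        refine le_trans ?_ h2
        rw [← ENNReal.ofReal_add (by positivity) (by positivity), ← ENNReal.ofReal_natCast]
        refine ENNReal.ofReal_le_ofReal ?_
        push_cast
        linarith
      exact (ENNReal.add_le_add_iff_right ENNReal.ofReal_ne_top).1 h4
    refine le_trans ?_ (le_add_self : _ ≤ risk S θ w c π)
    rw [ENNReal.ofReal_mul hc.le]
    refine mul_le_mul_right (le_trans (le_of_eq ?_) h3) _
    push_cast
    ring_nf
  have key : ∀ x : ℝ, 1 / 2 ≤ x → (L - k : ℝ) * δ ≤ x → L ≤ (2 * k + 1 / δ) * x := by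
    intro x hx1 hx2
    have h1 : (k : ℝ) ≤ 2 * k * x := by
      have := mul_le_mul_of_nonneg_left hx1 (Nat.cast_nonneg (α := ℝ) k)
      linarith
    have h2 : (L - k : ℝ) ≤ 1 / δ * x := by
      rw [one_div, inv_mul_eq_div, le_div_iff₀ hδ0]
      exact hx2
    linarith
  have hfin : ∀ x : ℝ, 1 / 2 ≤ x → (L - k : ℝ) * δ ≤ x →
      ENNReal.ofReal (c * x) ≤ risk S θ w c π →
      ENNReal.ofReal (c * L) ≤ ENNReal.ofReal (2 * k + 1 / δ) * risk S θ w c π := by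
    intro x hx1 hx2 hx
    refine le_trans ?_ (mul_le_mul_right hx _)
    rw [← ENNReal.ofReal_mul (by positivity)]
    refine ENNReal.ofReal_le_ofReal ?_
    have := mul_le_mul_of_nonneg_left (key x hx1 hx2) hc.le
    linarith
  rcases le_total ((L - k : ℝ) * δ) (1 / 2) with h | h
  · exact hfin _ le_rfl h hhalf
  · refine hfin _ h le_rfl (hlarge ?_)
    by_contra! hlt
    have h1 : (L : ℝ) - k ≤ 0 := by
      have : (L : ℝ) ≤ k := by exact_mod_cast hlt.le
      linarith
    have := mul_nonpos_of_nonpos_of_nonneg h1 hδ0.le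
    linarith

end Counting

/-! ### Consequences of the risk bound -/

/-- The risk bound in the form used for vanishing cost: for a fixed tree everything but the
term `log (1 / c) / D` is bounded. -/
lemma riskBound_le_of_height {C B D c : ℝ} {L : ℕ} (hL : 1 ≤ L) (hc : 0 < c) :
    c * C * L + c * Real.log (L / c) / D + B * c ≤
      c * (|C * L + Real.log L / D + B| + 1 + -Real.log c / D) := by
  have hL0 : (L : ℝ) ≠ 0 := by positivity
  rw [Real.log_div hL0 hc.ne']
  have h := mul_le_mul_of_nonneg_left
    ((le_abs_self (C * L + Real.log L / D + B)).trans (lt_add_one _).le) hc.le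
  calc _ = c * (C * L + Real.log L / D + B) + c * (-Real.log c / D) := by ring
    _ ≤ _ := by rw [mul_add]; linarith

/-- For a fixed cost the risk bound is linear in the height of the tree. -/
lemma riskBound_le_of_cost {C B D Δ c : ℝ} {L : ℕ} (hL : 1 ≤ L) (hc : 0 < c) (hΔ : 0 < Δ)
    (hD : Δ ≤ D) :
    c * C * L + c * Real.log (L / c) / D + B * c ≤ (|C| + 1 / (c * Δ) + |B|) * (c * L) := by
  have hL1 : (1 : ℝ) ≤ L := by exact_mod_cast hL
  have hD0 := hΔ.trans_le hD
  have h1 : c * C * L ≤ |C| * (c * L) := by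
    have := mul_le_mul_of_nonneg_right (le_abs_self C) (by positivity : 0 ≤ c * L)
    linarith
  have h2 : c * Real.log (L / c) / D ≤ 1 / (c * Δ) * (c * L) := by
    calc c * Real.log (L / c) / D ≤ c * (L / c) / D := by
          gcongr
          exact Real.log_le_self (by positivity)
      _ ≤ c * (L / c) / Δ := by gcongr
      _ = _ := by field_simp
  have h3 : B * c ≤ |B| * (c * L) := by
    calc B * c ≤ |B| * c := by gcongr; exact le_abs_self B
      _ ≤ _ := by gcongr; exact le_mul_of_one_le_right hc.le hL1
  linarith

end HDS

theorem theorem1 {Y P : Type*} [MeasurableSpace Y] (S : HDS.Model Y P)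
    (Δ : ℝ) (hΔ : 0 < Δ) (hAS1 : S.KLSeparated Δ)
    (hfin : ∀ l, (S.Θ₁ l).Finite) (hne : ∀ l, (S.Θ₁ l).Nonempty)
    (hmom : ∀ θ ∈ S.Θ₁ 0, MemLp (S.llr 0 θ) 2 (S.law 0 θ))
    (est : ℕ → List Y → P) (hest : S.IsMLE est) :
    -- suitable sample sizes of the internal tests exist at every level
    (∀ l, ∀ q < (1 : ℝ), ∃ K₀ : ℕ, ∀ k ≥ K₀, HDS.InternalTestGood S est l k q) ∧
    -- they can be chosen bounded over the levels if the models are uniformly regular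
    (∀ (J : ℕ) (V : ℝ), (∀ l, (S.Θ₁ l).ncard ≤ J) →
      (∀ l, ∀ θ ∈ S.Θ₁ l,
        ∫⁻ y, ENNReal.ofReal (S.llr l θ y ^ 2) ∂(S.law l (S.θ₀ l)) ≤ ENNReal.ofReal V ∧
        ∫⁻ y, ENNReal.ofReal (S.llr l θ y ^ 2) ∂(S.law l θ) ≤ ENNReal.ofReal V) →
      ∀ q < (1 : ℝ), ∃ K₀ : ℕ, ∀ l, ∀ k ≥ K₀, HDS.InternalTestGood S est l k q) ∧
    -- performance of hierarchical dynamic search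
    ∃ n₀ : ℕ, ∀ N₀ ≥ n₀, ∀ (K : ℕ → ℕ) (η : ℝ), 0 < η → BddAbove (Set.range K) →
      (∀ l, HDS.InternalTestGood S est l (K l) (1 / 2 + η)) →
      -- the risk bound
      (∃ C B : ℝ, ∀ (L : ℕ), 1 ≤ L → ∀ (c : ℝ), 0 < c → c < 1 →
        ∀ (θ : ℕ → P), (∀ l, θ l ∈ S.Θ₁ l) → ∀ (prior : PMF (HDS.Leaf L)),
          (HDS.hds S est K N₀ c L).IsMeasurable ∧
          0 < S.kl 0 (θ 0) (S.θ₀ 0) ∧ S.kl 0 (θ 0) (S.θ₀ 0) < ⊤ ∧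
          HDS.risk S θ prior c (HDS.hds S est K N₀ c L) ≤
            ENNReal.ofReal (c * C * L
              + c * Real.log (L / c) / (S.kl 0 (θ 0) (S.θ₀ 0)).toReal + B * c)) ∧
      -- asymptotic optimality in `c`
      (∀ (L : ℕ), 1 ≤ L → ∀ (θ : ℕ → P), (∀ l, θ l ∈ S.Θ₁ l) →
        ∀ (prior : PMF (HDS.Leaf L)), (∀ m, prior m ≠ 0) →
        S.kl 0 (S.θ₀ 0) (θ 0) ≤ S.kl 0 (θ 0) (S.θ₀ 0) →
        Filter.Tendsto
          (fun c : ℝ => HDS.risk S θ prior c (HDS.hds S est K N₀ c L) /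
            HDS.optRisk S θ prior c)
          (nhdsWithin 0 (Set.Ioi 0)) (nhds 1)) ∧
      -- order optimality in the number `2 ^ L` of processes
      (∀ (c : ℝ), 0 < c → c < 1 → ∀ ε < (1 : ℝ), ∃ B : ℝ, ∀ (L : ℕ), 1 ≤ L →
        ∀ (θ : ℕ → P), (∀ l, θ l ∈ S.Θ₁ l) → ∀ (π : HDS.Policy L Y), π.IsMeasurable →
        HDS.errProb S θ (PMF.uniformOfFintype (HDS.Leaf L)) π ≤ ENNReal.ofReal ε →
        HDS.risk S θ (PMF.uniformOfFintype (HDS.Leaf L)) c (HDS.hds S est K N₀ c L) ≤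
          ENNReal.ofReal B * HDS.risk S θ (PMF.uniformOfFintype (HDS.Leaf L)) c π) := by
  refine ⟨fun l q hq => hest.exists_internalTestGood (hfin l) hΔ hAS1 hq,
    fun J V hJ hV q hq => hest.exists_internalTestGood_uniform hfin hΔ hAS1 hJ
      (fun l θ hθ => (hV l θ hθ).1) hq, ?_⟩
  obtain ⟨n₀, hn₀⟩ := hest.exists_hds_risk_le hfin hne hΔ hAS1 hmom
  refine ⟨n₀, fun N₀ hN₀ K η hη hK hgood => ?_⟩
  obtain ⟨C, B, hrisk⟩ := hn₀ N₀ hN₀ K η hη hK hgood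
  have hkl : ∀ θ ∈ S.Θ₁ 0, Δ ≤ (S.kl 0 θ (S.θ₀ 0)).toReal := fun θ hθ =>
    HDS.toReal_kl_leaf_ge hAS1 hθ (hmom θ hθ)
  have htop : ∀ θ ∈ S.Θ₁ 0, S.kl 0 θ (S.θ₀ 0) ≠ ⊤ := fun θ hθ => S.kl_leaf_ne_top (hmom θ hθ)
  refine ⟨⟨C, B, fun L hL c hc hc1 θ hθ prior => ⟨HDS.hds_isMeasurable hest hfin K N₀ c L,
    (ENNReal.ofReal_pos.2 hΔ).trans_le (hAS1 0 _ (hθ 0)).2, (htop _ (hθ 0)).lt_top,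
    hrisk L hL c hc hc1 θ hθ prior⟩⟩, fun L hL θ hθ prior hprior hle => ?_,
    fun c hc hc1 ε hε => ?_⟩
  · refine HDS.tendsto_risk_div_optRisk hL hprior hle (htop _ (hθ 0))
      (hΔ.trans_le (hkl _ (hθ 0))) (fun c => HDS.hds_isMeasurable hest hfin K N₀ c L)
      (by positivity) fun c hc hc1 => (hrisk L hL c hc hc1 θ hθ prior).trans
        (ENNReal.ofReal_le_ofReal (HDS.riskBound_le_of_height hL hc))
  · obtain ⟨M, hM, hlow⟩ := HDS.exists_height_le_risk S hε
    refine ⟨(|C| + 1 / (c * Δ) + |B|) * M, fun L hL θ hθ π hπ herr => ?_⟩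
    refine (hrisk L hL c hc hc1 θ hθ _).trans ((ENNReal.ofReal_le_ofReal
      (HDS.riskBound_le_of_cost hL hc hΔ (hkl _ (hθ 0)))).trans ?_)
    rw [ENNReal.ofReal_mul (q := c * L) (by positivity), ENNReal.ofReal_mul (q := M) (by positivity),
      mul_assoc]
    exact mul_le_mul_right (hlow c hc hc1 L hL θ π hπ herr) _
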